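/- Fix integers $L\ge 2$, $N\ge 1$ and complex constants $\vec\kappa=(e_0,\dots,e_{L-1},\kappa_0,\dots,\kappa_{L-1},\theta_0,\dots,\theta_N)$ with $\sum_{n}e_n=\frac{L-1}{2}$ and $\sum_n\kappa_n=\sum_i\theta_i$. Let $\mathcal H_{L,N}(\vec\kappa)$ be the Hamiltonian system $$\frac{\partial q_n^{(i)}}{\partial s_j}=\frac{\partial H_j}{\partial p_n^{(i)}},\qquad \frac{\partial p_n^{(i)}}{\partial s_j}=-\frac{\partial H_j}{\partial q_n^{(i)}}\qquad(1\le i,j\le N,\ 1\le n\le L-1),$$ $$s_iH_i=\sum_{n=0}^{L-1}e_nq_n^{(i)}p_n^{(i)}+\sum_{j=0}^N\sum_{0\le m<n\le L-1}q_m^{(i)}p_m^{(j)}q_n^{(j)}p_n^{(i)}+\sum_{0\le j\le N,\,j\ne i}\frac{s_j}{s_i-s_j}\sum_{m,n=0}^{L-1}q_m^{(i)}p_m^{(j)}q_n^{(j)}p_n^{(i)},$$ where $s_0=q_n^{(0)}=q_0^{(i)}=1$, $p_n^{(0)}=\kappa_n-\sum_{i=1}^Nq_n^{(i)}p_n^{(i)}$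 ($n\geq 1$), $p_0^{(i)}=\theta_i-\sum_{n=1}^{L-1}q_n^{(i)}p_n^{(i)}$ ($0\le i\le N$), and $s_0,\dots,s_N$ are non-zero and pairwise distinct. Extend the suffix to $n\in\mathbb Z$ by $q_{n+L}^{(i)}=s_iq_n^{(i)}$, $p_{n+L}^{(i)}=p_n^{(i)}/s_i$, $e_{n+L}=e_n+1$, $\kappa_{n+L}=\kappa_n$. Put $\Gamma_{\vec\kappa}=\sum_{i=1}^N\bigl(\sum_{n=1}^{L-1}dp_n^{(i)}\wedge dq_n^{(i)}-dH_i\wedge ds_i\bigr)$. **Theorem.** For each of the transformations $\eta_i$ ($0\le i\le N$), $\zeta_{ij}$ ($0\le i\neq j\le N$) and $\iota$ below, acting on the parameters by $\vec\kappa\mapsto\vec\kappa'$, the relations above hold for $\vec\kappa'$ as well, and the action on $(s,q,p)$ is birational (it is given by an automorphism of the field $\mathbb C(s,q,p)$), canonical (on the set where its formulas are defined, it pulls $\Gamma_{\vec\kappa'}$ back to $\Gamma_{\vec\kappa}$), and carries $\mathcal H_{L,N}(\vec\kappa)$ into $\mathcal H_{L,N}(\vec\kappa')$ (it maps holomorphic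 solutions along which the formulas are defined to solutions). Action on the parameters (those not written are fixed): - $\eta_i:\ e_n\mapsto e_{n-1}+\frac1L,\ \kappa_n\mapsto\kappa_n-e_n+e_{n-1},\ \theta_i\mapsto\theta_i-1$. - $\zeta_{ij}:\ \theta_i\leftrightarrow\theta_j$. - $\iota:\ e_n\mapsto-e_{L-n}+1,\ \kappa_n\mapsto-\kappa_{L-n},\ \theta_i\mapsto-\theta_i$ (all $i$). Action on the variables (those not written are fixed): - $\eta_i$: for all $j$, $$\eta_i(q_n^{(j)})=\frac{\left(\sum_{m=1}^Lp_{-m}^{(i)}\right)\left(\sum_{m=1}^Lp_{n-m}^{(i)}q_{n-m}^{(j)}\right)}{\left(\sum_{m=1}^Lp_{n-m}^{(i)}\right)\left(\sum_{m=1}^Lp_{-m}^{(i)}q_{-m}^{(j)}\right)},$$ $$\eta_i(p_n^{(j)})=\frac1{\eta_i(q_n^{(j)})}\frac{s_j}{s_i-s_j}\left(\frac{p_n^{(j)}}{p_n^{(i)}}-\frac{p_{n-1}^{(j)}}{p_{n-1}^{(i)}}\right)\sum_{m=1}^Lp_{n-m}^{(i)}q_{n-m}^{(j)}\quad(j\ne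 i),$$ $$\eta_i(p_n^{(i)})=\frac1{\eta_i(q_n^{(i)})}\Bigl(\kappa_n-e_n+e_{n-1}-\sum_{0\le j\le N,\,j\ne i}\eta_i(q_n^{(j)})\,\eta_i(p_n^{(j)})\Bigr).$$ Here $\sum_{m=1}^Lp_{n-m}^{(i)}q_{n-m}^{(i)}=\theta_i$ for every $n$, and this constant is cancelled in the first formula (for $j=i$; and, if $i=0$, also in the factor $\sum_mp_{-m}^{(0)}/\sum_mp_{n-m}^{(0)}=\theta_0/\theta_0$), so that $\theta_i=0$ is allowed. If $\theta_i\ne0$, the three formulas hold as displayed for all $0\le j\le N$ and $0\le n\le L-1$, the left-hand sides for $j=0$ or $n=0$ being computed from the new canonical variables and parameters by the conventions above. - $\zeta_{ij}$ ($i,j\ne0$): $s_i\leftrightarrow s_j$, $q_n^{(i)}\leftrightarrow q_n^{(j)}$, $p_n^{(i)}\leftrightarrow p_n^{(j)}$. - $\zeta_{i0}=\zeta_{0i}$: $s_i\mapsto\frac1{s_i}$, $q_n^{(i)}\mapsto\frac1{q_n^{(i)}}$, $p_n^{(i)}\mapsto q_n^{(i)}p_n^{(0)}$, and for $j\ne 0,i$: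 $s_j\mapsto\frac{s_j}{s_i}$, $q_n^{(j)}\mapsto\frac{q_n^{(j)}}{q_n^{(i)}}$, $p_n^{(j)}\mapsto q_n^{(i)}p_n^{(j)}$. - $\iota:\ q_n^{(i)}\mapsto\dfrac{s_ip_{L-n}^{(i)}p_0^{(0)}}{p_{L-n}^{(0)}p_0^{(i)}},\quad p_n^{(i)}\mapsto-\dfrac{q_{L-n}^{(i)}p_0^{(i)}p_{L-n}^{(0)}}{s_ip_0^{(0)}}$. Moreover, the automorphisms $\zeta_{ij}$ of $\mathbb C(s,q,p)$ generate a group isomorphic to the symmetric group $\mathfrak S_{N+1}$ of $\{0,\dots,N\}$, with $\zeta_{ij}$ corresponding to the transposition $(i\,j)$. -/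

import Mathlib

namespace HLN

/-- The indices `1, …, L - 1`. -/
abbrev Idx (L : ℕ) [NeZero L] : Type := {n : Fin L // n ≠ 0}

/-- The constant parameters `(e₀, …, e_{L-1}, κ₀, …, κ_{L-1}, θ₀, …, θ_N)`. -/
@[ext]
structure Params (L N : ℕ) where
  e : Fin L → ℂ
  k : Fin L → ℂ
  θ : Fin (N + 1) → ℂ

/-- The coordinates `(s_i, q_n^{(i)}, p_n^{(i)})`, `1 ≤ i ≤ N`, `1 ≤ n ≤ L - 1`, with values in `F`.
An index `i : Fin N` stands for the index `i.succ ∈ {1, …, N}`. -/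
abbrev Phase (L N : ℕ) [NeZero L] (F : Type) : Type :=
  (Fin N → F) × (Fin N → Idx L → F) × (Fin N → Idx L → F)

noncomputable section

section Extended

variable {L N : ℕ} [NeZero L]

/-- The residue of an integer modulo `L`. -/
def res (L : ℕ) [NeZero L] (n : ℤ) : Fin L := Fin.ofNat L (n % (L : ℤ)).toNat

/-- `e_n` for `n ∈ ℤ`: `e_{n+L} = e_n + 1`. -/
def eExt (κ : Params L N) (n : ℤ) : ℂ := κ.e (res L n) + ((n / (L : ℤ) : ℤ) : ℂ)

/-- `κ_n` for `n ∈ ℤ`: `κ_{n+L} = κ_n`. -/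
def kExt (κ : Params L N) (n : ℤ) : ℂ := κ.k (res L n)

/-- The relations `∑ e_n = (L-1)/2` and `∑ κ_n = ∑ θ_i`. -/
def Params.Admissible (κ : Params L N) : Prop :=
  ∑ n, κ.e n = ((L : ℂ) - 1) / 2 ∧ ∑ n, κ.k n = ∑ i, κ.θ i

variable {F : Type} [Field F] [Algebra ℂ F]

/-- `s_i` for `0 ≤ i ≤ N`, with `s_0 = 1`. -/
def sB (x : Phase L N F) (i : Fin (N + 1)) : F := Fin.cases 1 x.1 i

/-- `q_n^{(i)}` for `0 ≤ i ≤ N`, `0 ≤ n ≤ L-1`, with `q_n^{(0)} = q_0^{(i)} = 1`. -/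
def qB (x : Phase L N F) (i : Fin (N + 1)) (n : Fin L) : F :=
  if h : n = 0 then 1 else Fin.cases 1 (fun a => x.2.1 a ⟨n, h⟩) i

/-- `p_n^{(i)}` for `0 ≤ i ≤ N`, `1 ≤ n ≤ L-1`, with
`p_n^{(0)} = κ_n - ∑_{i=1}^N q_n^{(i)} p_n^{(i)}`. -/
def pPos (κ : Params L N) (x : Phase L N F) (i : Fin (N + 1)) (n : Idx L) : F :=
  Fin.cases (algebraMap ℂ F (κ.k n) - ∑ a : Fin N, x.2.1 a n * x.2.2 a n)
    (fun a => x.2.2 a n) i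

/-- `p_n^{(i)}` for `0 ≤ i ≤ N`, `0 ≤ n ≤ L-1`, with
`p_0^{(i)} = θ_i - ∑_{n=1}^{L-1} q_n^{(i)} p_n^{(i)}`. -/
def pB (κ : Params L N) (x : Phase L N F) (i : Fin (N + 1)) (n : Fin L) : F :=
  if h : n = 0 then algebraMap ℂ F (κ.θ i) - ∑ m : Idx L, qB x i m * pPos κ x i m
  else pPos κ x i ⟨n, h⟩

/-- `q_n^{(i)}` for `n ∈ ℤ`: `q_{n+L}^{(i)} = s_i q_n^{(i)}`. -/
def qE (x : Phase L N F) (i : Fin (N + 1)) (n : ℤ) : F :=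
  sB x i ^ (n / (L : ℤ)) * qB x i (res L n)

/-- `p_n^{(i)}` for `n ∈ ℤ`: `p_{n+L}^{(i)} = p_n^{(i)} / s_i`. -/
def pE (κ : Params L N) (x : Phase L N F) (i : Fin (N + 1)) (n : ℤ) : F :=
  pB κ x i (res L n) / sB x i ^ (n / (L : ℤ))

/-- The Hamiltonian function `H_i` (the sum `∑_{0 ≤ m < n ≤ L-1}` is over `n` and `m ∈ Iio n`). -/
def hamiltonian (κ : Params L N) (i : Fin N) (x : Phase L N F) : F :=
  (1 / sB x i.succ) *
    (∑ n : Fin L, algebraMap ℂ F (κ.e n) * qB x i.succ n * pB κ x i.succ n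
      + ∑ j : Fin (N + 1), ∑ n : Fin L, ∑ m ∈ Finset.Iio n,
          qB x i.succ m * pB κ x j m * qB x j n * pB κ x i.succ n
      + ∑ j ∈ Finset.univ.erase i.succ,
          sB x j / (sB x i.succ - sB x j) *
            ∑ m : Fin L, ∑ n : Fin L,
              qB x i.succ m * pB κ x j m * qB x j n * pB κ x i.succ n)

/-- `s_0 = 1, s_1, …, s_N` are non-zero and pairwise distinct. -/
def Regular (x : Phase L N F) : Prop :=
  (∀ i, sB x i ≠ 0) ∧ Function.Injective (sB x)

end Extended

section System

variable {L N : ℕ} [NeZero L]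

/-- A holomorphic solution on `U` of the Hamiltonian system
`∂q_n^{(i)}/∂s_j = ∂H_j/∂p_n^{(i)}`, `∂p_n^{(i)}/∂s_j = -∂H_j/∂q_n^{(i)}` with parameters `κ`. -/
structure IsSolution (κ : Params L N) (U : Set (Fin N → ℂ))
    (q p : (Fin N → ℂ) → Fin N → Idx L → ℂ) : Prop where
  isOpen : IsOpen U
  regular : ∀ s ∈ U, Regular ((s, q s, p s) : Phase L N ℂ)
  diff_q : DifferentiableOn ℂ q U
  diff_p : DifferentiableOn ℂ p U
  eq_q : ∀ s ∈ U, ∀ (i j : Fin N) (n : Idx L),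
    fderiv ℂ q s (Pi.single j 1) i n =
      fderiv ℂ (hamiltonian κ j) ((s, q s, p s) : Phase L N ℂ)
        (0, 0, Pi.single i (Pi.single n 1))
  eq_p : ∀ s ∈ U, ∀ (i j : Fin N) (n : Idx L),
    fderiv ℂ p s (Pi.single j 1) i n =
      - fderiv ℂ (hamiltonian κ j) ((s, q s, p s) : Phase L N ℂ)
        (0, Pi.single i (Pi.single n 1), 0)

/-- The fundamental 2-form `Γ = ∑ dp_n^{(i)} ∧ dq_n^{(i)} - ∑ dH_i ∧ ds_i` at the point `x`,
evaluated on two tangent vectors. -/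
def fundamentalForm (κ : Params L N) (x v w : Phase L N ℂ) : ℂ :=
  (∑ i : Fin N, ∑ n : Idx L, (v.2.2 i n * w.2.1 i n - w.2.2 i n * v.2.1 i n))
    - ∑ i : Fin N, (fderiv ℂ (hamiltonian κ i) x v * w.1 i
        - fderiv ℂ (hamiltonian κ i) x w * v.1 i)

/-- The names of the coordinates `s_i`, `q_n^{(i)}`, `p_n^{(i)}`. -/
abbrev Coord (L N : ℕ) [NeZero L] : Type := Fin N ⊕ (Fin N × Idx L) ⊕ (Fin N × Idx L)

/-- The field `ℂ(s, q, p)` of rational functions in the coordinates. -/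
abbrev RatField (L N : ℕ) [NeZero L] : Type := FractionRing (MvPolynomial (Coord L N) ℂ)

/-- A coordinate, as an element of `ℂ(s, q, p)`. -/
def coordFn (c : Coord L N) : RatField L N :=
  algebraMap (MvPolynomial (Coord L N) ℂ) (RatField L N) (MvPolynomial.X c)

/-- The generic point, whose coordinates are the coordinate functions. -/
def generic (L N : ℕ) [NeZero L] : Phase L N (RatField L N) :=
  (fun i => coordFn (.inl i), fun i n => coordFn (.inr (.inl (i, n))),
    fun i n => coordFn (.inr (.inr (i, n))))

/-- A transformation of the variables `(s, q, p)` given by formulas that make sense over every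
extension field of `ℂ`, together with the domain on which the formulas are used. -/
structure Transf (L N : ℕ) [NeZero L] where
  toFun : ∀ (F : Type) [Field F] [Algebra ℂ F], Phase L N F → Phase L N F
  Dom : ∀ (F : Type) [Field F] [Algebra ℂ F], Phase L N F → Prop

/-- The automorphism `σ` of `ℂ(s, q, p)` maps each coordinate function to its image under `T`. -/
def Transf.Realizes (T : Transf L N) (σ : RatField L N ≃ₐ[ℂ] RatField L N) : Prop :=
  (fun i => σ ((generic L N).1 i), fun i n => σ ((generic L N).2.1 i n),
    fun i n => σ ((generic L N).2.2 i n)) = T.toFun (RatField L N) (generic L N)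

/-- `T` is a birational canonical transformation that carries the Hamiltonian system with
parameters `κ` into the one with parameters `κ'`. -/
structure Transf.IsSymmetry (T : Transf L N) (κ κ' : Params L N) : Prop where
  /-- No denominator vanishes identically. -/
  dom_generic : T.Dom (RatField L N) (generic L N)
  /-- The transformation is birational. -/
  birational : ∃ σ : RatField L N ≃ₐ[ℂ] RatField L N, T.Realizes σ
  differentiable : ∀ x : Phase L N ℂ, T.Dom ℂ x → DifferentiableAt ℂ (T.toFun ℂ) x
  /-- The transformation is canonical: the pull-back of `Γ_{κ'}` is `Γ_κ`. -/
  canonical : ∀ x : Phase L N ℂ, T.Dom ℂ x → ∀ v w : Phase L N ℂ,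
    fundamentalForm κ' (T.toFun ℂ x) (fderiv ℂ (T.toFun ℂ) x v) (fderiv ℂ (T.toFun ℂ) x w)
      = fundamentalForm κ x v w
  /-- The system is invariant: if `(q, p)` is a solution for `κ`, then its transform `(q', p')`, as
  a function of the transformed times, is a solution for `κ'`. -/
  maps_solutions : ∀ (U : Set (Fin N → ℂ)) (q p : (Fin N → ℂ) → Fin N → Idx L → ℂ),
    IsSolution κ U q p → (∀ s ∈ U, T.Dom ℂ (s, q s, p s)) →
    ∀ q' p' : (Fin N → ℂ) → Fin N → Idx L → ℂ,
      (∀ s ∈ U, q' (T.toFun ℂ (s, q s, p s)).1 = (T.toFun ℂ (s, q s, p s)).2.1 ∧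
        p' (T.toFun ℂ (s, q s, p s)).1 = (T.toFun ℂ (s, q s, p s)).2.2) →
      IsSolution κ' ((fun s => (T.toFun ℂ (s, q s, p s)).1) '' U) q' p'

end System

section Eta

variable {L N : ℕ} [NeZero L]

/-- Action of `η_i` on the parameters. -/
def etaParams (i : Fin (N + 1)) (κ : Params L N) : Params L N where
  e n := eExt κ ((n : ℕ) - 1) + 1 / (L : ℂ)
  k n := κ.k n - κ.e n + eExt κ ((n : ℕ) - 1)
  θ := Function.update κ.θ i (κ.θ i - 1)

variable {F : Type} [Field F] [Algebra ℂ F]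

/-- `∑_{m=1}^L p_{n-m}^{(i)}`. -/
def etaA (κ : Params L N) (i : Fin (N + 1)) (x : Phase L N F) (n : ℤ) : F :=
  ∑ m ∈ Finset.Icc 1 L, pE κ x i (n - (m : ℤ))

/-- `∑_{m=1}^L p_{n-m}^{(i)} q_{n-m}^{(j)}`. -/
def etaB (κ : Params L N) (i : Fin (N + 1)) (x : Phase L N F) (n : ℤ) (j : Fin (N + 1)) : F :=
  ∑ m ∈ Finset.Icc 1 L, pE κ x i (n - (m : ℤ)) * qE x j (n - (m : ℤ))

/-- The quotient `etaB n j / etaB 0 j`. For `j = i` numerator and denominator are both equal to the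
constant `θ_i`, and the quotient is taken in lowest terms, so that `θ_i = 0` is allowed. -/
def etaRatio (κ : Params L N) (i : Fin (N + 1)) (x : Phase L N F) (n : ℤ) (j : Fin (N + 1)) : F :=
  if j = i then 1 else etaB κ i x n j / etaB κ i x 0 j

/-- `η_i(q_n^{(j)})`; note that `etaA n = etaB n 0`, because `q_m^{(0)} = 1` for all `m`. -/
def etaQ (κ : Params L N) (i : Fin (N + 1)) (x : Phase L N F) (n : Fin L) (j : Fin (N + 1)) : F :=
  etaRatio κ i x (n : ℕ) j / etaRatio κ i x (n : ℕ) 0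

/-- `q ↦ (1/q) s_j/(s_i-s_j) (p_n^{(j)}/p_n^{(i)} - p_{n-1}^{(j)}/p_{n-1}^{(i)})
∑_{m=1}^L p_{n-m}^{(i)} q_{n-m}^{(j)}`. -/
def etaPExpr (κ : Params L N) (i : Fin (N + 1)) (x : Phase L N F) (n : Fin L) (j : Fin (N + 1))
    (q : F) : F :=
  1 / q * (sB x j / (sB x i - sB x j)) *
    (pE κ x j (n : ℕ) / pE κ x i (n : ℕ) - pE κ x j ((n : ℕ) - 1) / pE κ x i ((n : ℕ) - 1)) *
    etaB κ i x (n : ℕ) j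

/-- `η_i(p_n^{(j)})`. -/
def etaP (κ : Params L N) (i : Fin (N + 1)) (x : Phase L N F) (n : Fin L) (j : Fin (N + 1)) : F :=
  if j = i then
    1 / etaQ κ i x n i * (algebraMap ℂ F (κ.k n - κ.e n + eExt κ ((n : ℕ) - 1)) -
      ∑ a ∈ Finset.univ.erase i, etaQ κ i x n a * etaPExpr κ i x n a (etaQ κ i x n a))
  else etaPExpr κ i x n j (etaQ κ i x n j)

/-- Action of `η_i` on the variables. -/
def eta (κ : Params L N) (i : Fin (N + 1)) : Transf L N where
  toFun _ _ _ x :=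
    (x.1, fun a n => etaQ κ i x n a.succ, fun a n => etaP κ i x n a.succ)
  Dom _ _ _ x := Regular x ∧ (∀ n : Fin L, pB κ x i n ≠ 0) ∧
    ∀ j, j ≠ i → ∀ n : Fin L, etaB κ i x (n : ℕ) j ≠ 0

/-- The displayed formulas for `η_i` hold at the point `x`, for all `q_n^{(j)}` and `p_n^{(j)}` with
`0 ≤ j ≤ N`, `0 ≤ n ≤ L-1`. -/
def EtaFormulas (κ : Params L N) (i : Fin (N + 1)) (x : Phase L N F) : Prop :=
  let y := (eta κ i).toFun F x
  let κ' := etaParams i κ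
  ∀ n : Fin L,
    (∀ j, qB y j n =
      (etaA κ i x 0 * etaB κ i x (n : ℕ) j) / (etaA κ i x (n : ℕ) * etaB κ i x 0 j)) ∧
    (∀ j, j ≠ i → pB κ' y j n = etaPExpr κ i x n j (qB y j n)) ∧
    pB κ' y i n = 1 / qB y i n * (algebraMap ℂ F (κ.k n - κ.e n + eExt κ ((n : ℕ) - 1)) -
      ∑ j ∈ Finset.univ.erase i, qB y j n * pB κ' y j n)

end Eta

section Zeta

variable {L N : ℕ} [NeZero L]

/-- Action of `ζ_{ij}` on the parameters. -/
def zetaParams (i j : Fin (N + 1)) (κ : Params L N) : Params L N where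
  e := κ.e
  k := κ.k
  θ l := κ.θ (Equiv.swap i j l)

/-- Action of `ζ_{ij}`, `i, j ≠ 0`, on the variables. -/
def zetaSwap (κ : Params L N) (i j : Fin (N + 1)) : Transf L N where
  toFun _ _ _ x :=
    (fun a => sB x (Equiv.swap i j a.succ),
      fun a n => qB x (Equiv.swap i j a.succ) n,
      fun a n => pB κ x (Equiv.swap i j a.succ) n)
  Dom _ _ _ x := Regular x

/-- Action of `ζ_{i0} = ζ_{0i}`, `i ≠ 0`, on the variables. -/
def zetaZero (κ : Params L N) (i : Fin (N + 1)) : Transf L N where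
  toFun _ _ _ x :=
    (fun a => if a.succ = i then 1 / sB x i else x.1 a / sB x i,
      fun a n => if a.succ = i then 1 / qB x i n else x.2.1 a n / qB x i n,
      fun a n => if a.succ = i then qB x i n * pB κ x 0 n else qB x i n * x.2.2 a n)
  Dom _ _ _ x := Regular x ∧ ∀ n : Fin L, qB x i n ≠ 0

/-- Action of `ζ_{ij}`, `i ≠ j`, on the variables. -/
def zeta (κ : Params L N) (i j : Fin (N + 1)) : Transf L N :=
  if i = 0 then zetaZero κ j else if j = 0 then zetaZero κ i else zetaSwap κ i j

/-- The group generated by the `ζ_{ij}`, as a group of automorphisms of `ℂ(s, q, p)`. (The formulas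
for `ζ_{ij}` contain only the parameters `κ_n`, which no `ζ_{ij}` changes.) -/
def zetaGroup (κ : Params L N) : Subgroup (RatField L N ≃ₐ[ℂ] RatField L N) :=
  Subgroup.closure {σ | ∃ i j, i ≠ j ∧ (zeta κ i j).Realizes σ}

end Zeta

section Iota

variable {L N : ℕ} [NeZero L]

/-- Action of `ι` on the parameters. -/
def iotaParams (κ : Params L N) : Params L N where
  e n := - eExt κ ((L : ℤ) - (n : ℕ)) + 1
  k n := - kExt κ ((L : ℤ) - (n : ℕ))
  θ i := - κ.θ i

/-- Action of `ι` on the variables. -/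
def iota (κ : Params L N) : Transf L N where
  toFun _ _ _ x :=
    (x.1,
      fun a n =>
        sB x a.succ * pE κ x a.succ ((L : ℤ) - ((n : Fin L) : ℕ)) * pE κ x 0 0 /
          (pE κ x 0 ((L : ℤ) - ((n : Fin L) : ℕ)) * pE κ x a.succ 0),
      fun a n =>
        - (qE x a.succ ((L : ℤ) - ((n : Fin L) : ℕ)) * pE κ x a.succ 0 *
            pE κ x 0 ((L : ℤ) - ((n : Fin L) : ℕ)) / (sB x a.succ * pE κ x 0 0)))
  Dom _ _ _ x := Regular x ∧ (∀ n : Fin L, pB κ x 0 n ≠ 0) ∧ ∀ i, pB κ x i 0 ≠ 0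

end Iota

end

end HLN

/-! The proof works in the redundant variables `q_n^{(j)}`, `p_n^{(j)}` with `0 ≤ j ≤ N`, `0 ≤ n <
L`. There the conventions become the normalization `s_0 = q^{(0)} = q_0 = 1` together with the row
relations `∑_n q_n^{(j)} p_n^{(j)} = θ_j` and the column relations `∑_j q_n^{(j)} p_n^{(j)} = κ_n`,
and conversely these determine the extended variables (`extended_eq`). The Hamiltonians and the
2-form are written over all indices (`hamSum`, `form`).

The key point is invariance under the scaling `s_j ↦ c s_j`, `q ↦ a_j b_n q`, `p ↦ p / (a_j b_n)`,
even when `a`, `b`, `c` are functions (`form_gauge`). The corrections to the 2-form are `∑ d(q p) ∧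
dlog a_j`, `∑ d(q p) ∧ dlog b_n` and `∑ d(s_j H_j) ∧ dlog c`. The first two vanish by the row and
column relations, the third because `∑ s_j H_j` is constant (`two_mul_sum_hamSum`). So each
transformation need only be understood up to scaling.

Up to scaling, `ζ_{ij}` is a relabelling and `ι` is the reflection `q_n ↦ p_{L-n}`, `p_n ↦
-q_{L-n}`. For `η_i`, scale so that `p^{(i)} = s_i = 1`; for `j ≠ i` the new `q^{(j)}` is then a
quasi-periodic antiderivative of the old one, and the new `p^{(j)}` is minus the difference of the
shifted old one (`DiffPair`). Each Hamiltonian is rewritten through quasi-periodic antiderivatives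
of the products `q_n^{(j)} p_n^{(k)}` (`hamSum_eq_of_antideriv`), and summation by parts compares
old and new (`DiffPair.hamSum_eq`, `hamSum_reflect`). The boundary term produced by `e_{n+L} = e_n +
1` cancels the boundary term of `∑ dp ∧ dq` (`form_diffPair`, `form_reflect`).

Solutions are the sections whose tangent vectors are orthogonal under `Γ` to the vertical vectors
(`hamilton_iff`). A canonical map whose action on the times depends on the times alone acts
bijectively on vertical vectors, so it preserves this property. For birationality it suffices to
recover the old coordinates rationally from the new ones, by a transcendence degree argument
(`exists_algEquiv_of_generate`). Denominators are shown not to vanish identically by evaluation at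
explicit complex points (`Specializes`). -/

namespace HLN

open Finset

/-! ### The Hamiltonian as a sum of products: antiderivatives, scaling, relabelling. -/

section HamSum

variable {F : Type*} [Field F] {ι : Type*} [Fintype ι] [DecidableEq ι]

/-- `s_j H_j` as a function of all the variables `s_j`, `q_n^{(j)}`, `p_n^{(j)}`, with the indices
`n` in `{0, …, L - 1}` and `j` in an arbitrary finite set. -/
def hamSum (L : ℕ) (e : ℕ → F) (s : ι → F) (q p : ι → ℕ → F) (j : ι) : F :=
  ∑ n ∈ range L, e n * q j n * p j n
    + ∑ k, ∑ n ∈ range L, ∑ m ∈ range n, q j m * p k m * q k n * p j n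
    + ∑ k ∈ univ.erase j, s k / (s j - s k) *
        ∑ m ∈ range L, ∑ n ∈ range L, q j m * p k m * q k n * p j n

/-- The condition `s k * g k L = s j * g k 0` fixes the constant of summation of `g k` as `s k / (s
j - s k)` times the full sum, which is the rational coefficient in the Hamiltonian. So for `k ≠ j`
the ordered double sum and the rational term merge into `g k n`, and a change of variables can be
tested on antiderivatives. -/
theorem hamSum_eq_of_antideriv {L : ℕ} {e : ℕ → F} {s : ι → F} {q p : ι → ℕ → F} {j : ι}
    (hs : ∀ k, k ≠ j → s k ≠ s j) (g : ι → ℕ → F)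
    (hg : ∀ k, k ≠ j → ∀ n < L, g k (n + 1) = g k n + q j n * p k n)
    (hgL : ∀ k, k ≠ j → s k * g k L = s j * g k 0) :
    hamSum L e s q p j = ∑ n ∈ range L, p j n * (e n * q j n + ∑ k ∈ univ.erase j, g k n * q k n
      + (∑ m ∈ range n, q j m * p j m) * q j n) := by
  have key : ∀ k, k ≠ j → ∀ n ≤ L, g k n = ∑ m ∈ range n, q j m * p k m
      + s k / (s j - s k) * ∑ m ∈ range L, q j m * p k m := by
    intro k hk
    have h0 : ∀ n ≤ L, g k n = g k 0 + ∑ m ∈ range n, q j m * p k m := by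
      intro n
      induction n with
      | zero => simp
      | succ n ih =>
        intro h
        rw [hg k hk n h, ih (by omega), sum_range_succ, add_assoc]
    have hsk : s j - s k ≠ 0 := sub_ne_zero.2 (Ne.symm (hs k hk))
    have h1 := hgL k hk
    rw [h0 L le_rfl] at h1
    intro n hn
    rw [h0 n hn]
    have : g k 0 = s k / (s j - s k) * ∑ m ∈ range L, q j m * p k m := by
      field_simp
      linear_combination -h1
    rw [this]; ring
  have hR : ∀ n ∈ range L, p j n * (e n * q j n + ∑ k ∈ univ.erase j, g k n * q k n
      + (∑ m ∈ range n, q j m * p j m) * q j n) =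
      e n * q j n * p j n + (∑ m ∈ range n, q j m * p j m * q j n * p j n
        + ∑ k ∈ univ.erase j, ∑ m ∈ range n, q j m * p k m * q k n * p j n)
      + ∑ k ∈ univ.erase j, s k / (s j - s k) *
        ∑ m ∈ range L, q j m * p k m * q k n * p j n := by
    intro n hn
    have hn' : n ≤ L := (mem_range.1 hn).le
    have : ∑ k ∈ univ.erase j, g k n * q k n = ∑ k ∈ univ.erase j,
        ((∑ m ∈ range n, q j m * p k m) * q k n
          + s k / (s j - s k) * (∑ m ∈ range L, q j m * p k m) * q k n) :=
      sum_congr rfl fun k hk => by rw [key k (ne_of_mem_erase hk) n hn']; ring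
    rw [this, sum_add_distrib, mul_add, mul_add, mul_add, mul_sum, mul_sum]
    have h1 : ∀ k, ∑ m ∈ range n, q j m * p k m * q k n * p j n
        = p j n * ((∑ m ∈ range n, q j m * p k m) * q k n) := fun k => by
      rw [sum_mul, mul_sum]; exact sum_congr rfl fun _ _ => by ring
    have h2 : ∀ k, s k / (s j - s k) * ∑ m ∈ range L, q j m * p k m * q k n * p j n
        = p j n * (s k / (s j - s k) * (∑ m ∈ range L, q j m * p k m) * q k n) := fun k => by
      rw [mul_assoc _ (∑ m ∈ range L, q j m * p k m), sum_mul, mul_left_comm]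
      congr 1
      rw [mul_sum]; exact sum_congr rfl fun _ _ => by ring
    simp only [h1, h2]
    ring
  rw [sum_congr rfl hR, sum_add_distrib, sum_add_distrib, hamSum]
  congr 1
  · congr 1
    rw [sum_comm]
    refine sum_congr rfl fun n _ => ?_
    rw [add_sum_erase univ (fun k => ∑ m ∈ range n, q j m * p k m * q k n * p j n) (mem_univ j)]
  · rw [sum_comm]
    refine sum_congr rfl fun k _ => ?_
    rw [sum_comm, mul_sum]

theorem exists_antideriv {L : ℕ} {a b : F} (hab : a ≠ b) (u : ℕ → F) :
    ∃ g : ℕ → F, (∀ n, g (n + 1) = g n + u n) ∧ a * g L = b * g 0 := by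
  refine ⟨fun n => ∑ m ∈ range n, u m + a / (b - a) * ∑ m ∈ range L, u m, fun n => ?_, ?_⟩
  · simp only [sum_range_succ]; ring
  · have : b - a ≠ 0 := sub_ne_zero.2 hab.symm
    simp only [range_zero, sum_empty]
    field_simp
    ring

theorem sum_range_add_swap (L : ℕ) (f : ℕ → ℕ → F) :
    ∑ n ∈ range L, ∑ m ∈ range n, (f m n + f n m)
      = ∑ m ∈ range L, ∑ n ∈ range L, f m n - ∑ n ∈ range L, f n n := by
  induction L with
  | zero => simp
  | succ L ih =>
    rw [sum_range_succ, ih, sum_range_succ (fun m => ∑ n ∈ range (L + 1), f m n),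
      sum_range_succ (fun n => f n n)]
    simp only [sum_range_succ, sum_add_distrib]
    ring

theorem two_mul_sum_partial (L : ℕ) (y : ℕ → F) :
    2 * ∑ n ∈ range L, (∑ m ∈ range n, y m) * y n
      = (∑ n ∈ range L, y n) ^ 2 - ∑ n ∈ range L, y n ^ 2 := by
  induction L with
  | zero => simp
  | succ L ih => rw [sum_range_succ, mul_add, ih, sum_range_succ, sum_range_succ]; ring

/-- The sum of the `s_j H_j` is a constant. -/
theorem two_mul_sum_hamSum {L : ℕ} {e : ℕ → F} {s : ι → F} {q p : ι → ℕ → F}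
    (hs : Function.Injective s) {k : ℕ → F} {θ : ι → F}
    (hk : ∀ n < L, ∑ j, q j n * p j n = k n) (hθ : ∀ j, ∑ n ∈ range L, q j n * p j n = θ j) :
    2 * ∑ j, hamSum L e s q p j
      = 2 * ∑ n ∈ range L, e n * k n + ∑ j, θ j ^ 2 - ∑ n ∈ range L, k n ^ 2 := by
  set Y : ι → ι → F := fun j l => ∑ m ∈ range L, ∑ n ∈ range L, q j m * p l m * q l n * p j n
    with hY
  have hYsymm : ∀ j l, Y j l = Y l j := fun j l => by
    simp only [hY]; rw [sum_comm]
    exact sum_congr rfl fun _ _ => sum_congr rfl fun _ _ => by ring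
  set a : ι → ι → F := fun j l => ∑ n ∈ range L, ∑ m ∈ range n, q j m * p l m * q l n * p j n
    with ha
  set D : ι → ι → F := fun j l => ∑ n ∈ range L, (q j n * p j n) * (q l n * p l n) with hD
  have h1 : ∑ j, ∑ n ∈ range L, e n * q j n * p j n = ∑ n ∈ range L, e n * k n := by
    rw [sum_comm]
    refine sum_congr rfl fun n hn => ?_
    rw [← hk n (mem_range.1 hn), mul_sum]
    exact sum_congr rfl fun _ _ => by ring
  have haa : ∀ j l, a j l + a l j = Y j l - D j l := by
    intro j l
    have := sum_range_add_swap L fun m n => q j m * p l m * q l n * p j n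
    simp only [ha, hY, hD]
    rw [← sum_add_distrib]
    simp only [← sum_add_distrib]
    have e1 : ∑ n ∈ range L, (q j n * p j n) * (q l n * p l n)
      = ∑ n ∈ range L, q j n * p l n * q l n * p j n := sum_congr rfl fun _ _ => by ring
    rw [e1, ← this]
    exact sum_congr rfl fun _ _ => sum_congr rfl fun _ _ => by ring
  have h2 : 2 * ∑ j, ∑ l, a j l = ∑ j, ∑ l, (Y j l - D j l) := by
    rw [two_mul]
    nth_rw 2 [sum_comm]
    rw [← sum_add_distrib]
    refine sum_congr rfl fun j _ => ?_
    rw [← sum_add_distrib]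
    exact sum_congr rfl fun l _ => haa j l
  have h3 : ∑ j, ∑ l, D j l = ∑ n ∈ range L, k n ^ 2 := by
    have : ∀ j, ∑ l, D j l = ∑ n ∈ range L, (q j n * p j n) * k n := fun j => by
      simp only [hD]
      rw [sum_comm]
      exact sum_congr rfl fun n hn => by rw [← mul_sum, hk n (mem_range.1 hn)]
    rw [sum_congr rfl fun j _ => this j, sum_comm]
    exact sum_congr rfl fun n hn => by rw [← sum_mul, hk n (mem_range.1 hn), sq]
  have hYd : ∀ j, Y j j = θ j ^ 2 := fun j => by
    simp only [hY]
    rw [← hθ j, sq, sum_mul_sum]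
    exact sum_congr rfl fun _ _ => sum_congr rfl fun _ _ => by ring
  have he : ∀ f : ι → ι → F, ∑ j, ∑ l ∈ univ.erase j, f j l
      = ∑ j, ∑ l, if l = j then 0 else f j l := fun f =>
    sum_congr rfl fun j _ => by
      rw [← add_sum_erase univ _ (mem_univ j), if_pos rfl, zero_add]
      exact sum_congr rfl fun l hl => by rw [if_neg (ne_of_mem_erase hl)]
  -- `Y` is symmetric and the coefficients of `(j, l)` and `(l, j)` add up to -1, so the dependence
  -- on `s` disappears.
  have h4 : 2 * ∑ j, ∑ l ∈ univ.erase j, s l / (s j - s l) * Y j l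
      = - ∑ j, ∑ l ∈ univ.erase j, Y j l := by
    rw [he, he, two_mul]
    nth_rw 2 [sum_comm]
    rw [← sum_add_distrib, ← sum_neg_distrib]
    refine sum_congr rfl fun j _ => ?_
    rw [← sum_add_distrib, ← sum_neg_distrib]
    refine sum_congr rfl fun l _ => ?_
    by_cases h : l = j
    · simp [h]
    · rw [if_neg h, if_neg (Ne.symm h), if_neg h, hYsymm l j]
      have h1 : s j - s l ≠ 0 := sub_ne_zero.2 fun h' => h (hs h').symm
      have h2 : s l - s j ≠ 0 := sub_ne_zero.2 fun h' => h (hs h')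
      have h3 : s l / (s j - s l) + s j / (s l - s j) = -1 := by
        rw [← neg_sub (s j) (s l), div_neg]
        field_simp
        ring
      rw [← add_mul, h3]; ring
  have h5 : ∑ j, ∑ l, Y j l = ∑ j, θ j ^ 2 + ∑ j, ∑ l ∈ univ.erase j, Y j l := by
    rw [← sum_add_distrib]
    exact sum_congr rfl fun j _ => by rw [← hYd, add_sum_erase univ _ (mem_univ j)]
  have h6 : ∑ j, hamSum L e s q p j = ∑ n ∈ range L, e n * k n + ∑ j, ∑ l, a j l
      + ∑ j, ∑ l ∈ univ.erase j, s l / (s j - s l) * Y j l := by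
    simp only [hamSum, sum_add_distrib, h1, ha, hY]
  rw [h6, mul_add, mul_add, h2, h4]
  simp only [sum_sub_distrib]
  rw [h3, h5]
  ring

/-- Invariance of `s_j H_j` under scaling. -/
theorem hamSum_gauge {L : ℕ} {e : ℕ → F} {s s' : ι → F} {q p q' p' : ι → ℕ → F}
    {c : F} {a : ι → F} {b : ℕ → F} (hc : c ≠ 0) (ha : ∀ j, a j ≠ 0)
    (hs : ∀ j, s' j = c * s j) (hq : ∀ j, ∀ n < L, q' j n = a j * b n * q j n)
    (hp : ∀ j, ∀ n < L, a j * b n * p' j n = p j n) (j : ι) :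
    hamSum L e s' q' p' j = hamSum L e s q p j := by
  -- `b` cancels in every pair `q p` with a common lower index; the ratio `a j / a k` left over
  -- meets its inverse in each quartic term.
  have hq2 : ∀ j k, ∀ m < L, q' j m * p' k m = a j / a k * (q j m * p k m) := by
    intro j k m hm
    rw [hq j m hm, ← hp k m hm]
    have := ha k
    field_simp
  have h4 : ∀ k, ∀ m < L, ∀ n < L,
      q' j m * p' k m * q' k n * p' j n = q j m * p k m * q k n * p j n := by
    intro k m hm n hn
    rw [mul_assoc, hq2 j k m hm, hq2 k j n hn]
    have := ha k
    have := ha j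
    field_simp
  have h5 : ∀ k, s' k / (s' j - s' k) = s k / (s j - s k) := fun k => by
    rw [hs, hs, ← mul_sub, mul_div_mul_left _ _ hc]
  unfold hamSum
  congr 1
  · congr 1
    · refine sum_congr rfl fun n hn => ?_
      rw [mul_assoc, mul_assoc, hq2 j j n (mem_range.1 hn), div_self (ha j), one_mul]
    · refine sum_congr rfl fun k _ => sum_congr rfl fun n hn => sum_congr rfl fun m hm => ?_
      have hn' := mem_range.1 hn
      exact h4 k m ((mem_range.1 hm).trans hn') n hn'
  · refine sum_congr rfl fun k _ => ?_
    rw [h5]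
    congr 1
    exact sum_congr rfl fun m hm => sum_congr rfl fun n hn =>
      h4 k m (mem_range.1 hm) n (mem_range.1 hn)

theorem hamSum_perm {L : ℕ} {e : ℕ → F} {s : ι → F} {q p : ι → ℕ → F} (π : Equiv.Perm ι) (j : ι) :
    hamSum L e (fun k => s (π k)) (fun k => q (π k)) (fun k => p (π k)) j
      = hamSum L e s q p (π j) := by
  unfold hamSum
  congr 1
  · congr 1
    exact Equiv.sum_comp π fun k => ∑ n ∈ range L, ∑ m ∈ range n,
      q (π j) m * p k m * q k n * p (π j) n
  · refine sum_equiv π (fun k => by simp) fun k _ => rfl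

end HamSum

end HLN

namespace HLN

set_option linter.unusedSectionVars false

open Finset

/-! ### Summation by parts: the difference transformation and the reflection. -/

section Core

variable {F : Type*} [Field F] {ι : Type*} [Fintype ι] [DecidableEq ι]

theorem sum_range_shift (L : ℕ) (f : ℕ → F) (h : f L = f 0) :
    ∑ n ∈ range L, f (n + 1) = ∑ n ∈ range L, f n := by
  have := sum_range_succ f L
  rw [sum_range_succ', h] at this
  exact add_right_cancel this

/-- The variables of `η_i`, normalized by `p_n^{(i)} = s_i = 1`. Here `R_n = P_{n-1}` and
`E_n = e_{n-1}`. -/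
structure DiffPair (L : ℕ) (i : ι) (s : ι → F) (Q P Qh Ph R : ι → ℕ → F) : Prop where
  s_i : s i = 1
  Qh_succ : ∀ k, k ≠ i → ∀ n < L, Qh k (n + 1) = Qh k n + Q k n
  Qh_period : ∀ k, k ≠ i → Qh k L = s k * Qh k 0
  P_eq : ∀ k, k ≠ i → ∀ n < L, P k n = R k (n + 1)
  R_zero : ∀ k, k ≠ i → R k 0 = s k * R k L
  Ph_eq : ∀ k, k ≠ i → ∀ n < L, Ph k n = R k n - R k (n + 1)
  P_i : ∀ n < L, P i n = 1
  Qh_i : ∀ n < L, Qh i n = 1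

/-- `∑ q_n p_n` is the same for both sets of variables. -/
theorem DiffPair.sum_eq {L : ℕ} {i : ι} {s : ι → F} {Q P Qh Ph R : ι → ℕ → F}
    (h : DiffPair L i s Q P Qh Ph R) {k : ι} (hk : k ≠ i) :
    ∑ n ∈ range L, Qh k n * Ph k n = ∑ n ∈ range L, Q k n * P k n := by
  -- Summation by parts. The boundary term `Qh * R` is periodic, because `Qh` gains the factor `s k`
  -- over a period and `R` loses it.
  have h1 : ∀ n ∈ range L, Qh k n * Ph k n
      = Q k n * P k n + (Qh k n * R k n - Qh k (n + 1) * R k (n + 1)) := by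
    intro n hn
    have hn' := mem_range.1 hn
    rw [h.Ph_eq k hk n hn', h.P_eq k hk n hn', h.Qh_succ k hk n hn']
    ring
  have h2 : Qh k L * R k L = Qh k 0 * R k 0 := by
    rw [h.Qh_period k hk, h.R_zero k hk]; ring
  rw [sum_congr rfl h1, sum_add_distrib, sum_sub_distrib,
    sum_range_shift L (fun n => Qh k n * R k n) h2, sub_self, add_zero]

/-- For the index `i` the old antiderivative is `Qh j` itself, as `P i = 1` and `s i = 1`; for the
other `l` the Leibniz rule turns the old `g l` into the new `g l - Qh j * R l`. Summing by parts
with `Ph j = -ΔR j` transforms the new sum into the old one. The correction `R j 0 * Qh j 0` is the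
boundary term caused by `E L = E 0 + 1`, and the last term comes from the shift `c`. -/
theorem DiffPair.hamSum_eq [CharZero F] {L : ℕ} {i : ι} {s : ι → F} {Q P Qh Ph R : ι → ℕ → F}
    (h : DiffPair L i s Q P Qh Ph R) (hs : Function.Injective s) {e e' E k k' : ℕ → F} {c : F}
    (hQi : ∀ n < L, Q i n = k n - ∑ l ∈ univ.erase i, Q l n * P l n)
    (hPi : ∀ n < L, Ph i n = k' n - ∑ l ∈ univ.erase i, Qh l n * Ph l n)
    (he : ∀ n < L, e n = E (n + 1)) (he' : ∀ n < L, e' n = E n + c) (hE : E L = E 0 + 1)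
    (hk : ∀ n < L, k' n = k n - E (n + 1) + E n) {j : ι} (hj : j ≠ i) :
    hamSum L e' s Qh Ph j = hamSum L e s Q P j - R j 0 * Qh j 0
      + c * ∑ n ∈ range L, Q j n * P j n := by
  have hsj : ∀ k, k ≠ j → s k ≠ s j := fun k hk h' => hk (hs h')
  have hg : ∀ l, ∃ g : ℕ → F, l ≠ j →
      ((∀ n, g (n + 1) = g n + Q j n * P l n) ∧ s l * g L = s j * g 0) := fun l => by
    by_cases hl : l = j
    · exact ⟨0, fun h => absurd hl h⟩
    · obtain ⟨g, hg⟩ := exists_antideriv (L := L) (hsj l hl) fun n => Q j n * P l n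
      exact ⟨g, fun _ => hg⟩
  choose g hg using hg
  obtain ⟨H, hH, hHL⟩ := exists_antideriv (L := L) (hsj i hj.symm) fun n => Qh j n * Ph i n
  set S := (univ.erase j).erase i with hS
  have hiS : i ∈ univ.erase j := mem_erase.2 ⟨hj.symm, mem_univ _⟩
  have hSj : ∀ l ∈ S, l ≠ j := fun l hl => ne_of_mem_erase (mem_of_mem_erase hl)
  have hSi : ∀ l ∈ S, l ≠ i := fun l hl => ne_of_mem_erase hl
  have hsplit : ∀ f : ι → F, ∑ l ∈ univ.erase j, f l = f i + ∑ l ∈ S, f l := fun f =>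
    (add_sum_erase _ f hiS).symm
  have hsplit' : ∀ f : ι → F, ∑ l ∈ univ.erase i, f l = f j + ∑ l ∈ S, f l := fun f => by
    rw [hS, erase_right_comm]
    exact (add_sum_erase _ f (mem_erase.2 ⟨hj, mem_univ _⟩)).symm
  -- the old variables
  have hold := hamSum_eq_of_antideriv (L := L) (e := e) (q := Q) (p := P) hsj
    (fun l => if l = i then Qh j else g l)
    (fun l hl n hn => by
      by_cases hli : l = i
      · subst hli
        simp only [if_true]
        rw [h.Qh_succ j hj n hn, h.P_i n hn, mul_one]
      · simp only [if_neg hli]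
        exact (hg l hl).1 n)
    (fun l hl => by
      by_cases hli : l = i
      · subst hli
        simp only [if_true]
        rw [h.Qh_period j hj, h.s_i, one_mul]
      · simp only [if_neg hli]
        exact (hg l hl).2)
  have hnew := hamSum_eq_of_antideriv (L := L) (e := e') (q := Qh) (p := Ph) hsj
    (fun l => if l = i then H else fun n => g l n - Qh j n * R l n)
    (fun l hl n hn => by
      by_cases hli : l = i
      · subst hli
        simp only [if_true]
        exact hH n
      · simp only [if_neg hli]
        rw [(hg l hl).1 n, h.Ph_eq l hli n hn, h.Qh_succ j hj n hn, h.P_eq l hli n hn]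
        ring)
    (fun l hl => by
      by_cases hli : l = i
      · subst hli
        simp only [if_true]
        exact hHL
      · simp only [if_neg hli]
        have := (hg l hl).2
        rw [h.Qh_period j hj, h.R_zero l hli]
        linear_combination this)
  rw [hold, hnew]
  have hS1 : ∀ f : ℕ → ι → F, ∀ n, ∑ l ∈ S, (if l = i then Qh j else g l) n * f n l
      = ∑ l ∈ S, g l n * f n l := fun f n => sum_congr rfl fun l hl => by rw [if_neg (hSi l hl)]
  have hS2 : ∀ f : ℕ → ι → F, ∀ n,
      ∑ l ∈ S, (if l = i then H else fun n => g l n - Qh j n * R l n) n * f n l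
      = ∑ l ∈ S, (g l n - Qh j n * R l n) * f n l := fun f n =>
    sum_congr rfl fun l hl => by rw [if_neg (hSi l hl)]
  simp only [hsplit, if_true]
  simp only [hS1 (fun n l => Q l n), hS2 (fun n l => Qh l n)]
  set w : ℕ → F := fun n => Qh j n * R j n with hw
  -- `G n` is the coefficient of `Ph j n` in the new Hamiltonian without the self-interaction of
  -- `j`; it is summed by parts against `R j`.
  set G : ℕ → F := fun n => (E n + c) * Qh j n
    + ∑ l ∈ S, (g l n - Qh j n * R l n) * Qh l n + H n with hG
  have hGL : R j L * G L = R j 0 * G 0 + R j 0 * Qh j 0 := by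
    have h1 : ∑ l ∈ S, (g l L - Qh j L * R l L) * Qh l L
        = s j * ∑ l ∈ S, (g l 0 - Qh j 0 * R l 0) * Qh l 0 := by
      rw [mul_sum]
      refine sum_congr rfl fun l hl => ?_
      have := (hg l (hSj l hl)).2
      rw [h.Qh_period j hj, h.Qh_period l (hSi l hl), h.R_zero l (hSi l hl)]
      linear_combination Qh l 0 * this
    have h2 : H L = s j * H 0 := by rw [← hHL, h.s_i, one_mul]
    simp only [hG]
    rw [h1, h2, hE, h.Qh_period j hj, h.R_zero j hj]
    ring
  have hdiff : ∀ n ∈ range L,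
      Ph j n * (e' n * Qh j n + (H n * Qh i n + ∑ l ∈ S, (g l n - Qh j n * R l n) * Qh l n)
        + (∑ m ∈ range n, Qh j m * Ph j m) * Qh j n)
      = P j n * (e n * Q j n + (Qh j n * Q i n + ∑ l ∈ S, g l n * Q l n)
        + (∑ m ∈ range n, Q j m * P j m) * Q j n)
        + c * (Q j n * P j n)
        + ((∑ m ∈ range n, Qh j m * Ph j m) * (Qh j n * Ph j n)
          - (∑ m ∈ range n, Q j m * P j m) * (Q j n * P j n)
          + R j (n + 1) * Qh j n * (w (n + 1) - w n))
        + (R j n * G n - R j (n + 1) * G (n + 1)) := by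
    intro n hn
    have hn' := mem_range.1 hn
    have e1 : ∑ l ∈ S, (g l (n + 1) - Qh j (n + 1) * R l (n + 1)) * Qh l (n + 1)
        - ∑ l ∈ S, (g l n - Qh j n * R l n) * Qh l n
        = ∑ l ∈ S, g l n * Q l n
          - Qh j n * ∑ l ∈ S, (Qh l (n + 1) * R l (n + 1) - Qh l n * R l n) := by
      rw [mul_sum, ← sum_sub_distrib, ← sum_sub_distrib]
      refine sum_congr rfl fun l hl => ?_
      rw [(hg l (hSj l hl)).1 n, h.P_eq l (hSi l hl) n hn', h.Qh_succ j hj n hn',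
        h.Qh_succ l (hSi l hl) n hn']
      ring
    -- The column relations express `Ph i - Q i` by increments of `E` and of the products `Qh l * R
    -- l`, `l ≠ i`; hence `ΔG` reproduces the old coefficient.
    have e2 : Ph i n = Q i n + E n - E (n + 1) + (w (n + 1) - w n)
        + ∑ l ∈ S, (Qh l (n + 1) * R l (n + 1) - Qh l n * R l n) := by
      have : ∑ l ∈ S, (Qh l (n + 1) * R l (n + 1) - Qh l n * R l n)
          = ∑ l ∈ S, Q l n * P l n - ∑ l ∈ S, Qh l n * Ph l n := by
        rw [← sum_sub_distrib]
        refine sum_congr rfl fun l hl => ?_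
        rw [h.P_eq l (hSi l hl) n hn', h.Qh_succ l (hSi l hl) n hn', h.Ph_eq l (hSi l hl) n hn']
        ring
      rw [hPi n hn', hQi n hn', hk n hn', hsplit', hsplit', this, h.Ph_eq j hj n hn',
        h.P_eq j hj n hn']
      simp only [hw]
      rw [h.Qh_succ j hj n hn']
      ring
    simp only [hG]
    rw [h.Qh_i n hn', he n hn', he' n hn', h.Ph_eq j hj n hn', h.P_eq j hj n hn', hH n, e2]
    rw [h.Qh_succ j hj n hn'] at e1 ⊢
    linear_combination R j (n + 1) * e1
  -- Doubling turns sums against partial sums into squares: the squared totals agree by `sum_eq`,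
  -- and the rest telescopes in `w ^ 2`.
  have hself : ∑ n ∈ range L, ((∑ m ∈ range n, Qh j m * Ph j m) * (Qh j n * Ph j n)
          - (∑ m ∈ range n, Q j m * P j m) * (Q j n * P j n)
          + R j (n + 1) * Qh j n * (w (n + 1) - w n)) = 0 := by
    have h2 : (2 : F) ≠ 0 := two_ne_zero
    refine (mul_eq_zero.1 ?_).resolve_left h2
    rw [sum_add_distrib, sum_sub_distrib, mul_add, mul_sub, two_mul_sum_partial,
      two_mul_sum_partial, h.sum_eq hj]
    have hwL : w L ^ 2 = w 0 ^ 2 := by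
      simp only [hw]; rw [h.Qh_period j hj, h.R_zero j hj]; ring
    have h3 := sum_range_shift L (fun n => w n ^ 2) hwL
    rw [mul_sum]
    have h4 : ∀ n ∈ range L, 2 * (R j (n + 1) * Qh j n * (w (n + 1) - w n))
        = (Qh j n * Ph j n) ^ 2 - (Q j n * P j n) ^ 2 + (w (n + 1) ^ 2 - w n ^ 2) := by
      intro n hn
      have hn' := mem_range.1 hn
      simp only [hw]
      rw [h.P_eq j hj n hn', h.Qh_succ j hj n hn', h.Ph_eq j hj n hn']
      ring
    rw [sum_congr rfl h4, sum_add_distrib, sum_sub_distrib, sum_sub_distrib]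
    rw [h3]
    ring
  rw [sum_congr rfl hdiff, sum_add_distrib, sum_add_distrib, sum_add_distrib, hself]
  have htel : ∑ n ∈ range L, (R j n * G n - R j (n + 1) * G (n + 1))
      = R j 0 * G 0 - R j L * G L := sum_range_sub' (fun n => R j n * G n) L
  rw [htel, hGL, mul_sum]
  ring

/-- Reflection reverses the ordered double sums, so the new antiderivatives come from those (`h l`)
of `q l * p j`. Summation by parts against the antiderivatives `g l` of `q j * p l` brings the old
sum back; `g l * h l` is periodic since the two quasi-periods are inverse to each other. The 1 in
`e'` gives the total of `q * p`, and `e L = e 0 + 1` gives `q j 0 * p j 0`. -/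
theorem hamSum_reflect [CharZero F] {L : ℕ} {s : ι → F} {q p q' p' : ι → ℕ → F} {e e' : ℕ → F}
    (hs : Function.Injective s) (hs0 : ∀ j, s j ≠ 0)
    (hqL : ∀ j, q j L = s j * q j 0) (hpL : ∀ j, s j * p j L = p j 0) (heL : e L = e 0 + 1)
    (hq' : ∀ j, ∀ n < L, q' j n = p j (L - n)) (hp' : ∀ j, ∀ n < L, p' j n = - q j (L - n))
    (he' : ∀ n < L, e' n = - e (L - n) + 1) (j : ι) :
    hamSum L e' s q' p' j = hamSum L e s q p j - ∑ n ∈ range L, q j n * p j n + q j 0 * p j 0 := by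
  have hsj : ∀ k, k ≠ j → s k ≠ s j := fun k hk h' => hk (hs h')
  have hg : ∀ l, ∃ g : ℕ → F, l ≠ j →
      ((∀ n, g (n + 1) = g n + q j n * p l n) ∧ s l * g L = s j * g 0) := fun l => by
    by_cases hl : l = j
    · exact ⟨0, fun h => absurd hl h⟩
    · obtain ⟨g, hg⟩ := exists_antideriv (L := L) (hsj l hl) fun n => q j n * p l n
      exact ⟨g, fun _ => hg⟩
  choose g hg using hg
  have hh : ∀ l, ∃ g : ℕ → F, l ≠ j →
      ((∀ n, g (n + 1) = g n + q l n * p j n) ∧ s j * g L = s l * g 0) := fun l => by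
    by_cases hl : l = j
    · exact ⟨0, fun h => absurd hl h⟩
    · obtain ⟨g, hg⟩ := exists_antideriv (L := L) (hsj l hl).symm fun n => q l n * p j n
      exact ⟨g, fun _ => hg⟩
  choose h hh using hh
  have hp0 : ∀ k l, s l * (q k L * p l L) = s k * (q k 0 * p l 0) := fun k l => by
    rw [hqL, ← hpL l]; ring
  rw [hamSum_eq_of_antideriv (L := L) (e := e) hsj g (fun l hl n _ => (hg l hl).1 n)
    fun l hl => (hg l hl).2]
  -- The argument is `L + 1 - n` rather than `L - n`, so that the step from `n` to `n + 1` consumes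
  -- the index `L - n` of the reflected variables.
  rw [hamSum_eq_of_antideriv (L := L) (e := e') hsj (fun l n => h l (L + 1 - n))
    (fun l hl n hn => by
      rw [show L + 1 - n = (L - n) + 1 by omega, (hh l hl).1, hq' j n hn, hp' l n hn,
        show L + 1 - (n + 1) = L - n by omega]
      ring)
    (fun l hl => by
      simp only [show L + 1 - L = 0 + 1 by omega, Nat.sub_zero]
      rw [(hh l hl).1, (hh l hl).1]
      linear_combination (-1 : F) * (hh l hl).2 - hp0 l j)]
  have hrefl : ∀ f : ℕ → F, ∑ n ∈ range L, f (L - n) = ∑ n ∈ range L, f (n + 1) := fun f => by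
    rw [← sum_range_reflect fun n => f (n + 1)]
    refine sum_congr rfl fun n hn => ?_
    have := mem_range.1 hn
    congr 1; omega
  have hy : q j L * p j L = q j 0 * p j 0 := mul_left_cancel₀ (hs0 j) (hp0 j j)
  have h1 : ∀ n ∈ range L, p' j n * (e' n * q' j n
      + ∑ l ∈ univ.erase j, h l (L + 1 - n) * q' l n
      + (∑ m ∈ range n, q' j m * p' j m) * q' j n)
      = (e (L - n) - 1) * (q j (L - n) * p j (L - n))
        - ∑ l ∈ univ.erase j, q j (L - n) * p l (L - n) * h l (L - n + 1)
        + (∑ m ∈ range n, q j (L - m) * p j (L - m)) * (q j (L - n) * p j (L - n)) := by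
    intro n hn
    have hn' := mem_range.1 hn
    have a1 : ∑ l ∈ univ.erase j, h l (L + 1 - n) * q' l n
        = ∑ l ∈ univ.erase j, p l (L - n) * h l (L - n + 1) :=
      sum_congr rfl fun l _ => by rw [hq' l n hn', show L + 1 - n = L - n + 1 by omega]; ring
    have a2 : ∑ m ∈ range n, q' j m * p' j m = - ∑ m ∈ range n, q j (L - m) * p j (L - m) := by
      rw [← sum_neg_distrib]
      refine sum_congr rfl fun m hm => ?_
      have hm' := (mem_range.1 hm).trans hn'
      rw [hq' j m hm', hp' j m hm']; ring
    have a3 : ∑ l ∈ univ.erase j, q j (L - n) * p l (L - n) * h l (L - n + 1)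
        = q j (L - n) * ∑ l ∈ univ.erase j, p l (L - n) * h l (L - n + 1) := by
      rw [mul_sum]; exact sum_congr rfl fun _ _ => by ring
    rw [a1, a2, a3, hq' j n hn', hp' j n hn', he' n hn']
    ring
  rw [sum_congr rfl h1, sum_add_distrib, sum_sub_distrib]
  have h2 : ∑ n ∈ range L, (e (L - n) - 1) * (q j (L - n) * p j (L - n))
      = ∑ n ∈ range L, (e n - 1) * (q j n * p j n) + q j 0 * p j 0 := by
    rw [hrefl fun n => (e n - 1) * (q j n * p j n)]
    have := sum_range_succ' (fun n => (e n - 1) * (q j n * p j n)) L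
    rw [sum_range_succ] at this
    rw [hy, heL] at this
    linear_combination (-1 : F) * this
  have h3 : ∑ n ∈ range L, ∑ l ∈ univ.erase j, q j (L - n) * p l (L - n) * h l (L - n + 1)
      = - ∑ n ∈ range L, ∑ l ∈ univ.erase j, p j n * (g l n * q l n) := by
    rw [sum_comm, sum_comm (s := range L), ← sum_neg_distrib]
    refine sum_congr rfl fun l hl => ?_
    have hl' := ne_of_mem_erase hl
    rw [hrefl fun n => q j n * p l n * h l (n + 1)]
    have hh1 : s j * h l (L + 1) = s l * h l 1 := by
      rw [(hh l hl').1, show (1 : ℕ) = 0 + 1 from rfl, (hh l hl').1]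
      linear_combination (hh l hl').2 + hp0 l j
    have hc : q j L * p l L * h l (L + 1) = q j 0 * p l 0 * h l (0 + 1) := by
      refine mul_left_cancel₀ (mul_ne_zero (hs0 l) (hs0 j)) ?_
      rw [zero_add]
      linear_combination s j * h l (L + 1) * hp0 j l + s j * (q j 0 * p l 0) * hh1
    rw [sum_range_shift L (fun n => q j n * p l n * h l (n + 1)) hc, ← sum_neg_distrib]
    have h4 : ∀ n ∈ range L, q j n * p l n * h l (n + 1)
        = - (p j n * (g l n * q l n)) + (g l (n + 1) * h l (n + 1) - g l n * h l n) := by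
      intro n _
      rw [(hg l hl').1 n, (hh l hl').1 n]; ring
    have h5 : g l L * h l L = g l 0 * h l 0 := by
      refine mul_left_cancel₀ (mul_ne_zero (hs0 l) (hs0 j)) ?_
      linear_combination s j * h l L * (hg l hl').2 + s j * g l 0 * (hh l hl').2
    rw [sum_congr rfl h4, sum_add_distrib, sum_range_sub fun n => g l n * h l n, h5, sub_self,
      add_zero]
  have h4 : ∑ n ∈ range L, (∑ m ∈ range n, q j (L - m) * p j (L - m))
        * (q j (L - n) * p j (L - n))
      = ∑ n ∈ range L, (∑ m ∈ range n, q j m * p j m) * (q j n * p j n) := by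
    refine mul_left_cancel₀ (two_ne_zero (α := F)) ?_
    rw [two_mul_sum_partial L fun n => q j (L - n) * p j (L - n),
      two_mul_sum_partial L fun n => q j n * p j n, hrefl fun n => q j n * p j n,
      hrefl fun n => (q j n * p j n) ^ 2, sum_range_shift L (fun n => q j n * p j n) hy,
      sum_range_shift L (fun n => (q j n * p j n) ^ 2) (by simp only [hy])]
  rw [h2, h3, h4]
  rw [sub_neg_eq_add, show ∀ a b c d e f : F, (a + b + c + d = e - f + b) ↔ (a + f + c + d = e) from
    fun a b c d e f => ⟨fun h => by linear_combination h, fun h => by linear_combination h⟩]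
  rw [← sum_add_distrib, ← sum_add_distrib, ← sum_add_distrib]
  refine sum_congr rfl fun n _ => ?_
  rw [← mul_sum]
  ring

end Core

end HLN

namespace HLN

set_option linter.unusedSectionVars false

open Finset

/-! ### Extended variables, their row and column relations. -/

section Extended

variable {L N : ℕ} [NeZero L] {F : Type} [Field F] [Algebra ℂ F]

theorem res_natCast (n : Fin L) : res L ((n : ℕ) : ℤ) = n := by
  apply Fin.ext
  have : ((n : ℕ) : ℤ) % (L : ℤ) = (n : ℕ) := Int.emod_eq_of_lt (by omega) (by have := n.2; omega)
  simp [res, this]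

theorem res_add (n : ℤ) : res L (n + L) = res L n := by
  simp [res]

theorem natCast_ediv (n : Fin L) : ((n : ℕ) : ℤ) / (L : ℤ) = 0 :=
  Int.ediv_eq_zero_of_lt (by omega) (by have := n.2; omega)

theorem add_ediv_period (n : ℤ) : (n + L) / (L : ℤ) = n / L + 1 :=
  Int.add_ediv_of_dvd_right (dvd_refl _) |>.trans (by
    rw [Int.ediv_self (by exact_mod_cast NeZero.ne L)])

theorem qE_natCast (x : Phase L N F) (j : Fin (N + 1)) (n : Fin L) :
    qE x j ((n : ℕ) : ℤ) = qB x j n := by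
  rw [qE, natCast_ediv, res_natCast, zpow_zero, one_mul]

theorem pE_natCast (κ : Params L N) (x : Phase L N F) (j : Fin (N + 1)) (n : Fin L) :
    pE κ x j ((n : ℕ) : ℤ) = pB κ x j n := by
  rw [pE, natCast_ediv, res_natCast, zpow_zero, div_one]

theorem eExt_natCast (κ : Params L N) (n : Fin L) : eExt κ ((n : ℕ) : ℤ) = κ.e n := by
  rw [eExt, natCast_ediv, res_natCast, Int.cast_zero, add_zero]

theorem kExt_natCast (κ : Params L N) (n : Fin L) : kExt κ ((n : ℕ) : ℤ) = κ.k n := by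
  rw [kExt, res_natCast]

theorem qE_add {x : Phase L N F} {j : Fin (N + 1)} (h : sB x j ≠ 0) (n : ℤ) :
    qE x j (n + L) = sB x j * qE x j n := by
  rw [qE, qE, add_ediv_period, res_add, zpow_add₀ h, zpow_one]; ring

theorem pE_add {κ : Params L N} {x : Phase L N F} {j : Fin (N + 1)} (h : sB x j ≠ 0) (n : ℤ) :
    pE κ x j (n + L) = pE κ x j n / sB x j := by
  rw [pE, pE, add_ediv_period, res_add, zpow_add₀ h, zpow_one, div_mul_eq_div_div]

theorem eExt_add (κ : Params L N) (n : ℤ) : eExt κ (n + L) = eExt κ n + 1 := by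
  rw [eExt, eExt, add_ediv_period, res_add]; push_cast; ring

theorem kExt_add (κ : Params L N) (n : ℤ) : kExt κ (n + L) = kExt κ n := by
  rw [kExt, kExt, res_add]

@[simp] theorem sB_zero (x : Phase L N F) : sB x 0 = 1 := rfl

@[simp] theorem sB_succ (x : Phase L N F) (a : Fin N) : sB x a.succ = x.1 a := rfl

@[simp] theorem qB_zero_right (x : Phase L N F) (j : Fin (N + 1)) : qB x j 0 = 1 := by simp [qB]

@[simp] theorem qB_zero_left (x : Phase L N F) (n : Fin L) : qB x 0 n = 1 := by
  by_cases h : n = 0 <;> simp [qB, h]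

theorem qB_succ (x : Phase L N F) (a : Fin N) (n : Idx L) : qB x a.succ n = x.2.1 a n := by
  simp [qB, n.2]

theorem pB_succ (κ : Params L N) (x : Phase L N F) (a : Fin N) (n : Idx L) :
    pB κ x a.succ n = x.2.2 a n := by
  simp [pB, n.2, pPos]

theorem pB_idx (κ : Params L N) (x : Phase L N F) (j : Fin (N + 1)) (n : Idx L) :
    pB κ x j n = pPos κ x j n := by
  simp [pB, n.2]

theorem sum_fin_eq_add_sum_idx {M : Type*} [AddCommMonoid M] (f : Fin L → M) :
    ∑ n, f n = f 0 + ∑ n : Idx L, f n := by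
  rw [← add_sum_erase univ f (mem_univ 0)]
  congr 1
  exact sum_subtype (univ.erase 0) (fun n => by simp) f

theorem sum_row (κ : Params L N) (x : Phase L N F) (j : Fin (N + 1)) :
    ∑ n, qB x j n * pB κ x j n = algebraMap ℂ F (κ.θ j) := by
  rw [sum_fin_eq_add_sum_idx]
  simp only [pB_idx, qB_zero_right, one_mul]
  simp [pB]

theorem sum_col_idx (κ : Params L N) (x : Phase L N F) (n : Idx L) :
    ∑ j, qB x j n * pB κ x j n = algebraMap ℂ F (κ.k n) := by
  rw [Fin.sum_univ_succ]
  simp only [pB_succ, qB_succ]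
  rw [pB_idx, qB_zero_left]
  simp [pPos]

/-- Double counting: rows and columns have the same total because `∑ κ_n = ∑ θ_j`, which forces the
missing column `n = 0`. -/
theorem sum_col_of_idx {κ : Params L N} (hκ : κ.Admissible) {q p : Fin (N + 1) → Fin L → F}
    (hrow : ∀ j, ∑ n, q j n * p j n = algebraMap ℂ F (κ.θ j))
    (hcol : ∀ n : Idx L, ∑ j, q j n * p j n = algebraMap ℂ F (κ.k n)) (n : Fin L) :
    ∑ j, q j n * p j n = algebraMap ℂ F (κ.k n) := by
  by_cases h : n = 0
  · subst h
    have h1 : ∑ n, ∑ j, q j n * p j n = ∑ n, algebraMap ℂ F (κ.k n) := by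
      rw [sum_comm, sum_congr rfl fun j _ => hrow j, ← map_sum, ← map_sum, hκ.2]
    rw [sum_fin_eq_add_sum_idx fun n => ∑ j, q j n * p j n,
      sum_fin_eq_add_sum_idx fun n => algebraMap ℂ F (κ.k n),
      sum_congr rfl fun n _ => hcol n] at h1
    exact add_right_cancel h1
  · exact hcol ⟨n, h⟩

/-- The same double counting with one row missing. For `η_i` this is row `i`, whose new momenta are
defined through the columns. -/
theorem sum_row_of_erase {κ : Params L N} (hκ : κ.Admissible) {q p : Fin (N + 1) → Fin L → F}
    {i : Fin (N + 1)}
    (hrow : ∀ j, j ≠ i → ∑ n, q j n * p j n = algebraMap ℂ F (κ.θ j))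
    (hcol : ∀ n, ∑ j, q j n * p j n = algebraMap ℂ F (κ.k n)) (j : Fin (N + 1)) :
    ∑ n, q j n * p j n = algebraMap ℂ F (κ.θ j) := by
  by_cases h : j = i
  · subst h
    have h1 : ∑ j, ∑ n, q j n * p j n = ∑ j, algebraMap ℂ F (κ.θ j) := by
      rw [sum_comm, sum_congr rfl fun j _ => hcol j, ← map_sum, ← map_sum, hκ.2]
    rw [← add_sum_erase _ _ (mem_univ j), ← add_sum_erase _ _ (mem_univ j),
      sum_congr rfl fun l hl => hrow l (ne_of_mem_erase hl)] at h1
    exact add_right_cancel h1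
  · exact hrow j h

theorem sum_col {κ : Params L N} (hκ : κ.Admissible) (x : Phase L N F) (n : Fin L) :
    ∑ j, qB x j n * pB κ x j n = algebraMap ℂ F (κ.k n) :=
  sum_col_of_idx hκ (sum_row κ x) (sum_col_idx κ x) n

/-- The extended variables are determined by the constraints. -/
theorem extended_eq {κ : Params L N} {y : Phase L N F} {q p : Fin (N + 1) → Fin L → F}
    (hq0 : ∀ n, q 0 n = 1) (hqz : ∀ j, q j 0 = 1)
    (hyq : ∀ a (n : Idx L), y.2.1 a n = q a.succ n) (hyp : ∀ a (n : Idx L), y.2.2 a n = p a.succ n)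
    (hrow : ∀ j, ∑ n, q j n * p j n = algebraMap ℂ F (κ.θ j))
    (hcol : ∀ n : Idx L, ∑ j, q j n * p j n = algebraMap ℂ F (κ.k n)) :
    (∀ j n, qB y j n = q j n) ∧ ∀ j n, pB κ y j n = p j n := by
  have hq : ∀ j n, qB y j n = q j n := by
    intro j n
    refine Fin.cases ?_ (fun a => ?_) j
    · rw [qB_zero_left, hq0]
    · by_cases h : n = 0
      · rw [h, qB_zero_right, hqz]
      · exact (qB_succ y a ⟨n, h⟩).trans (hyq a ⟨n, h⟩)
  have hp : ∀ j (n : Idx L), pB κ y j n = p j n := by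
    intro j n
    refine Fin.cases ?_ (fun a => ?_) j
    -- In a column `n ≠ 0` the only unknown is `p_n^{(0)}`; afterwards the only unknown in row `j`
    -- is `p_0^{(j)}`.
    · have h1 := sum_col_idx κ y n
      rw [← hcol n, Fin.sum_univ_succ, Fin.sum_univ_succ] at h1
      have h2 : ∀ a : Fin N, qB y a.succ n * pB κ y a.succ n = q a.succ n * p a.succ n :=
        fun a => by rw [hq, pB_succ, hyp]
      rw [sum_congr rfl fun a _ => h2 a, qB_zero_left, hq0, one_mul, one_mul] at h1
      exact add_right_cancel h1
    · rw [pB_succ, hyp]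
  refine ⟨hq, fun j n => ?_⟩
  by_cases h : n = 0
  · have h1 := sum_row κ y j
    rw [← hrow j, sum_fin_eq_add_sum_idx, sum_fin_eq_add_sum_idx] at h1
    have h2 : ∀ n : Idx L, qB y j n * pB κ y j n = q j n * p j n := fun n => by rw [hq, hp]
    rw [sum_congr rfl fun n _ => h2 n, qB_zero_right, hqz, one_mul, one_mul] at h1
    rw [h]
    exact add_right_cancel h1
  · exact hp j ⟨n, h⟩

theorem sum_fin_eq_sum_range {M : Type*} [AddCommMonoid M] (f : Fin L → M) (g : ℤ → M)
    (h : ∀ n : Fin L, g ((n : ℕ) : ℤ) = f n) : ∑ n, f n = ∑ n ∈ range L, g (n : ℕ) := by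
  rw [← Fin.sum_univ_eq_sum_range (fun n => g (n : ℕ))]
  exact sum_congr rfl fun n _ => (h n).symm

theorem sum_Iio_eq_sum_range {M : Type*} [AddCommMonoid M] (f : Fin L → M) (g : ℤ → M)
    (h : ∀ n : Fin L, g ((n : ℕ) : ℤ) = f n) (n : Fin L) :
    ∑ m ∈ Iio n, f m = ∑ m ∈ range (n : ℕ), g (m : ℕ) := by
  rw [← Nat.Iio_eq_range, ← Fin.map_valEmbedding_Iio, sum_map]
  exact sum_congr rfl fun m _ => (h m).symm

theorem sum_row_range (κ : Params L N) (x : Phase L N F) (j : Fin (N + 1)) :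
    ∑ n ∈ range L, qE x j (n : ℕ) * pE κ x j (n : ℕ) = algebraMap ℂ F (κ.θ j) := by
  rw [← sum_row κ x j]
  exact (sum_fin_eq_sum_range _ (fun n => qE x j n * pE κ x j n)
    fun n => by rw [qE_natCast, pE_natCast]).symm

theorem sum_col_range {κ : Params L N} (hκ : κ.Admissible) (x : Phase L N F) (n : ℕ) (hn : n < L) :
    ∑ j, qE x j n * pE κ x j n = algebraMap ℂ F (kExt κ n) := by
  have := sum_col hκ x ⟨n, hn⟩
  simp only [← qE_natCast, ← pE_natCast, ← kExt_natCast] at this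
  exact this

/-- Passes from sums over `Fin L` to sums over natural numbers, where the shift `n + 1` and the
value at `n = L` make sense. -/
theorem hamiltonian_eq (κ : Params L N) (i : Fin N) (x : Phase L N F) :
    hamiltonian κ i x = hamSum L (fun n => algebraMap ℂ F (eExt κ n)) (sB x)
      (fun j n => qE x j n) (fun j n => pE κ x j n) i.succ / sB x i.succ := by
  rw [hamiltonian, hamSum, one_div, div_eq_inv_mul]
  congr 2
  · congr 1
    · exact sum_fin_eq_sum_range _
        (fun n => algebraMap ℂ F (eExt κ n) * qE x i.succ n * pE κ x i.succ n)
        fun n => by rw [qE_natCast, pE_natCast, eExt_natCast]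
    · refine sum_congr rfl fun j _ => ?_
      rw [← Fin.sum_univ_eq_sum_range (fun n => ∑ m ∈ range n,
        qE x i.succ m * pE κ x j m * qE x j n * pE κ x i.succ n)]
      refine sum_congr rfl fun n _ => ?_
      exact sum_Iio_eq_sum_range _ (fun m => qE x i.succ m * pE κ x j m *
        qE x j (n : ℕ) * pE κ x i.succ (n : ℕ)) (fun m => by simp only [qE_natCast, pE_natCast]) n
  · refine sum_congr rfl fun j _ => ?_
    congr 1
    rw [← Fin.sum_univ_eq_sum_range (fun m => ∑ n ∈ range L,
        qE x i.succ m * pE κ x j m * qE x j n * pE κ x i.succ n)]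
    refine sum_congr rfl fun m _ => ?_
    exact sum_fin_eq_sum_range _ (fun n => qE x i.succ (m : ℕ) * pE κ x j (m : ℕ) *
        qE x j n * pE κ x i.succ n) fun n => by simp only [qE_natCast, pE_natCast]

end Extended

end HLN

namespace HLN

set_option linter.unusedSectionVars false

open Finset

/-! ### Admissibility of the transformed parameters. -/

section Parameters

variable {L N : ℕ} [NeZero L]

/-- The shift trades `e_{L-1}` for `e_{-1} = e_{L-1} - 1`. In `etaParams` this loss is made up by
`L` summands `1 / L` in the sum of the `e_n`, and it matches `θ_i - 1` in the sum of the `κ_n`. -/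
theorem sum_eExt_shift (κ : Params L N) :
    ∑ n : Fin L, eExt κ ((n : ℕ) - 1) = ∑ n, κ.e n - 1 := by
  rw [sum_fin_eq_sum_range (fun n : Fin L => eExt κ ((n : ℕ) - 1)) (fun n => eExt κ (n - 1))
    (fun _ => rfl), sum_fin_eq_sum_range κ.e (eExt κ) (eExt_natCast κ)]
  have h := sum_range_succ (fun n : ℕ => eExt κ ((n : ℤ) - 1)) L
  rw [sum_range_succ'] at h
  have h1 := eExt_add κ (-1)
  rw [show (-1 + (L : ℤ)) = (L : ℤ) - 1 by ring] at h1
  simp only [Nat.cast_add, Nat.cast_one, add_sub_cancel_right, Nat.cast_zero, zero_sub] at h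
  rw [h1] at h
  linear_combination (-1 : ℂ) * h

theorem sum_reflect_fin {M : Type*} [AddCommMonoid M] (f : ℤ → M) :
    ∑ n : Fin L, f ((L : ℤ) - (n : ℕ)) = ∑ n ∈ range L, f ((n : ℤ) + 1) := by
  rw [sum_fin_eq_sum_range (fun n : Fin L => f ((L : ℤ) - (n : ℕ))) (fun n => f (L - n))
    (fun _ => rfl), ← sum_range_reflect (fun n : ℕ => f ((n : ℤ) + 1))]
  refine sum_congr rfl fun n hn => ?_
  have := mem_range.1 hn
  congr 1
  omega

theorem etaParams_admissible {κ : Params L N} (hκ : κ.Admissible) (i : Fin (N + 1)) :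
    (etaParams i κ).Admissible := by
  have hL : (L : ℂ) ≠ 0 := by exact_mod_cast NeZero.ne L
  constructor
  · simp only [etaParams, sum_add_distrib, sum_eExt_shift, hκ.1, sum_const, card_univ,
      Fintype.card_fin, nsmul_eq_mul]
    field_simp
    ring
  · simp only [etaParams, sum_add_distrib, sum_eExt_shift, sum_sub_distrib, hκ.2]
    rw [sum_update_of_mem (mem_univ i), ← add_sum_erase univ κ.θ (mem_univ i),
      sdiff_singleton_eq_erase]
    ring

theorem zetaParams_admissible {κ : Params L N} (hκ : κ.Admissible) (i j : Fin (N + 1)) :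
    (zetaParams i j κ).Admissible := by
  refine ⟨hκ.1, ?_⟩
  simp only [zetaParams]
  rw [hκ.2, Equiv.sum_comp (Equiv.swap i j) κ.θ]

theorem iotaParams_admissible {κ : Params L N} (hκ : κ.Admissible) :
    (iotaParams κ).Admissible := by
  constructor
  · simp only [iotaParams, sum_add_distrib, sum_neg_distrib, sum_const, card_univ,
      Fintype.card_fin, nsmul_eq_mul]
    rw [sum_reflect_fin]
    have h := sum_range_succ (fun n : ℕ => eExt κ (n : ℤ)) L
    rw [sum_range_succ'] at h
    have h1 := eExt_add κ 0
    rw [zero_add] at h1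
    rw [h1, ← sum_fin_eq_sum_range κ.e (eExt κ) (eExt_natCast κ), hκ.1] at h
    push_cast at h
    linear_combination (-1 : ℂ) * h
  · simp only [iotaParams, sum_neg_distrib, ← hκ.2]
    rw [sum_reflect_fin, sum_fin_eq_sum_range κ.k (kExt κ) (kExt_natCast κ)]
    congr 1
    have := sum_range_shift L (fun n : ℕ => kExt κ (n : ℤ))
      (by have := kExt_add κ 0; rw [zero_add] at this; simpa using this)
    push_cast at this
    exact this

theorem kExt_etaParams (i : Fin (N + 1)) (κ : Params L N) {n : ℕ} (hn : n < L) :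
    kExt (etaParams i κ) n = kExt κ n - eExt κ n + eExt κ ((n : ℤ) - 1) := by
  have h1 := kExt_natCast (etaParams i κ) ⟨n, hn⟩
  have h2 := kExt_natCast κ ⟨n, hn⟩
  have h3 := eExt_natCast κ ⟨n, hn⟩
  simp only at h1 h2 h3
  rw [h1, h2, h3]
  rfl

theorem eExt_etaParams (i : Fin (N + 1)) (κ : Params L N) {n : ℕ} (hn : n < L) :
    eExt (etaParams i κ) n = eExt κ ((n : ℤ) - 1) + 1 / (L : ℂ) := by
  have h1 := eExt_natCast (etaParams i κ) ⟨n, hn⟩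
  simp only at h1
  rw [h1]
  rfl

theorem eExt_iotaParams (κ : Params L N) {n : ℕ} (hn : n < L) :
    eExt (iotaParams κ) n = - eExt κ ((L : ℤ) - n) + 1 := by
  have h1 := eExt_natCast (iotaParams κ) ⟨n, hn⟩
  simp only at h1
  rw [h1]
  rfl

end Parameters

/-! ### The transformation `η_i` as a difference transformation up to scaling. -/

section Eta

variable {L N : ℕ} [NeZero L] {F : Type} [Field F] [Algebra ℂ F]

/-- `s_j`, scaled so that `s_i = 1`. -/
def normS (i : Fin (N + 1)) (x : Phase L N F) (j : Fin (N + 1)) : F := sB x j / sB x i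

/-- `q_n^{(j)}`, scaled so that `p_n^{(i)} = 1`. -/
def normQ (κ : Params L N) (i : Fin (N + 1)) (x : Phase L N F) (j : Fin (N + 1)) (n : ℕ) : F :=
  pE κ x i n * qE x j n

/-- `p_n^{(j)}`, scaled so that `p_n^{(i)} = 1`. -/
def normP (κ : Params L N) (i : Fin (N + 1)) (x : Phase L N F) (j : Fin (N + 1)) (n : ℕ) : F :=
  pE κ x j n / pE κ x i n

/-- `p_{n-1}^{(j)}`, scaled so that `p_n^{(i)} = 1`. -/
def shiftP (κ : Params L N) (i : Fin (N + 1)) (x : Phase L N F) (j : Fin (N + 1)) (n : ℕ) : F :=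
  pE κ x j ((n : ℤ) - 1) / pE κ x i ((n : ℤ) - 1)

/-- The image of `q_n^{(j)}` under `η_i`, up to scaling. -/
def hatQ (κ : Params L N) (i : Fin (N + 1)) (x : Phase L N F) (j : Fin (N + 1)) (n : ℕ) : F :=
  if j = i then 1 else ∑ m ∈ range n, normQ κ i x j m
    + 1 / (normS i x j - 1) * ∑ m ∈ range L, normQ κ i x j m

/-- The image of `p_n^{(j)}` under `η_i`, up to scaling. -/
def hatP (κ : Params L N) (i : Fin (N + 1)) (x : Phase L N F) (j : Fin (N + 1)) (n : ℕ) : F :=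
  if j = i then algebraMap ℂ F (kExt κ n - eExt κ n + eExt κ ((n : ℤ) - 1))
    - ∑ l ∈ univ.erase i, hatQ κ i x l n * (shiftP κ i x l n - shiftP κ i x l (n + 1))
  else shiftP κ i x j n - shiftP κ i x j (n + 1)

variable {κ : Params L N} {i : Fin (N + 1)} {x : Phase L N F}

theorem normS_sub_one (hx : Regular x) {j : Fin (N + 1)} (hj : j ≠ i) : normS i x j - 1 ≠ 0 := by
  have h := hx.1 i
  rw [normS, div_sub_one h]
  exact div_ne_zero (sub_ne_zero.2 fun h' => hj (hx.2 h')) h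

theorem normS_injective (hx : Regular x) : Function.Injective (normS i x) := fun a b h => by
  have h' := hx.1 i
  simp only [normS] at h
  exact hx.2 ((div_left_inj' h').1 h)

/-- The term with `1 / (normS - 1)` in `hatQ` is the constant of summation that gives it the
quasi-period `normS`. The relation for `shiftP` compares the momenta at `-1` and `L - 1`. -/
theorem diffPair (hx : Regular x) (hp : ∀ n : Fin L, pB κ x i n ≠ 0) :
    DiffPair L i (normS i x) (normQ κ i x) (normP κ i x) (hatQ κ i x) (hatP κ i x)
      (shiftP κ i x) where
  s_i := div_self (hx.1 i)
  Qh_succ k hk n hn := by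
    simp only [hatQ, if_neg hk, sum_range_succ]; ring
  Qh_period k hk := by
    have := normS_sub_one (i := i) hx hk
    simp only [hatQ, if_neg hk, range_zero, sum_empty]
    field_simp
    ring
  P_eq k hk n hn := by
    simp only [normP, shiftP, Nat.cast_add, Nat.cast_one, add_sub_cancel_right]
  R_zero k hk := by
    have h1 : ∀ j, pE κ x j (-1) = sB x j * pE κ x j ((L : ℤ) - 1) := fun j => by
      have := pE_add (κ := κ) (hx.1 j) (-1)
      rw [show (-1 + (L : ℤ)) = (L : ℤ) - 1 by ring] at this
      rw [this, mul_div_cancel₀ _ (hx.1 j)]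
    simp only [shiftP, Nat.cast_zero, zero_sub, h1, normS]
    rw [mul_div_mul_comm]
  Ph_eq k hk n hn := by simp only [hatP, if_neg hk]
  P_i n hn := by
    have := hp ⟨n, hn⟩
    rw [← pE_natCast] at this
    exact div_self this
  Qh_i n hn := by simp only [hatQ, if_true]

/-- The sum runs over a window of length `L` sliding with `n`. A step gains `p_n q_n` and loses
`p_{n-L} q_{n-L} = (s_i / s_j) p_n q_n`, so the sum is `1 - s_i / s_j` times an antiderivative of
`normQ`, and the initial values agree. Thus the sums in the formulas for `η_i` are `hatQ` up to a
factor independent of `n`. -/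
theorem etaB_eq (hx : Regular x) {j : Fin (N + 1)} (hj : j ≠ i) (n : ℕ) :
    etaB κ i x n j = (sB x j - sB x i) / sB x j * hatQ κ i x j n := by
  have hi := hx.1 i
  have hj' := hx.1 j
  have hd := normS_sub_one (i := i) hx hj
  have hij : sB x j - sB x i ≠ 0 := sub_ne_zero.2 fun h => hj (hx.2 h)
  have hper : ∀ m : ℤ, pE κ x i (m - L) * qE x j (m - L)
      = sB x i / sB x j * (pE κ x i m * qE x j m) := fun m => by
    have h1 := pE_add (κ := κ) hi (m - L)
    have h2 := qE_add hj' (m - L)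
    rw [sub_add_cancel] at h1 h2
    rw [h1, h2]
    field_simp
  have hIcc : ∀ f : ℕ → F, ∑ m ∈ Icc 1 L, f m = ∑ m ∈ range L, f (m + 1) := fun f => by
    rw [range_eq_Ico, sum_Ico_add' f 0 L 1]
    rfl
  induction n with
  | zero =>
    rw [etaB, hIcc, ← sum_range_reflect]
    simp only [hatQ, if_neg hj, range_zero, sum_empty, zero_add, normS]
    have : ∀ m ∈ range L, pE κ x i (((0 : ℕ) : ℤ) - ((L - 1 - m + 1 : ℕ) : ℤ)) *
        qE x j (((0 : ℕ) : ℤ) - ((L - 1 - m + 1 : ℕ) : ℤ))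
        = sB x i / sB x j * normQ κ i x j m := fun m hm => by
      have := mem_range.1 hm
      rw [normQ, ← hper, show ((0 : ℕ) : ℤ) - ((L - 1 - m + 1 : ℕ) : ℤ) = (m : ℤ) - L by omega]
    rw [sum_congr rfl this, ← mul_sum, ← mul_assoc]
    congr 1
    rw [div_sub_one hi]
    field_simp
  | succ n ih =>
    have h1 : etaB κ i x ((n + 1 : ℕ) : ℤ) j = etaB κ i x n j + pE κ x i n * qE x j n
        - pE κ x i ((n : ℤ) - L) * qE x j ((n : ℤ) - L) := by
      rw [etaB, etaB, hIcc, hIcc]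
      have h2 := sum_range_succ (fun m : ℕ => pE κ x i ((n : ℤ) - m) * qE x j ((n : ℤ) - m)) L
      rw [sum_range_succ'] at h2
      have h3 : ∀ m : ℕ, (((n + 1 : ℕ) : ℤ) - ((m + 1 : ℕ) : ℤ)) = (n : ℤ) - m := fun m => by
        push_cast; ring
      simp only [h3]
      simp only [Nat.cast_zero, sub_zero] at h2
      linear_combination (-1 : F) * h2
    rw [h1, ih, hper, (show hatQ κ i x j (n + 1) = hatQ κ i x j n + normQ κ i x j n by
      simp only [hatQ, if_neg hj, sum_range_succ]; ring), normQ]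
    field_simp
    ring

theorem hatQ_ne_zero (hx : ((eta κ i).Dom F x)) (j : Fin (N + 1)) {n : ℕ} (hn : n < L) :
    hatQ κ i x j n ≠ 0 := by
  by_cases hj : j = i
  · simp [hatQ, hj]
  · have h := hx.2.2 j hj ⟨n, hn⟩
    simp only at h
    rw [etaB_eq hx.1 hj] at h
    exact right_ne_zero_of_mul h

theorem etaRatio_eq (hx : Regular x) (n : ℕ) (j : Fin (N + 1)) :
    etaRatio κ i x n j = hatQ κ i x j n / hatQ κ i x j 0 := by
  by_cases hj : j = i
  · simp [etaRatio, hatQ, hj]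
  · have h0 := etaB_eq (κ := κ) hx hj 0
    rw [Nat.cast_zero] at h0
    have hij : sB x j - sB x i ≠ 0 := sub_ne_zero.2 fun h => hj (hx.2 h)
    rw [etaRatio, if_neg hj, h0, etaB_eq hx hj, mul_div_mul_left]
    exact div_ne_zero hij (hx.1 j)

/-- Exhibits `η_i(q)` as a scaling `a_j b_n hatQ`, with the factors that restore `q^{(0)} = q_0 =
1`. -/
theorem etaQ_eq (hx : Regular x) (n : Fin L) (j : Fin (N + 1)) :
    etaQ κ i x n j = hatQ κ i x 0 0 / hatQ κ i x j 0 * (1 / hatQ κ i x 0 n) * hatQ κ i x j n := by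
  rw [etaQ, etaRatio_eq hx, etaRatio_eq hx, div_div_eq_mul_div]
  ring

theorem etaQ_ne_zero (hx : ((eta κ i).Dom F x)) (n : Fin L) (j : Fin (N + 1)) :
    etaQ κ i x n j ≠ 0 := by
  have h := fun j (n : Fin L) => hatQ_ne_zero hx j n.2
  have h0 := fun j => h j 0
  simp only [Fin.val_zero] at h0
  rw [etaQ_eq hx.1]
  exact mul_ne_zero (mul_ne_zero (div_ne_zero (h0 _) (h0 _)) (one_div_ne_zero (h _ _))) (h _ _)

/-- Products `q p` do not see the scaling: `s_j / (s_i - s_j)` is, up to sign, inverse to the factor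
in `etaB_eq`, and the sign reverses the difference of momenta. -/
theorem etaQ_mul_etaPExpr (hx : ((eta κ i).Dom F x)) (n : Fin L) {j : Fin (N + 1)} (hj : j ≠ i) :
    etaQ κ i x n j * etaPExpr κ i x n j (etaQ κ i x n j) = hatQ κ i x j n * hatP κ i x j n := by
  have h := etaQ_ne_zero hx n j
  have hij : sB x i - sB x j ≠ 0 := sub_ne_zero.2 fun h => hj (hx.1.2 h).symm
  have hj' := hx.1.1 j
  rw [etaPExpr, etaB_eq hx.1 hj]
  simp only [hatP, if_neg hj, shiftP, Nat.cast_add, Nat.cast_one, add_sub_cancel_right]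
  field_simp
  ring

theorem etaQ_mul_etaP (hx : ((eta κ i).Dom F x)) (n : Fin L) (j : Fin (N + 1)) :
    etaQ κ i x n j * etaP κ i x n j = hatQ κ i x j n * hatP κ i x j n := by
  by_cases hj : j = i
  · subst hj
    have h := etaQ_ne_zero hx n j
    rw [etaP, if_pos rfl, ← mul_assoc, mul_one_div_cancel h, one_mul,
      sum_congr rfl fun l hl => etaQ_mul_etaPExpr hx n (ne_of_mem_erase hl)]
    simp only [hatP, hatQ, if_true, one_mul, kExt_natCast, eExt_natCast]
    congr 1
    refine sum_congr rfl fun l hl => ?_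
    rw [if_neg (ne_of_mem_erase hl), if_neg (ne_of_mem_erase hl)]
  · rw [etaP, if_neg hj, etaQ_mul_etaPExpr hx n hj]

theorem etaQ_zero_right (hx : ((eta κ i).Dom F x)) (j : Fin (N + 1)) : etaQ κ i x 0 j = 1 := by
  have h := fun j => hatQ_ne_zero hx j (Nat.pos_of_neZero L)
  have h0 := h 0
  have hj := h j
  rw [etaQ_eq hx.1]
  simp only [Fin.val_zero]
  field_simp

theorem etaQ_zero_left (hx : ((eta κ i).Dom F x)) (n : Fin L) : etaQ κ i x n 0 = 1 := by
  have h1 := hatQ_ne_zero hx 0 n.2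
  have h0 := hatQ_ne_zero hx 0 (Nat.pos_of_neZero L)
  rw [etaQ_eq hx.1]
  field_simp

theorem hat_col (n : ℕ) : ∑ j, hatQ κ i x j n * hatP κ i x j n
    = algebraMap ℂ F (kExt κ n - eExt κ n + eExt κ ((n : ℤ) - 1)) := by
  rw [← add_sum_erase univ _ (mem_univ i)]
  have h1 : hatQ κ i x i n = 1 := if_pos rfl
  have h2 : hatP κ i x i n = algebraMap ℂ F (kExt κ n - eExt κ n + eExt κ ((n : ℤ) - 1))
      - ∑ l ∈ univ.erase i, hatQ κ i x l n * (shiftP κ i x l n - shiftP κ i x l (n + 1)) :=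
    if_pos rfl
  have h3 : ∀ l ∈ univ.erase i, hatQ κ i x l n * hatP κ i x l n
      = hatQ κ i x l n * (shiftP κ i x l n - shiftP κ i x l (n + 1)) := fun l hl => by
    rw [hatP, if_neg (ne_of_mem_erase hl)]
  rw [h1, h2, sum_congr rfl h3]
  ring

theorem norm_row (hp : ∀ n : Fin L, pB κ x i n ≠ 0) (j : Fin (N + 1)) :
    ∑ n ∈ range L, normQ κ i x j n * normP κ i x j n = algebraMap ℂ F (κ.θ j) := by
  rw [← sum_row_range κ x j]
  refine sum_congr rfl fun n hn => ?_
  have h := hp ⟨n, mem_range.1 hn⟩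
  rw [← pE_natCast] at h
  simp only at h
  rw [normQ, normP]
  field_simp

theorem norm_col (hκ : κ.Admissible) (hp : ∀ n : Fin L, pB κ x i n ≠ 0) {n : ℕ} (hn : n < L) :
    ∑ j, normQ κ i x j n * normP κ i x j n = algebraMap ℂ F (kExt κ n) := by
  rw [← sum_col_range hκ x n hn]
  refine sum_congr rfl fun j _ => ?_
  have h := hp ⟨n, hn⟩
  rw [← pE_natCast] at h
  simp only at h
  rw [normQ, normP]
  field_simp

/-- Rows `j ≠ i` are preserved by summation by parts. Row `i` is forced by the columns, and `θ_i -
1` balances the total. -/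
theorem hat_row (hκ : κ.Admissible) (hx : ((eta κ i).Dom F x)) (j : Fin (N + 1)) :
    ∑ n ∈ range L, hatQ κ i x j n * hatP κ i x j n
      = algebraMap ℂ F ((etaParams i κ).θ j) := by
  rw [← Fin.sum_univ_eq_sum_range (fun n => hatQ κ i x j n * hatP κ i x j n)]
  refine sum_row_of_erase (etaParams_admissible hκ i) (i := i)
    (q := fun j n => hatQ κ i x j n) (p := fun j n => hatP κ i x j n)
    (fun j hj => ?_) (fun n => ?_) j
  · rw [Fin.sum_univ_eq_sum_range (fun n => hatQ κ i x j n * hatP κ i x j n),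
      (diffPair hx.1 hx.2.1).sum_eq hj, norm_row hx.2.1]
    simp [etaParams, Function.update_of_ne hj]
  · rw [hat_col, ← kExt_etaParams i κ n.2, kExt_natCast]

/-- The extended variables at the image of `x` under `η_i`. -/
theorem eta_extended (hκ : κ.Admissible) (hx : ((eta κ i).Dom F x)) :
    (∀ j n, qB ((eta κ i).toFun F x) j n = etaQ κ i x n j) ∧
      ∀ j n, pB (etaParams i κ) ((eta κ i).toFun F x) j n = etaP κ i x n j := by
  refine extended_eq (q := fun j n => etaQ κ i x n j) (p := fun j n => etaP κ i x n j)
    (etaQ_zero_left hx) (etaQ_zero_right hx) (fun a n => rfl) (fun a n => rfl) (fun j => ?_)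
    fun n => ?_
  · rw [sum_congr rfl fun n _ => etaQ_mul_etaP hx n j,
      Fin.sum_univ_eq_sum_range (fun n => hatQ κ i x j n * hatP κ i x j n), hat_row hκ hx]
  · rw [sum_congr rfl fun j _ => etaQ_mul_etaP hx n j, hat_col, ← kExt_etaParams i κ n.1.2,
      kExt_natCast]

/-- For `j = i` the factors `s_i` cancel, so the summand is `L`-periodic and every window carries
the full row sum. -/
theorem etaB_self (hx : Regular x) (n : ℕ) : etaB κ i x n i = algebraMap ℂ F (κ.θ i) := by
  have hi := hx.1 i
  have hper : ∀ m : ℤ, pE κ x i (m - L) * qE x i (m - L) = pE κ x i m * qE x i m := fun m => by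
    have h1 := pE_add (κ := κ) hi (m - L)
    have h2 := qE_add hi (m - L)
    rw [sub_add_cancel] at h1 h2
    rw [h1, h2]
    field_simp
  have hIcc : ∀ f : ℕ → F, ∑ m ∈ Icc 1 L, f m = ∑ m ∈ range L, f (m + 1) := fun f => by
    rw [range_eq_Ico, sum_Ico_add' f 0 L 1]
    rfl
  induction n with
  | zero =>
    rw [etaB, hIcc, ← sum_range_reflect, ← sum_row_range κ x i]
    refine sum_congr rfl fun m hm => ?_
    have := mem_range.1 hm
    rw [show ((0 : ℕ) : ℤ) - ((L - 1 - m + 1 : ℕ) : ℤ) = (m : ℤ) - L by omega, hper, mul_comm]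
  | succ n ih =>
    rw [← ih, etaB, etaB, hIcc, hIcc]
    have h2 := sum_range_succ (fun m : ℕ => pE κ x i ((n : ℤ) - m) * qE x i ((n : ℤ) - m)) L
    rw [sum_range_succ', hper] at h2
    have h3 : ∀ m : ℕ, (((n + 1 : ℕ) : ℤ) - ((m + 1 : ℕ) : ℤ)) = (n : ℤ) - m := fun m => by
      push_cast; ring
    simp only [h3]
    simp only [Nat.cast_zero, sub_zero] at h2
    exact (add_right_cancel h2).symm

/-- `etaRatio` differs from the displayed quotient only by the cancelled `θ_i / θ_i`. The cases `j =
0` and `n = 0` are included because `eta_extended` identifies all extended variables of the image.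
-/
theorem etaFormulas_of_dom (hκ : κ.Admissible) (hθ : κ.θ i ≠ 0) (hx : ((eta κ i).Dom F x)) :
    EtaFormulas κ i x := by
  obtain ⟨hq, hp⟩ := eta_extended hκ hx
  have hθ' : algebraMap ℂ F (κ.θ i) ≠ 0 := (map_ne_zero _).2 hθ
  have hratio : ∀ (n : ℕ) j, etaRatio κ i x n j = etaB κ i x n j / etaB κ i x 0 j := by
    intro n j
    by_cases hj : j = i
    · subst hj
      have := etaB_self (κ := κ) (i := j) hx.1 0
      rw [Nat.cast_zero] at this
      rw [etaB_self hx.1, this, div_self hθ', etaRatio, if_pos rfl]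
    · rw [etaRatio, if_neg hj]
  have hA : ∀ n : ℤ, etaA κ i x n = etaB κ i x n 0 := fun n => by
    refine sum_congr rfl fun m _ => ?_
    rw [qE, sB_zero, one_zpow, qB_zero_left, one_mul, mul_one]
  intro n
  refine ⟨fun j => ?_, fun j hj => ?_, ?_⟩
  · rw [hq, etaQ, hratio, hratio, hA, hA, div_div_div_eq, mul_comm]
    congr 1
    exact mul_comm _ _
  · rw [hp, hq, etaP, if_neg hj]
  · rw [hp, hq, etaP, if_pos rfl]
    congr 2
    refine sum_congr rfl fun j hj => ?_
    rw [hp, hq, etaP, if_neg (ne_of_mem_erase hj)]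

end Eta

end HLN

namespace HLN

set_option linter.unusedSectionVars false

open Finset

/-! ### The transformations `ζ_{ij}` as permutations of `0, …, N`. -/

section Perm

variable {L N : ℕ} [NeZero L]

/-- The transformation of the variables that permutes the indices `0, …, N` by `π`. -/
def permTransf (κ : Params L N) (π : Equiv.Perm (Fin (N + 1))) : Transf L N where
  toFun _ _ _ x :=
    (fun a => sB x (π a.succ) / sB x (π 0),
      fun a n => qB x (π a.succ) n / qB x (π 0) n,
      fun a n => pB κ x (π a.succ) n * qB x (π 0) n)
  Dom _ _ _ x := Regular x ∧ ∀ n : Fin L, qB x (π 0) n ≠ 0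

/-- A permutation of the indices destroys `s_0 = q^{(0)} = 1`, and dividing by the entries that land
at index 0 restores it. These are the quotients in `ζ_{i0}`; when 0 is fixed the divisors are 1. -/
theorem zeta_eq_permTransf (κ : Params L N) {i j : Fin (N + 1)} (hij : i ≠ j) :
    zeta κ i j = permTransf κ (Equiv.swap i j) := by
  have h0 : ∀ j, j ≠ 0 → zetaZero κ j = permTransf κ (Equiv.swap 0 j) := by
    intro j hj
    simp only [zetaZero, permTransf, Equiv.swap_apply_left]
    congr 1
    funext F _ _ x
    have h : ∀ a : Fin N, Equiv.swap 0 j a.succ = if a.succ = j then 0 else a.succ := fun a => by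
      rw [Equiv.swap_apply_def, if_neg (Fin.succ_ne_zero a)]
    refine Prod.ext ?_ (Prod.ext ?_ ?_)
    · funext a
      simp only [h]
      split_ifs
      · rw [sB_zero]
      · rw [sB_succ]
    · funext a n
      simp only [h]
      split_ifs
      · rw [qB_zero_left]
      · rw [qB_succ]
    · funext a n
      simp only [h]
      split_ifs
      · rw [mul_comm]
      · rw [pB_succ, mul_comm]
  unfold zeta
  split_ifs with hi hj
  · subst hi
    exact h0 j hij.symm
  · subst hj
    rw [Equiv.swap_comm]
    exact h0 i hij
  · have h : Equiv.swap i j 0 = 0 := Equiv.swap_apply_of_ne_of_ne (Ne.symm hi) (Ne.symm hj)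
    simp only [zetaSwap, permTransf, h, sB_zero, qB_zero_left, div_one, mul_one, ne_eq, one_ne_zero,
      not_false_eq_true, implies_true, and_true]

/-- Action of a permutation of the indices `0, …, N` on the parameters. -/
def permParams (π : Equiv.Perm (Fin (N + 1))) (κ : Params L N) : Params L N where
  e := κ.e
  k := κ.k
  θ l := κ.θ (π l)

variable {F : Type} [Field F] [Algebra ℂ F]

theorem perm_sB {κ : Params L N} {π : Equiv.Perm (Fin (N + 1))} {x : Phase L N F}
    (h : sB x (π 0) ≠ 0) (j : Fin (N + 1)) :
    sB ((permTransf κ π).toFun F x) j = sB x (π j) / sB x (π 0) := by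
  refine Fin.cases ?_ (fun a => rfl) j
  rw [sB_zero, div_self h]

/-- The extended variables at the image of `x` under a permutation. -/
theorem perm_extended {κ : Params L N} (hκ : κ.Admissible) {π : Equiv.Perm (Fin (N + 1))}
    {x : Phase L N F} (hx : ∀ n, qB x (π 0) n ≠ 0) :
    (∀ j n, qB ((permTransf κ π).toFun F x) j n = qB x (π j) n / qB x (π 0) n) ∧
      ∀ j n, pB (permParams π κ) ((permTransf κ π).toFun F x) j n
        = pB κ x (π j) n * qB x (π 0) n := by
  have hqp : ∀ j n, qB x (π j) n / qB x (π 0) n * (pB κ x (π j) n * qB x (π 0) n)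
      = qB x (π j) n * pB κ x (π j) n := fun j n => by
    have := hx n
    field_simp
  refine extended_eq (fun n => div_self (hx n)) (fun j => by simp) (fun a n => rfl)
    (fun a n => rfl) (fun j => ?_) fun n => ?_
  · rw [sum_congr rfl fun n _ => hqp j n, sum_row]
    rfl
  · rw [sum_congr rfl fun j _ => hqp j n,
      Equiv.sum_comp π fun j => qB x j (n : Fin L) * pB κ x j n, sum_col hκ]
    rfl

end Perm

/-! ### The transformation `ι` as a reflection exchanging `q` and `p`. -/

section Iota

variable {L N : ℕ} [NeZero L] {F : Type} [Field F] [Algebra ℂ F] {κ : Params L N} {x : Phase L N F}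

/-- `ι(q_n^{(j)})`. -/
def iotaQ (κ : Params L N) (x : Phase L N F) (j : Fin (N + 1)) (n : ℕ) : F :=
  sB x j * pE κ x j ((L : ℤ) - n) * pE κ x 0 0 / (pE κ x 0 ((L : ℤ) - n) * pE κ x j 0)

/-- `ι(p_n^{(j)})`. -/
def iotaP (κ : Params L N) (x : Phase L N F) (j : Fin (N + 1)) (n : ℕ) : F :=
  - (qE x j ((L : ℤ) - n) * pE κ x j 0 * pE κ x 0 ((L : ℤ) - n) / (sB x j * pE κ x 0 0))

theorem pE_zero (κ : Params L N) (x : Phase L N F) (j : Fin (N + 1)) :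
    pE κ x j 0 = pB κ x j 0 := by
  have := pE_natCast κ x j 0
  simpa using this

theorem qE_zero (x : Phase L N F) (j : Fin (N + 1)) : qE x j 0 = 1 := by
  have := qE_natCast x j 0
  simpa using this

theorem pE_period (κ : Params L N) {x : Phase L N F} (hx : Regular x) (j : Fin (N + 1)) :
    pE κ x j L = pE κ x j 0 / sB x j := by
  have := pE_add (κ := κ) (hx.1 j) 0
  rwa [zero_add] at this

theorem qE_period {x : Phase L N F} (hx : Regular x) (j : Fin (N + 1)) :
    qE x j L = sB x j * qE x j 0 := by
  have := qE_add (hx.1 j) 0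
  rwa [zero_add] at this

theorem pE_zero_reflect_ne_zero (hx : (iota κ).Dom F x) {n : ℕ} (hn : n < L) :
    pE κ x 0 ((L : ℤ) - n) ≠ 0 := by
  rcases Nat.eq_zero_or_pos n with rfl | h
  · rw [Nat.cast_zero, sub_zero, pE_period κ hx.1, sB_zero, div_one, pE_zero]
    exact hx.2.1 0
  · have := hx.2.1 ⟨L - n, by omega⟩
    rw [← pE_natCast] at this
    simpa only [Nat.cast_sub hn.le] using this

/-- All scaling factors cancel in the product, leaving the pure reflection; the row and column
relations of the image follow from this. -/
theorem iotaQ_mul_iotaP (hx : (iota κ).Dom F x) (j : Fin (N + 1)) {n : ℕ} (hn : n < L) :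
    iotaQ κ x j n * iotaP κ x j n
      = - (qE x j ((L : ℤ) - n) * pE κ x j ((L : ℤ) - n)) := by
  have h1 := hx.1.1 j
  have h2 := hx.2.2 j
  have h3 := hx.2.2 0
  have h4 := pE_zero_reflect_ne_zero hx hn
  rw [← pE_zero] at h2 h3
  rw [iotaQ, iotaP]
  field_simp

theorem iota_row (hx : (iota κ).Dom F x) (j : Fin (N + 1)) :
    ∑ n ∈ range L, iotaQ κ x j n * iotaP κ x j n = algebraMap ℂ F ((iotaParams κ).θ j) := by
  have h1 : ∑ n ∈ range L, iotaQ κ x j n * iotaP κ x j n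
      = - ∑ n ∈ range L, qE x j ((n : ℤ) + 1) * pE κ x j ((n : ℤ) + 1) := by
    rw [← sum_reflect_fin (L := L) fun n => qE x j n * pE κ x j n, ← sum_neg_distrib,
      ← Fin.sum_univ_eq_sum_range (fun n => iotaQ κ x j n * iotaP κ x j n)]
    exact sum_congr rfl fun n _ => iotaQ_mul_iotaP hx j n.2
  have h2 : ∑ n ∈ range L, qE x j ((n : ℤ) + 1) * pE κ x j ((n : ℤ) + 1)
      = ∑ n ∈ range L, qE x j n * pE κ x j n := by
    have := sum_range_shift L (fun n : ℕ => qE x j n * pE κ x j n) (by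
      have := hx.1.1 j
      simp only [Nat.cast_zero]
      rw [qE_period hx.1, pE_period κ hx.1]
      field_simp)
    push_cast at this
    exact this
  rw [h1, h2, sum_row_range]
  simp [iotaParams]

/-- The extended variables at the image of `x` under `ι`. -/
theorem iota_extended (hκ : κ.Admissible) (hx : (iota κ).Dom F x) :
    (∀ j n, qB ((iota κ).toFun F x) j n = iotaQ κ x j (n : ℕ)) ∧
      ∀ j n, pB (iotaParams κ) ((iota κ).toFun F x) j n = iotaP κ x j (n : ℕ) := by
  have h3 := hx.2.2 0
  rw [← pE_zero] at h3
  refine extended_eq (fun n => ?_) (fun j => ?_) (fun a n => rfl)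
    (fun a n => rfl) (fun j => ?_) fun n => ?_
  · have h4 := pE_zero_reflect_ne_zero hx n.2
    rw [iotaQ, sB_zero]
    field_simp
  · have h1 := hx.1.1 j
    have h2 := hx.2.2 j
    rw [← pE_zero] at h2
    rw [iotaQ, Fin.val_zero, Nat.cast_zero, sub_zero, pE_period κ hx.1, pE_period κ hx.1, sB_zero]
    field_simp
  · rw [Fin.sum_univ_eq_sum_range (fun n => iotaQ κ x j n * iotaP κ x j n), iota_row hx]
  · rw [sum_congr rfl fun j _ => iotaQ_mul_iotaP hx j n.1.2, sum_neg_distrib]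
    have hn : 0 < (n.1 : ℕ) := Nat.pos_of_ne_zero fun h => n.2 (Fin.ext h)
    have := sum_col_range hκ x (L - n.1) (by have := n.1.2; omega)
    rw [Nat.cast_sub n.1.2.le] at this
    rw [this]
    simp [iotaParams]

end Iota

end HLN

namespace HLN

set_option linter.unusedSectionVars false

open Finset Filter Topology

/-! ### Calculus of `df ∧ dg`. -/

section Wedge

variable {E : Type*} [NormedAddCommGroup E] [NormedSpace ℂ E]

/-- `(df ∧ dg)(v, w)` at the point `x`. -/
noncomputable def wedge (x v w : E) (f g : E → ℂ) : ℂ :=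
  fderiv ℂ f x v * fderiv ℂ g x w - fderiv ℂ f x w * fderiv ℂ g x v

variable {x v w : E}

theorem wedge_congr {f f' g g' : E → ℂ} (hf : f =ᶠ[𝓝 x] f') (hg : g =ᶠ[𝓝 x] g') :
    wedge x v w f g = wedge x v w f' g' := by
  rw [wedge, wedge, hf.fderiv_eq, hg.fderiv_eq]

theorem wedge_const_right (f : E → ℂ) {g : E → ℂ} {c : ℂ} (hg : g =ᶠ[𝓝 x] fun _ => c) :
    wedge x v w f g = 0 := by
  rw [wedge, hg.fderiv_eq]; simp

theorem wedge_const_left {f : E → ℂ} (g : E → ℂ) {c : ℂ} (hf : f =ᶠ[𝓝 x] fun _ => c) :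
    wedge x v w f g = 0 := by
  rw [wedge, hf.fderiv_eq]; simp

theorem wedge_sum_left {ι : Type*} (s : Finset ι) {f : ι → E → ℂ} (g : E → ℂ)
    (hf : ∀ i ∈ s, DifferentiableAt ℂ (f i) x) :
    wedge x v w (fun y => ∑ i ∈ s, f i y) g = ∑ i ∈ s, wedge x v w (f i) g := by
  simp only [wedge, fderiv_fun_sum hf, _root_.sum_apply, sum_mul, sum_sub_distrib]

theorem wedge_add_left {f f' : E → ℂ} (g : E → ℂ)
    (hf : DifferentiableAt ℂ f x) (hf' : DifferentiableAt ℂ f' x) :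
    wedge x v w (fun y => f y + f' y) g = wedge x v w f g + wedge x v w f' g := by
  simp only [wedge, fderiv_fun_add hf hf', _root_.add_apply]; ring

theorem wedge_sub_left {f f' : E → ℂ} (g : E → ℂ)
    (hf : DifferentiableAt ℂ f x) (hf' : DifferentiableAt ℂ f' x) :
    wedge x v w (fun y => f y - f' y) g = wedge x v w f g - wedge x v w f' g := by
  simp only [wedge, fderiv_fun_sub hf hf', _root_.sub_apply]; ring

theorem wedge_sub_right (f : E → ℂ) {g g' : E → ℂ}
    (hg : DifferentiableAt ℂ g x) (hg' : DifferentiableAt ℂ g' x) :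
    wedge x v w f (fun y => g y - g' y) = wedge x v w f g - wedge x v w f g' := by
  simp only [wedge, fderiv_fun_sub hg hg', _root_.sub_apply]; ring

theorem wedge_neg_swap (f g : E → ℂ) : wedge x v w (fun y => - f y) g = wedge x v w g f := by
  simp only [wedge, fderiv_fun_neg, _root_.neg_apply]; ring

theorem differentiableAt_div {f g : E → ℂ} (hf : DifferentiableAt ℂ f x)
    (hg : DifferentiableAt ℂ g x) (h : g x ≠ 0) : DifferentiableAt ℂ (fun y => f y / g y) x := by
  simp only [div_eq_mul_inv]
  exact hf.fun_mul (hg.fun_inv h)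

/-- The differential of `1 / s` is a multiple of `ds` and dies in the wedge with `ds`. -/
theorem wedge_div_self {f s : E → ℂ} (hf : DifferentiableAt ℂ f x) (hs : DifferentiableAt ℂ s x)
    (h : s x ≠ 0) : wedge x v w (fun y => f y / s y) s = wedge x v w f s / s x := by
  have h1 : DifferentiableAt ℂ (fun y => f y / s y) x := differentiableAt_div hf hs h
  have h2 : f =ᶠ[𝓝 x] fun y => (f y / s y) * s y := by
    filter_upwards [hs.continuousAt.eventually_ne h] with y hy
    rw [div_mul_cancel₀ _ hy]
  rw [wedge_congr h2 (EventuallyEq.refl _ s)]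
  simp only [wedge, fderiv_fun_mul h1 hs, _root_.add_apply,
    _root_.smul_apply, smul_eq_mul]
  field_simp
  ring

/-- This is the exterior derivative of `p' dq' = p dq + q p dlog(a b)`. The hypothesis has the form
`a * b * p' = p` so that no quotient has to be differentiated. -/
theorem wedge_gauge {p q p' q' a b : E → ℂ} (hp' : DifferentiableAt ℂ p' x)
    (hq : DifferentiableAt ℂ q x) (ha : DifferentiableAt ℂ a x) (hb : DifferentiableAt ℂ b x)
    (ha0 : a x ≠ 0) (hb0 : b x ≠ 0) (hpp : ∀ᶠ y in 𝓝 x, a y * b y * p' y = p y)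
    (hqq : ∀ᶠ y in 𝓝 x, q' y = a y * b y * q y) :
    wedge x v w p' q' = wedge x v w p q + wedge x v w (fun y => q y * p y) a / a x
      + wedge x v w (fun y => q y * p y) b / b x := by
  have hab : DifferentiableAt ℂ (fun y => a y * b y) x := ha.fun_mul hb
  have habp : DifferentiableAt ℂ (fun y => a y * b y * p' y) x := hab.fun_mul hp'
  have e1 : p =ᶠ[𝓝 x] fun y => a y * b y * p' y := hpp.mono fun y hy => hy.symm
  have e2 : (fun y => q y * p y) =ᶠ[𝓝 x] fun y => q y * (a y * b y * p' y) :=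
    e1.mono fun y hy => by simp only [hy]
  rw [wedge_congr (EventuallyEq.refl _ p') (show q' =ᶠ[𝓝 x] _ from hqq),
    wedge_congr e1 (EventuallyEq.refl _ q), wedge_congr e2 (EventuallyEq.refl _ a),
    wedge_congr e2 (EventuallyEq.refl _ b)]
  simp only [wedge, fderiv_fun_mul hq habp, fderiv_fun_mul hab hp', fderiv_fun_mul hab hq,
    fderiv_fun_mul ha hb, _root_.add_apply, _root_.smul_apply,
    smul_eq_mul]
  field_simp
  ring

theorem wedge_comp {E' : Type*} [NormedAddCommGroup E'] [NormedSpace ℂ E'] {T : E' → E} {x v w : E'}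
    (hT : DifferentiableAt ℂ T x) {f g : E → ℂ} (hf : DifferentiableAt ℂ f (T x))
    (hg : DifferentiableAt ℂ g (T x)) :
    wedge x v w (fun y => f (T y)) (fun y => g (T y))
      = wedge (T x) (fderiv ℂ T x v) (fderiv ℂ T x w) f g := by
  have h1 := fderiv_fun_comp x hf hT
  have h2 := fderiv_fun_comp x hg hT
  rw [wedge, h1, h2]
  rfl

end Wedge

/-! ### Invariance of the 2-form under relabelling, scaling, differences and reflection. -/

section Form

variable {E : Type*} [NormedAddCommGroup E] [NormedSpace ℂ E] {ι : Type*} [Fintype ι]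
  [DecidableEq ι]

/-- The 2-form `∑ dp ∧ dq - ∑ dH ∧ ds` in all the variables. -/
noncomputable def form (L : ℕ) (e : ℕ → ℂ) (s : ι → E → ℂ) (q p : ι → ℕ → E → ℂ) (x v w : E) : ℂ :=
  ∑ j, ∑ n ∈ range L, wedge x v w (p j n) (q j n)
    - ∑ j, wedge x v w (fun y => hamSum L e (fun k => s k y) (fun k n => q k n y)
        (fun k n => p k n y) j / s j y) (s j)

variable {L : ℕ} {e : ℕ → ℂ} {s : ι → E → ℂ} {q p : ι → ℕ → E → ℂ} {x v w : E}

theorem form_perm (π : Equiv.Perm ι) :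
    form L e (fun k => s (π k)) (fun k => q (π k)) (fun k => p (π k)) x v w
      = form L e s q p x v w := by
  unfold form
  congr 1
  · exact Equiv.sum_comp π fun j => ∑ n ∈ range L, wedge x v w (p j n) (q j n)
  · rw [← Equiv.sum_comp π fun j => wedge x v w (fun y => hamSum L e (fun k => s k y)
      (fun k n => q k n y) (fun k n => p k n y) j / s j y) (s j)]
    refine sum_congr rfl fun j _ => ?_
    congr 1
    funext y
    rw [← hamSum_perm π j]

theorem differentiableAt_hamSum (hs : ∀ j, DifferentiableAt ℂ (s j) x)
    (hq : ∀ j, ∀ n < L, DifferentiableAt ℂ (q j n) x)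
    (hp : ∀ j, ∀ n < L, DifferentiableAt ℂ (p j n) x)
    (hinj : Function.Injective fun j => s j x) (j : ι) :
    DifferentiableAt ℂ (fun y => hamSum L e (fun k => s k y) (fun k n => q k n y)
        (fun k n => p k n y) j) x := by
  have h4 : ∀ k, ∀ m < L, ∀ n < L,
      DifferentiableAt ℂ (fun y => q j m y * p k m y * q k n y * p j n y) x :=
    fun k m hm n hn => (((hq j m hm).fun_mul (hp k m hm)).fun_mul (hq k n hn)).fun_mul (hp j n hn)
  unfold hamSum
  refine (DifferentiableAt.fun_add ?_ ?_).fun_add ?_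
  · refine DifferentiableAt.fun_sum fun n hn => ?_
    have hn' := mem_range.1 hn
    exact ((hq j n hn').const_mul _).fun_mul (hp j n hn')
  · refine DifferentiableAt.fun_sum fun k _ => DifferentiableAt.fun_sum fun n hn =>
      DifferentiableAt.fun_sum fun m hm => ?_
    have hn' := mem_range.1 hn
    exact h4 k m ((mem_range.1 hm).trans hn') n hn'
  · refine DifferentiableAt.fun_sum fun k hk => DifferentiableAt.fun_mul ?_ ?_
    · refine differentiableAt_div (hs k) ((hs j).fun_sub (hs k)) (sub_ne_zero.2 fun h => ?_)
      exact ne_of_mem_erase hk (hinj h).symm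
    · exact DifferentiableAt.fun_sum fun m hm => DifferentiableAt.fun_sum fun n hn =>
        h4 k m (mem_range.1 hm) n (mem_range.1 hn)

/-- Invariance of the 2-form under scaling. -/
theorem form_gauge {c : E → ℂ} {a : ι → E → ℂ} {b : ℕ → E → ℂ} {k : ℕ → ℂ} {θ : ι → ℂ}
    (hs : ∀ j, DifferentiableAt ℂ (s j) x)
    (hq : ∀ j, ∀ n < L, DifferentiableAt ℂ (q j n) x)
    (hp : ∀ j, ∀ n < L, DifferentiableAt ℂ (p j n) x)
    (hp' : ∀ j, ∀ n < L, DifferentiableAt ℂ (p' j n) x)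
    (hc : DifferentiableAt ℂ c x) (ha : ∀ j, DifferentiableAt ℂ (a j) x)
    (hb : ∀ n < L, DifferentiableAt ℂ (b n) x)
    (hc0 : c x ≠ 0) (ha0 : ∀ j, a j x ≠ 0) (hb0 : ∀ n < L, b n x ≠ 0)
    (hs0 : ∀ j, s j x ≠ 0) (hinj : ∀ᶠ y in 𝓝 x, Function.Injective fun j => s j y)
    (hcol : ∀ᶠ y in 𝓝 x, ∀ n < L, ∑ j, q j n y * p j n y = k n)
    (hrow : ∀ᶠ y in 𝓝 x, ∀ j, ∑ n ∈ range L, q j n y * p j n y = θ j)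
    (hss : ∀ᶠ y in 𝓝 x, ∀ j, s' j y = c y * s j y)
    (hqq : ∀ᶠ y in 𝓝 x, ∀ j, ∀ n < L, q' j n y = a j y * b n y * q j n y)
    (hpp : ∀ᶠ y in 𝓝 x, ∀ j, ∀ n < L, a j y * b n y * p' j n y = p j n y) :
    form L e s' q' p' x v w = form L e s q p x v w := by
  have hone : DifferentiableAt ℂ (fun _ : E => (1 : ℂ)) x := differentiableAt_const _
  have hqp : ∀ j, ∀ n < L, DifferentiableAt ℂ (fun y => q j n y * p j n y) x :=
    fun j n hn => (hq j n hn).fun_mul (hp j n hn)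
  have h1 : ∑ j, ∑ n ∈ range L, wedge x v w (p' j n) (q' j n)
      = ∑ j, ∑ n ∈ range L, wedge x v w (p j n) (q j n) := by
    have e1 : ∀ j, ∀ n ∈ range L, wedge x v w (p' j n) (q' j n) = wedge x v w (p j n) (q j n)
        + wedge x v w (fun y => q j n y * p j n y) (a j) / a j x
        + wedge x v w (fun y => q j n y * p j n y) (b n) / b n x := by
      intro j n hn
      have hn' := mem_range.1 hn
      exact wedge_gauge (hp' j n hn') (hq j n hn') (ha j) (hb n hn') (ha0 j) (hb0 n hn')
        (hpp.mono fun y hy => hy j n hn') (hqq.mono fun y hy => hy j n hn')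
    rw [sum_congr rfl fun j _ => sum_congr rfl (e1 j)]
    simp only [sum_add_distrib]
    -- `a j` is common to row `j` and `b n` to column `n`, so after summation only differentials of
    -- constant row and column sums remain.
    have e2 : ∀ j, ∑ n ∈ range L, wedge x v w (fun y => q j n y * p j n y) (a j) / a j x = 0 := by
      intro j
      rw [← sum_div, ← wedge_sum_left _ _ fun n hn => hqp j n (mem_range.1 hn),
        wedge_const_left (c := θ j) _ (hrow.mono fun y hy => hy j), zero_div]
    have e3 : ∑ j, ∑ n ∈ range L, wedge x v w (fun y => q j n y * p j n y) (b n) / b n x = 0 := by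
      rw [sum_comm]
      refine sum_eq_zero fun n hn => ?_
      have hn' := mem_range.1 hn
      rw [← sum_div, ← wedge_sum_left _ _ fun j _ => hqp j n hn',
        wedge_const_left (c := k n) _ (hcol.mono fun y hy => hy n hn'), zero_div]
    rw [sum_congr rfl fun j _ => e2 j, e3, sum_const_zero, add_zero, add_zero]
  have hinjx : Function.Injective fun j => s j x := hinj.self_of_nhds
  have hH : ∀ j, DifferentiableAt ℂ (fun y => hamSum L e (fun k => s k y) (fun k n => q k n y)
      (fun k n => p k n y) j) x := fun j => differentiableAt_hamSum hs hq hp hinjx j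
  have hs0' : ∀ᶠ y in 𝓝 x, ∀ j, s j y ≠ 0 :=
    eventually_all.2 fun j => (hs j).continuousAt.eventually_ne (hs0 j)
  have hc0' : ∀ᶠ y in 𝓝 x, c y ≠ 0 := hc.continuousAt.eventually_ne hc0
  have ha0' : ∀ᶠ y in 𝓝 x, ∀ j, a j y ≠ 0 :=
    eventually_all.2 fun j => (ha j).continuousAt.eventually_ne (ha0 j)
  have hgauge : ∀ᶠ y in 𝓝 x, ∀ j, hamSum L e (fun k => s' k y) (fun k n => q' k n y)
      (fun k n => p' k n y) j = hamSum L e (fun k => s k y) (fun k n => q k n y)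
      (fun k n => p k n y) j := by
    filter_upwards [hc0', ha0', hss, hqq, hpp] with y g1 g2 g3 g4 g5 j
    exact hamSum_gauge g1 g2 g3 g4 g5 j
  have h2 : ∑ j, wedge x v w (fun y => hamSum L e (fun k => s' k y) (fun k n => q' k n y)
        (fun k n => p' k n y) j / s' j y) (s' j)
      = ∑ j, wedge x v w (fun y => hamSum L e (fun k => s k y) (fun k n => q k n y)
        (fun k n => p k n y) j / s j y) (s j) := by
    have e1 : ∀ j, wedge x v w (fun y => hamSum L e (fun k => s' k y) (fun k n => q' k n y)
        (fun k n => p' k n y) j / s' j y) (s' j)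
        = wedge x v w (fun y => hamSum L e (fun k => s k y) (fun k n => q k n y)
          (fun k n => p k n y) j / s j y) (s j)
        + wedge x v w (fun y => hamSum L e (fun k => s k y) (fun k n => q k n y)
          (fun k n => p k n y) j) c / c x := by
      intro j
      have hd : DifferentiableAt ℂ (fun y => hamSum L e (fun k => s k y) (fun k n => q k n y)
          (fun k n => p k n y) j / s j y) x := differentiableAt_div (hH j) (hs j) (hs0 j)
      have hd' : DifferentiableAt ℂ (fun y => hamSum L e (fun k => s' k y) (fun k n => q' k n y)
          (fun k n => p' k n y) j / s' j y) x := by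
        have : DifferentiableAt ℂ (fun y => hamSum L e (fun k => s k y) (fun k n => q k n y)
          (fun k n => p k n y) j / (c y * s j y)) x :=
          differentiableAt_div (hH j) (hc.fun_mul (hs j)) (mul_ne_zero hc0 (hs0 j))
        refine this.congr_of_eventuallyEq ?_
        filter_upwards [hgauge, hss] with y g1 g2
        rw [g1, g2]
      -- The pair `(H_j, s_j)` is itself scaled by `c`, with `s_j H_j` in the role of the product `q
      -- p`.
      rw [wedge_gauge (q := s j) (q' := s' j) (a := c) (b := fun _ => 1) hd' (hs j) hc hone hc0
        one_ne_zero (p := fun y => hamSum L e (fun k => s k y) (fun k n => q k n y)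
          (fun k n => p k n y) j / s j y) ?_ ?_, wedge_const_right (c := 1) _ (EventuallyEq.refl _ _),
        zero_div, add_zero]
      · congr 2
        refine wedge_congr ?_ (EventuallyEq.refl _ _)
        filter_upwards [hs0'] with y g
        rw [mul_div_cancel₀ _ (g j)]
      · filter_upwards [hgauge, hss, hs0', hc0'] with y g1 g2 g3 g4
        rw [g1, g2, mul_one]
        have := g3 j
        field_simp
      · filter_upwards [hss] with y g
        rw [g, mul_one]
    rw [sum_congr rfl fun j _ => e1 j, sum_add_distrib, ← sum_div,
      ← wedge_sum_left _ _ fun j _ => hH j]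
    -- Summed over `j`, the corrections involve only the differential of `∑ s_j H_j`, a constant by
    -- `two_mul_sum_hamSum`.
    rw [wedge_const_left (c := (2 * ∑ n ∈ range L, e n * k n + ∑ j, θ j ^ 2
      - ∑ n ∈ range L, k n ^ 2) / 2), zero_div, add_zero]
    filter_upwards [hinj, hcol, hrow] with y g1 g2 g3
    rw [← two_mul_sum_hamSum g1 g2 g3]
    ring
  rw [form, form, h1, h2]

/-- The 2-form and the difference transformation. -/
theorem form_diffPair {i : ι} {S : ι → E → ℂ} {Q P Qh Ph R : ι → ℕ → E → ℂ}
    {E' k k' : ℕ → ℂ} {c : ℂ} {θ : ι → ℂ}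
    (h : ∀ᶠ y in 𝓝 x, DiffPair L i (fun j => S j y) (fun j n => Q j n y) (fun j n => P j n y)
      (fun j n => Qh j n y) (fun j n => Ph j n y) (fun j n => R j n y))
    (hS : ∀ j, DifferentiableAt ℂ (S j) x)
    (hQ : ∀ j, ∀ n < L, DifferentiableAt ℂ (Q j n) x)
    (hP : ∀ j, ∀ n < L, DifferentiableAt ℂ (P j n) x)
    (hQh : ∀ j, ∀ n ≤ L, DifferentiableAt ℂ (Qh j n) x)
    (hR : ∀ j, ∀ n ≤ L, DifferentiableAt ℂ (R j n) x)
    (hS0 : ∀ j, S j x ≠ 0) (hinj : ∀ᶠ y in 𝓝 x, Function.Injective fun j => S j y)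
    (hQi : ∀ᶠ y in 𝓝 x, ∀ n < L, Q i n y = k n - ∑ l ∈ univ.erase i, Q l n y * P l n y)
    (hPi : ∀ᶠ y in 𝓝 x, ∀ n < L, Ph i n y = k' n - ∑ l ∈ univ.erase i, Qh l n y * Ph l n y)
    (hrow : ∀ᶠ y in 𝓝 x, ∀ j, ∑ n ∈ range L, Q j n y * P j n y = θ j)
    (he : ∀ n < L, e n = E' (n + 1)) (he' : ∀ n < L, e' n = E' n + c) (hE : E' L = E' 0 + 1)
    (hk : ∀ n < L, k' n = k n - E' (n + 1) + E' n) :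
    form L e' S Qh Ph x v w = form L e S Q P x v w := by
  rw [form, form, ← sum_sub_distrib, ← sum_sub_distrib]
  refine sum_congr rfl fun j _ => ?_
  by_cases hj : j = i
  · subst hj
    -- The index `i` contributes nothing on either side, since `S i`, `Qh i` and `P i` are constant.
    have hSc : S j =ᶠ[𝓝 x] fun _ => 1 := h.mono fun y hy => hy.s_i
    rw [wedge_const_right _ hSc, wedge_const_right _ hSc, sub_zero, sub_zero]
    rw [sum_eq_zero fun n hn => wedge_const_right _
      (show Qh j n =ᶠ[𝓝 x] fun _ => 1 from h.mono fun y hy => hy.Qh_i n (mem_range.1 hn))]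
    rw [sum_eq_zero fun n hn => wedge_const_left _
      (show P j n =ᶠ[𝓝 x] fun _ => 1 from h.mono fun y hy => hy.P_i n (mem_range.1 hn))]
  · have hRL := hR j L le_rfl
    have hR0 := hR j 0 (Nat.zero_le L)
    have hQ0 := hQh j 0 (Nat.zero_le L)
    have hRQ : DifferentiableAt ℂ (fun y => R j L y * Qh j 0 y) x := hRL.fun_mul hQ0
    -- The difference telescopes to `dR_0 ∧ dQh_0 - dR_L ∧ dQh_L`, which the quasi-periods turn into
    -- `-d(R_L Qh_0) ∧ dS_j`.
    have e1 : ∑ n ∈ range L, wedge x v w (Ph j n) (Qh j n)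
        = ∑ n ∈ range L, wedge x v w (P j n) (Q j n)
          - wedge x v w (fun y => R j L y * Qh j 0 y) (S j) := by
      have e2 : ∀ n ∈ range L, wedge x v w (Ph j n) (Qh j n) = wedge x v w (P j n) (Q j n)
          - (wedge x v w (R j (n + 1)) (Qh j (n + 1)) - wedge x v w (R j n) (Qh j n)) := by
        intro n hn
        have hn' := mem_range.1 hn
        have a1 : Ph j n =ᶠ[𝓝 x] fun y => R j n y - R j (n + 1) y :=
          h.mono fun y hy => hy.Ph_eq j hj n hn'
        have a2 : P j n =ᶠ[𝓝 x] R j (n + 1) := h.mono fun y hy => hy.P_eq j hj n hn'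
        have a3 : Q j n =ᶠ[𝓝 x] fun y => Qh j (n + 1) y - Qh j n y := h.mono fun y hy => by
          have := hy.Qh_succ j hj n hn'
          simp only [this, add_sub_cancel_left]
        rw [wedge_congr a1 (EventuallyEq.refl _ _), wedge_congr a2 a3,
          wedge_sub_left _ (hR j n hn'.le) (hR j (n + 1) hn'),
          wedge_sub_right _ (hQh j (n + 1) hn') (hQh j n hn'.le)]
        ring
      rw [sum_congr rfl e2, sum_sub_distrib,
        sum_range_sub (fun n => wedge x v w (R j n) (Qh j n)) L]
      congr 1
      have a1 : R j 0 =ᶠ[𝓝 x] fun y => S j y * R j L y := h.mono fun y hy => hy.R_zero j hj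
      have a2 : Qh j L =ᶠ[𝓝 x] fun y => S j y * Qh j 0 y := h.mono fun y hy => hy.Qh_period j hj
      rw [wedge_congr (EventuallyEq.refl _ (R j L)) a2, wedge_congr a1 (EventuallyEq.refl _ _)]
      simp only [wedge, fderiv_fun_mul (hS j) hQ0, fderiv_fun_mul (hS j) hRL,
        fderiv_fun_mul hRL hQ0, _root_.add_apply, _root_.smul_apply,
        smul_eq_mul]
      ring
    have hH : DifferentiableAt ℂ (fun y => hamSum L e (fun k => S k y) (fun k n => Q k n y)
        (fun k n => P k n y) j / S j y) x :=
      differentiableAt_div (differentiableAt_hamSum hS hQ hP hinj.self_of_nhds j) (hS j) (hS0 j)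
    -- Divided by `S_j`, the correction of the Hamiltonian is the same `R_L Qh_0`, so it cancels the
    -- boundary term; `c θ_j / S_j` depends on `S_j` alone.
    have e3 : (fun y => hamSum L e' (fun k => S k y) (fun k n => Qh k n y)
        (fun k n => Ph k n y) j / S j y) =ᶠ[𝓝 x] fun y =>
        hamSum L e (fun k => S k y) (fun k n => Q k n y) (fun k n => P k n y) j / S j y
          - R j L y * Qh j 0 y + c * θ j / S j y := by
      filter_upwards [h, hinj, hQi, hPi, hrow, (hS j).continuousAt.eventually_ne (hS0 j)]
        with y g1 g2 g3 g4 g5 g6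
      rw [g1.hamSum_eq g2 g3 g4 he he' hE hk hj, g5, g1.R_zero j hj]
      field_simp
    rw [e1, wedge_congr e3 (EventuallyEq.refl _ _),
      wedge_add_left _ (hH.fun_sub hRQ) (differentiableAt_div (differentiableAt_const _) (hS j) (hS0 j)),
      wedge_sub_left _ hH hRQ, wedge_div_self (differentiableAt_const _) (hS j) (hS0 j),
      wedge_const_left (c := c * θ j) _ (EventuallyEq.refl _ _)]
    ring

/-- The 2-form and the exchange of `q` and `p`. -/
theorem form_reflect {θ : ι → ℂ}
    (hs : ∀ j, DifferentiableAt ℂ (s j) x)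
    (hq : ∀ j, ∀ n ≤ L, DifferentiableAt ℂ (q j n) x)
    (hp : ∀ j, ∀ n ≤ L, DifferentiableAt ℂ (p j n) x)
    (hs0 : ∀ j, s j x ≠ 0) (hinj : ∀ᶠ y in 𝓝 x, Function.Injective fun j => s j y)
    (hqL : ∀ᶠ y in 𝓝 x, ∀ j, q j L y = s j y * q j 0 y)
    (hpL : ∀ᶠ y in 𝓝 x, ∀ j, s j y * p j L y = p j 0 y)
    (hrow : ∀ᶠ y in 𝓝 x, ∀ j, ∑ n ∈ range L, q j n y * p j n y = θ j)
    (heL : e L = e 0 + 1) (he' : ∀ n < L, e' n = - e (L - n) + 1) :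
    form L e' s (fun j n => p j (L - n)) (fun j n y => - q j (L - n) y) x v w
      = form L e s q p x v w := by
  rw [form, form, ← sum_sub_distrib, ← sum_sub_distrib]
  refine sum_congr rfl fun j _ => ?_
  have hq0 := hq j 0 (Nat.zero_le L)
  have hp0 := hp j 0 (Nat.zero_le L)
  have hqp : DifferentiableAt ℂ (fun y => q j 0 y * p j 0 y) x := hq0.fun_mul hp0
  -- The reflected sum runs over `1, …, L`. Replacing the term `L` by the term `0` is a scaling by
  -- `s_j`, whose cost `d(q_0 p_0) ∧ ds_j / s_j` the correction in `hamSum_reflect` cancels.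
  have e1 : ∑ n ∈ range L, wedge x v w (fun y => - q j (L - n) y) (p j (L - n))
      = ∑ n ∈ range L, wedge x v w (p j n) (q j n)
        + wedge x v w (fun y => q j 0 y * p j 0 y) (s j) / s j x := by
    simp only [wedge_neg_swap]
    have h1 := sum_range_succ (fun n => wedge x v w (p j n) (q j n)) L
    rw [sum_range_succ'] at h1
    have h2 : ∑ n ∈ range L, wedge x v w (p j (L - n)) (q j (L - n))
        = ∑ n ∈ range L, wedge x v w (p j (n + 1)) (q j (n + 1)) := by
      rw [← sum_range_reflect fun n => wedge x v w (p j (n + 1)) (q j (n + 1))]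
      refine sum_congr rfl fun n hn => ?_
      have := mem_range.1 hn
      rw [show L - 1 - n + 1 = L - n by omega]
    have h3 := wedge_gauge (v := v) (w := w) (q := q j 0) (q' := q j L) (p := p j 0) (p' := p j L)
      (a := s j)
      (b := fun _ => 1) (hp j L le_rfl) hq0 (hs j) (differentiableAt_const _) (hs0 j) one_ne_zero
      (hpL.mono fun y hy => by rw [mul_one, hy]) (hqL.mono fun y hy => by rw [mul_one, hy])
    rw [wedge_const_right (c := 1) _ (EventuallyEq.refl _ _), zero_div, add_zero] at h3
    rw [h2]
    rw [h3] at h1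
    linear_combination h1
  have hH : DifferentiableAt ℂ (fun y => hamSum L e (fun k => s k y) (fun k n => q k n y)
      (fun k n => p k n y) j / s j y) x :=
    differentiableAt_div (differentiableAt_hamSum hs (fun j n hn => hq j n hn.le)
      (fun j n hn => hp j n hn.le) hinj.self_of_nhds j) (hs j) (hs0 j)
  have hs0' : ∀ᶠ y in 𝓝 x, ∀ j, s j y ≠ 0 :=
    eventually_all.2 fun j => (hs j).continuousAt.eventually_ne (hs0 j)
  have e3 : (fun y => hamSum L e' (fun k => s k y) (fun k n => p k (L - n) y)
      (fun k n => - q k (L - n) y) j / s j y) =ᶠ[𝓝 x] fun y =>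
      hamSum L e (fun k => s k y) (fun k n => q k n y) (fun k n => p k n y) j / s j y
        + (q j 0 y * p j 0 y) / s j y - θ j / s j y := by
    filter_upwards [hinj, hs0', hqL, hpL, hrow] with y g1 g2 g3 g4 g5
    rw [hamSum_reflect (s := fun j => s j y) (q := fun j n => q j n y) (p := fun j n => p j n y)
      g1 g2 g3 g4 heL (fun _ _ _ => rfl) (fun _ _ _ => rfl) he' j, g5]
    ring
  rw [e1, wedge_congr e3 (EventuallyEq.refl _ _),
    wedge_sub_left _ (hH.fun_add (differentiableAt_div hqp (hs j) (hs0 j)))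
      (differentiableAt_div (differentiableAt_const _) (hs j) (hs0 j)),
    wedge_add_left _ hH (differentiableAt_div hqp (hs j) (hs0 j)), wedge_div_self hqp (hs j) (hs0 j),
    wedge_div_self (differentiableAt_const _) (hs j) (hs0 j),
    wedge_const_left (c := θ j) _ (EventuallyEq.refl _ _)]
  ring

end Form

end HLN

namespace HLN

set_option linter.unusedSectionVars false

open Finset Filter Topology

/-! ### Differentiability, and `Γ` in the extended variables. -/

section Differentiability

variable {L N : ℕ} [NeZero L] {κ : Params L N} {x : Phase L N ℂ}

theorem differentiableAt_sB (j : Fin (N + 1)) :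
    DifferentiableAt ℂ (fun y : Phase L N ℂ => sB y j) x := by
  refine Fin.cases ?_ (fun a => ?_) j
  · exact differentiableAt_const _
  · simp only [sB_succ]; fun_prop

theorem differentiableAt_qB (j : Fin (N + 1)) (n : Fin L) :
    DifferentiableAt ℂ (fun y : Phase L N ℂ => qB y j n) x := by
  by_cases h : n = 0
  · subst h; simp only [qB_zero_right]; exact differentiableAt_const _
  refine Fin.cases ?_ (fun a => ?_) j
  · simp only [qB_zero_left]; exact differentiableAt_const _
  · have : (fun y : Phase L N ℂ => qB y a.succ n) = fun y => y.2.1 a ⟨n, h⟩ :=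
      funext fun y => qB_succ y a ⟨n, h⟩
    rw [this]; fun_prop

theorem differentiableAt_pPos (κ : Params L N) (j : Fin (N + 1)) (n : Idx L) :
    DifferentiableAt ℂ (fun y : Phase L N ℂ => pPos κ y j n) x := by
  refine Fin.cases ?_ (fun a => ?_) j
  · simp only [pPos, Fin.cases_zero]; fun_prop
  · simp only [pPos, Fin.cases_succ]; fun_prop

theorem differentiableAt_pB (κ : Params L N) (j : Fin (N + 1)) (n : Fin L) :
    DifferentiableAt ℂ (fun y : Phase L N ℂ => pB κ y j n) x := by
  by_cases h : n = 0
  · subst h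
    simp only [pB]
    exact (differentiableAt_const _).fun_sub (DifferentiableAt.fun_sum fun m _ =>
      (differentiableAt_qB j m).fun_mul (differentiableAt_pPos κ j m))
  · simp only [pB, dif_neg h]
    exact differentiableAt_pPos κ j ⟨n, h⟩

theorem differentiableAt_sB_zpow (hx : Regular x) (j : Fin (N + 1)) (k : ℤ) :
    DifferentiableAt ℂ (fun y : Phase L N ℂ => sB y j ^ k) x :=
  (differentiableAt_zpow.2 (Or.inl (hx.1 j))).fun_comp' x (differentiableAt_sB j)

theorem differentiableAt_qE (hx : Regular x) (j : Fin (N + 1)) (n : ℤ) :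
    DifferentiableAt ℂ (fun y : Phase L N ℂ => qE y j n) x :=
  (differentiableAt_sB_zpow hx j _).fun_mul (differentiableAt_qB j _)

theorem differentiableAt_pE (κ : Params L N) (hx : Regular x) (j : Fin (N + 1)) (n : ℤ) :
    DifferentiableAt ℂ (fun y : Phase L N ℂ => pE κ y j n) x :=
  differentiableAt_div (differentiableAt_pB κ j _) (differentiableAt_sB_zpow hx j _)
    (zpow_ne_zero _ (hx.1 j))

theorem eventually_regular (hx : Regular x) : ∀ᶠ y in 𝓝 x, Regular y := by
  have h1 : ∀ᶠ y in 𝓝 x, ∀ i, sB y i ≠ 0 :=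
    eventually_all.2 fun i => (differentiableAt_sB i).continuousAt.eventually_ne (hx.1 i)
  have h2 : ∀ᶠ y in 𝓝 x, ∀ i j, i ≠ j → sB y i - sB y j ≠ 0 :=
    eventually_all.2 fun i => eventually_all.2 fun j => eventually_imp_distrib_left.2 fun hij =>
      ((differentiableAt_sB i).fun_sub (differentiableAt_sB j)).continuousAt.eventually_ne
        (sub_ne_zero.2 fun h => hij (hx.2 h))
  filter_upwards [h1, h2] with y g1 g2
  exact ⟨g1, fun i j h => by_contra fun hij => g2 i j hij (sub_eq_zero.2 h)⟩

/-- The 2-form at a regular point. -/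
theorem fundamentalForm_eq_form (v w : Phase L N ℂ) :
    fundamentalForm κ x v w = form L (fun n => eExt κ n) (fun j y => sB y j)
      (fun j n y => qE y j n) (fun j n y => pE κ y j n) x v w := by
  have hs1 : ∀ (a : Fin N) (v : Phase L N ℂ),
      fderiv ℂ (fun y : Phase L N ℂ => sB y a.succ) x v = v.1 a := by
    intro a v
    let ℓ : Phase L N ℂ →L[ℂ] ℂ :=
      (ContinuousLinearMap.proj a).comp (ContinuousLinearMap.fst ℂ _ _)
    have : (fun y : Phase L N ℂ => sB y a.succ) = ℓ := rfl
    rw [this, ContinuousLinearMap.fderiv]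
    rfl
  have hq1 : ∀ (a : Fin N) (n : Idx L) (v : Phase L N ℂ),
      fderiv ℂ (fun y : Phase L N ℂ => qE y a.succ ((n : Fin L) : ℕ)) x v = v.2.1 a n := by
    intro a n v
    let ℓ : Phase L N ℂ →L[ℂ] ℂ :=
      (ContinuousLinearMap.proj (R := ℂ) (φ := fun _ : Idx L => ℂ) n).comp
      ((ContinuousLinearMap.proj (R := ℂ) (φ := fun _ : Fin N => Idx L → ℂ) a).comp
        ((ContinuousLinearMap.fst ℂ _ _).comp (ContinuousLinearMap.snd ℂ _ _)))
    have : (fun y : Phase L N ℂ => qE y a.succ ((n : Fin L) : ℕ)) = ℓ :=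
      funext fun y => by rw [qE_natCast, qB_succ]; rfl
    rw [this, ContinuousLinearMap.fderiv]
    rfl
  have hp1 : ∀ (a : Fin N) (n : Idx L) (v : Phase L N ℂ),
      fderiv ℂ (fun y : Phase L N ℂ => pE κ y a.succ ((n : Fin L) : ℕ)) x v = v.2.2 a n := by
    intro a n v
    let ℓ : Phase L N ℂ →L[ℂ] ℂ :=
      (ContinuousLinearMap.proj (R := ℂ) (φ := fun _ : Idx L => ℂ) n).comp
      ((ContinuousLinearMap.proj (R := ℂ) (φ := fun _ : Fin N => Idx L → ℂ) a).comp
        ((ContinuousLinearMap.snd ℂ _ _).comp (ContinuousLinearMap.snd ℂ _ _)))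
    have : (fun y : Phase L N ℂ => pE κ y a.succ ((n : Fin L) : ℕ)) = ℓ :=
      funext fun y => by rw [pE_natCast, pB_succ]; rfl
    rw [this, ContinuousLinearMap.fderiv]
    rfl
  rw [fundamentalForm, form]
  congr 1
  · rw [Fin.sum_univ_succ]
    -- The terms absent from `Γ` vanish because `q^{(0)}`, `q_0` and `s_0` are constant.
    have h0 : ∑ n ∈ range L, wedge x v w (fun y => pE κ y 0 n) (fun y => qE y 0 n) = 0 :=
      sum_eq_zero fun n _ => wedge_const_right (c := 1) _ (Eventually.of_forall fun y => by
        simp only [qE, sB_zero, one_zpow, qB_zero_left, one_mul])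
    rw [h0, zero_add]
    refine sum_congr rfl fun a _ => ?_
    rw [← Fin.sum_univ_eq_sum_range (fun n : ℕ => wedge x v w (fun y => pE κ y a.succ n)
      (fun y => qE y a.succ n)), sum_fin_eq_add_sum_idx]
    have h1 : wedge x v w (fun y => pE κ y a.succ ((0 : Fin L) : ℕ))
        (fun y => qE y a.succ ((0 : Fin L) : ℕ)) = 0 :=
      wedge_const_right (c := 1) _ (Eventually.of_forall fun y => by
        simp only [qE_natCast, qB_zero_right])
    rw [h1, zero_add]
    refine sum_congr rfl fun n _ => ?_
    rw [wedge, hq1, hq1, hp1, hp1]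
  · rw [Fin.sum_univ_succ]
    rw [wedge_const_right (c := 1) (g := fun y : Phase L N ℂ => sB y 0) _
      (EventuallyEq.refl _ _), zero_add]
    refine sum_congr rfl fun a _ => ?_
    have : hamiltonian κ a = fun y : Phase L N ℂ => hamSum L (fun n => eExt κ n)
        (fun k => sB y k) (fun k n => qE y k n) (fun k n => pE κ y k n) a.succ / sB y a.succ :=
      funext fun y => hamiltonian_eq κ a y
    rw [wedge, hs1, hs1, this]

/-- Pull-back commutes with `d`, so canonicity becomes an identity between two instances of `form`
at the same point `x`. -/
theorem fundamentalForm_pullback {κ' : Params L N} {T : Phase L N ℂ → Phase L N ℂ}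
    (hT : DifferentiableAt ℂ T x) (hTx : Regular (T x)) (v w : Phase L N ℂ) :
    fundamentalForm κ' (T x) (fderiv ℂ T x v) (fderiv ℂ T x w)
      = form L (fun n => eExt κ' n) (fun j y => sB (T y) j)
      (fun j n y => qE (T y) j n) (fun j n y => pE κ' (T y) j n) x v w := by
  rw [fundamentalForm_eq_form, form, form]
  congr 1
  · refine sum_congr rfl fun j _ => sum_congr rfl fun n _ => ?_
    exact (wedge_comp hT (differentiableAt_pE κ' hTx j n) (differentiableAt_qE hTx j n)).symm
  · refine sum_congr rfl fun j _ => ?_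
    exact (wedge_comp hT (f := fun y => hamSum L (fun n => eExt κ' n)
        (fun k => sB y k) (fun k n => qE y k n) (fun k n => pE κ' y k n) j / sB y j)
      (differentiableAt_div (differentiableAt_hamSum (fun j => differentiableAt_sB j)
        (fun j n _ => differentiableAt_qE hTx j n) (fun j n _ => differentiableAt_pE κ' hTx j n)
        hTx.2 j) (differentiableAt_sB j) (hTx.1 j)) (differentiableAt_sB j)).symm

theorem differentiableAt_phase {T : Phase L N ℂ → Phase L N ℂ}
    (hs : ∀ a, DifferentiableAt ℂ (fun y => (T y).1 a) x)
    (hq : ∀ a n, DifferentiableAt ℂ (fun y => (T y).2.1 a n) x)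
    (hp : ∀ a n, DifferentiableAt ℂ (fun y => (T y).2.2 a n) x) : DifferentiableAt ℂ T x :=
  (differentiableAt_pi.2 hs).prodMk ((differentiableAt_pi.2 fun a => differentiableAt_pi.2 (hq a)).prodMk
    (differentiableAt_pi.2 fun a => differentiableAt_pi.2 (hp a)))

end Differentiability

/-! ### The permutations are canonical. -/

section Perm

variable {L N : ℕ} [NeZero L] {κ : Params L N} {π : Equiv.Perm (Fin (N + 1))} {x : Phase L N ℂ}

theorem perm_regular {F : Type} [Field F] [Algebra ℂ F] {x : Phase L N F} (hx : Regular x) :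
    Regular ((permTransf κ π).toFun F x) := by
  have h0 := hx.1 (π 0)
  have h : sB ((permTransf κ π).toFun F x) = fun j => sB x (π j) / sB x (π 0) :=
    funext (perm_sB h0)
  rw [Regular, h]
  exact ⟨fun i => div_ne_zero (hx.1 _) h0, fun i j hij => π.injective (hx.2 ((div_left_inj' h0).1 hij))⟩

theorem perm_differentiableAt (hx : (permTransf κ π).Dom ℂ x) :
    DifferentiableAt ℂ ((permTransf κ π).toFun ℂ) x :=
  differentiableAt_phase
    (fun _ => differentiableAt_div (differentiableAt_sB _) (differentiableAt_sB _) (hx.1.1 _))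
    (fun _ _ => differentiableAt_div (differentiableAt_qB _ _) (differentiableAt_qB _ _) (hx.2 _))
    (fun _ _ => (differentiableAt_pB κ _ _).fun_mul (differentiableAt_qB _ _))

theorem perm_eventually_dom (hx : (permTransf κ π).Dom ℂ x) :
    ∀ᶠ y in 𝓝 x, (permTransf κ π).Dom ℂ y := by
  filter_upwards [eventually_regular hx.1, eventually_all.2 fun n =>
    (differentiableAt_qB (π 0) n).continuousAt.eventually_ne (hx.2 n)] with y g1 g2
  exact ⟨g1, g2⟩

/-- Relabelling is followed by the scaling with `c = 1 / s_{π 0}` and `b_n = 1 / q_n^{(π 0)}`. -/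
theorem perm_canonical (hκ : κ.Admissible) (hx : (permTransf κ π).Dom ℂ x) (v w : Phase L N ℂ) :
    fundamentalForm (permParams π κ) ((permTransf κ π).toFun ℂ x)
      (fderiv ℂ ((permTransf κ π).toFun ℂ) x v) (fderiv ℂ ((permTransf κ π).toFun ℂ) x w)
      = fundamentalForm κ x v w := by
  have hTx : Regular ((permTransf κ π).toFun ℂ x) := perm_regular hx.1
  have hT := perm_differentiableAt hx
  have hreg := eventually_regular hx.1
  have hdom := perm_eventually_dom hx
  rw [fundamentalForm_pullback hT hTx, fundamentalForm_eq_form,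
    ← form_perm (s := fun j y => sB y j) π]
  have hq0 : ∀ n < L, qE x (π 0) (n : ℤ) ≠ 0 := fun n hn => by
    have := hx.2 ⟨n, hn⟩
    rwa [← qE_natCast] at this
  refine form_gauge (e := fun n => eExt κ n) (k := fun n => kExt κ n) (θ := fun j => κ.θ (π j))
    (c := fun y => 1 / sB y (π 0)) (a := fun _ _ => 1) (b := fun n y => 1 / qE y (π 0) n)
    (fun j => differentiableAt_sB _) (fun j n _ => differentiableAt_qE hx.1 _ _)
    (fun j n _ => differentiableAt_pE κ hx.1 _ _) (fun j n _ => ?_)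
    (differentiableAt_div (differentiableAt_const _) (differentiableAt_sB _) (hx.1.1 _))
    (fun j => differentiableAt_const _)
    (fun n hn => differentiableAt_div (differentiableAt_const _) (differentiableAt_qE hx.1 _ _)
      (hq0 n hn)) (one_div_ne_zero (hx.1.1 _)) (fun _ => one_ne_zero)
    (fun n hn => one_div_ne_zero (hq0 n hn)) (fun j => hx.1.1 _) ?_ ?_ ?_ ?_ ?_ ?_
  · exact (differentiableAt_pE _ hTx j n).fun_comp' x hT
  · filter_upwards [hreg] with y hy
    exact hy.2.comp π.injective
  · refine Eventually.of_forall fun y n hn => ?_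
    rw [Equiv.sum_comp π fun j => qE y j n * pE κ y j n]
    exact sum_col_range hκ y n hn
  · exact Eventually.of_forall fun y j => sum_row_range κ y (π j)
  · filter_upwards [hreg] with y hy j
    rw [perm_sB (hy.1 _)]; ring
  · filter_upwards [hdom] with y hy j n hn
    rw [qE_natCast _ j ⟨n, hn⟩, (perm_extended hκ hy.2).1, qE_natCast y _ ⟨n, hn⟩,
      qE_natCast y _ ⟨n, hn⟩]
    ring
  · filter_upwards [hdom] with y hy j n hn
    have := hy.2 ⟨n, hn⟩
    rw [pE_natCast _ _ j ⟨n, hn⟩, (perm_extended hκ hy.2).2, qE_natCast y _ ⟨n, hn⟩,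
      pE_natCast κ y _ ⟨n, hn⟩]
    field_simp

end Perm

/-! ### `ι` is canonical. -/

section Iota

variable {L N : ℕ} [NeZero L] {κ : Params L N} {x : Phase L N ℂ}

theorem iota_eventually_dom (hx : (iota κ).Dom ℂ x) : ∀ᶠ y in 𝓝 x, (iota κ).Dom ℂ y := by
  filter_upwards [eventually_regular hx.1, eventually_all.2 fun n =>
    (differentiableAt_pB κ 0 n).continuousAt.eventually_ne (hx.2.1 n), eventually_all.2 fun i =>
    (differentiableAt_pB κ i 0).continuousAt.eventually_ne (hx.2.2 i)] with y g1 g2 g3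
  exact ⟨g1, g2, g3⟩

theorem differentiableAt_iotaQ (hx : (iota κ).Dom ℂ x) (j : Fin (N + 1)) {n : ℕ} (hn : n < L) :
    DifferentiableAt ℂ (fun y => iotaQ κ y j n) x := by
  have h2 := hx.2.2 j
  rw [← pE_zero] at h2
  exact differentiableAt_div (((differentiableAt_sB j).fun_mul (differentiableAt_pE κ hx.1 _ _)).fun_mul
      (differentiableAt_pE κ hx.1 _ _))
    ((differentiableAt_pE κ hx.1 _ _).fun_mul (differentiableAt_pE κ hx.1 _ _))
    (mul_ne_zero (pE_zero_reflect_ne_zero hx hn) h2)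

theorem differentiableAt_iotaP (hx : (iota κ).Dom ℂ x) (j : Fin (N + 1)) (n : ℕ) :
    DifferentiableAt ℂ (fun y => iotaP κ y j n) x := by
  have h2 := hx.2.2 0
  rw [← pE_zero] at h2
  exact (differentiableAt_div (((differentiableAt_qE hx.1 _ _).fun_mul
    (differentiableAt_pE κ hx.1 _ _)).fun_mul (differentiableAt_pE κ hx.1 _ _))
    ((differentiableAt_sB j).fun_mul (differentiableAt_pE κ hx.1 _ _))
    (mul_ne_zero (hx.1.1 j) h2)).fun_neg

theorem iota_differentiableAt (hx : (iota κ).Dom ℂ x) :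
    DifferentiableAt ℂ ((iota κ).toFun ℂ) x :=
  differentiableAt_phase (fun a => differentiableAt_sB a.succ)
    (fun a n => differentiableAt_iotaQ hx a.succ n.1.2)
    (fun a n => differentiableAt_iotaP hx a.succ n.1)

/-- Reflection is followed by the scaling with `a_j = s_j p_0^{(0)} / p_0^{(j)}` and `b_n = 1 /
p_{L-n}^{(0)}`, which restores `q^{(0)} = q_0 = 1`. -/
theorem iota_canonical (hκ : κ.Admissible) (hx : (iota κ).Dom ℂ x) (v w : Phase L N ℂ) :
    fundamentalForm (iotaParams κ) ((iota κ).toFun ℂ x)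
      (fderiv ℂ ((iota κ).toFun ℂ) x v) (fderiv ℂ ((iota κ).toFun ℂ) x w)
      = fundamentalForm κ x v w := by
  have hTx : Regular ((iota κ).toFun ℂ x) := hx.1
  have hT := iota_differentiableAt hx
  have hreg := eventually_regular hx.1
  have hdom := iota_eventually_dom hx
  have hp : ∀ j, pE κ x j 0 ≠ 0 := fun j => by rw [pE_zero]; exact hx.2.2 j
  rw [fundamentalForm_pullback hT hTx, fundamentalForm_eq_form]
  rw [← form_reflect (e := fun n => eExt κ n) (e' := fun n => eExt (iotaParams κ) n)
    (q := fun j n y => qE y j n) (p := fun j n y => pE κ y j n)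
    (θ := fun j => κ.θ j) (fun j => differentiableAt_sB j)
    (fun j n _ => differentiableAt_qE hx.1 _ _) (fun j n _ => differentiableAt_pE κ hx.1 _ _)
    hx.1.1 (hreg.mono fun y hy => hy.2) (hreg.mono fun y hy j => qE_period hy j)
    (hreg.mono fun y hy j => by
      rw [pE_period κ hy, mul_div_cancel₀ _ (hy.1 j), Nat.cast_zero])
    (Eventually.of_forall fun y j => sum_row_range κ y j)
    (by have := eExt_add κ 0; rwa [zero_add] at this)
    (fun n hn => by rw [eExt_iotaParams κ hn, Nat.cast_sub hn.le])]
  have hcast : ∀ n < L, ((L - n : ℕ) : ℤ) = (L : ℤ) - n := fun n hn => Nat.cast_sub (le_of_lt hn)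
  refine form_gauge (e := fun n => eExt (iotaParams κ) n) (k := fun n => - kExt κ ((L - n : ℕ) : ℤ))
    (θ := fun j => - κ.θ j)
    (c := fun _ => 1) (a := fun j y => sB y j * pE κ y 0 0 / pE κ y j 0)
    (b := fun n y => 1 / pE κ y 0 ((L - n : ℕ) : ℤ))
    (fun j => differentiableAt_sB _) (fun j n _ => differentiableAt_pE κ hx.1 _ _)
    (fun j n _ => (differentiableAt_qE hx.1 _ _).fun_neg) (fun j n _ => ?_)
    (differentiableAt_const _)
    (fun j => differentiableAt_div ((differentiableAt_sB j).fun_mul (differentiableAt_pE κ hx.1 _ _))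
      (differentiableAt_pE κ hx.1 _ _) (hp j))
    (fun n hn => differentiableAt_div (differentiableAt_const _) (differentiableAt_pE κ hx.1 _ _)
      ?_) one_ne_zero (fun j => div_ne_zero (mul_ne_zero (hx.1.1 j) (hp 0)) (hp j))
    (fun n hn => one_div_ne_zero ?_) hx.1.1 (hreg.mono fun y hy => hy.2) ?_ ?_ ?_ ?_ ?_
  · exact (differentiableAt_pE _ hTx j n).fun_comp' x hT
  · rw [hcast n hn]; exact pE_zero_reflect_ne_zero hx hn
  · rw [hcast n hn]; exact pE_zero_reflect_ne_zero hx hn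
  · filter_upwards [hreg] with y hy n hn
    have h1 : ∀ j, pE κ y j ((L - n : ℕ) : ℤ) * - qE y j ((L - n : ℕ) : ℤ)
        = - (qE y j ((L - n : ℕ) : ℤ) * pE κ y j ((L - n : ℕ) : ℤ)) := fun j => by ring
    rw [sum_congr rfl fun j _ => h1 j, sum_neg_distrib, neg_inj]
    -- The reflection sends column 0 to column `L`, whose products `q p` equal those of column 0.
    rcases Nat.eq_zero_or_pos n with rfl | h
    · rw [Nat.sub_zero]
      have h2 := sum_col_range hκ y 0 hn
      have h3 := kExt_add κ 0
      rw [zero_add] at h3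
      rw [h3, ← Nat.cast_zero]
      refine Eq.trans (sum_congr rfl fun j _ => ?_) h2
      have := hy.1 j
      rw [qE_period hy, pE_period κ hy, Nat.cast_zero]
      field_simp
    · exact sum_col_range hκ y (L - n) (by omega)
  · filter_upwards [hdom] with y hy j
    have h1 := iota_row hy j
    rw [← sum_congr rfl fun n hn => (iotaQ_mul_iotaP hy j (mem_range.1 hn)).symm] at h1
    refine Eq.trans (sum_congr rfl fun n hn => ?_) h1
    rw [hcast n (mem_range.1 hn)]
    ring
  · exact Eventually.of_forall fun y j => (one_mul _).symm
  · filter_upwards [hdom] with y hy j n hn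
    have h1 := pE_zero_reflect_ne_zero hy hn
    rw [qE_natCast _ j ⟨n, hn⟩, (iota_extended hκ hy).1, hcast n hn, iotaQ]
    field_simp
  · filter_upwards [hdom] with y hy j n hn
    have h1 := pE_zero_reflect_ne_zero hy hn
    have h2 := hy.1.1 j
    have h3 := hy.2.2 j
    have h4 := hy.2.2 0
    rw [← pE_zero] at h3 h4
    rw [pE_natCast _ _ j ⟨n, hn⟩, (iota_extended hκ hy).2, hcast n hn, iotaP]
    field_simp

end Iota

/-! ### `η_i` is canonical. -/

section Eta

variable {L N : ℕ} [NeZero L] {κ : Params L N} {i : Fin (N + 1)} {x : Phase L N ℂ}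

theorem differentiableAt_normS (hx : Regular x) (j : Fin (N + 1)) :
    DifferentiableAt ℂ (fun y : Phase L N ℂ => normS i y j) x :=
  differentiableAt_div (differentiableAt_sB _) (differentiableAt_sB _) (hx.1 _)

theorem differentiableAt_normQ (hx : Regular x) (j : Fin (N + 1)) (n : ℕ) :
    DifferentiableAt ℂ (fun y => normQ κ i y j n) x :=
  (differentiableAt_pE κ hx _ _).fun_mul (differentiableAt_qE hx _ _)

theorem differentiableAt_hatQ (hx : Regular x) (j : Fin (N + 1)) (n : ℕ) :
    DifferentiableAt ℂ (fun y => hatQ κ i y j n) x := by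
  by_cases hj : j = i
  · simp only [hatQ, if_pos hj]; exact differentiableAt_const _
  · simp only [hatQ, if_neg hj]
    exact (DifferentiableAt.fun_sum fun m _ => differentiableAt_normQ hx j m).fun_add
      ((differentiableAt_div (differentiableAt_const _)
        ((differentiableAt_normS hx j).fun_sub (differentiableAt_const _))
        (normS_sub_one hx hj)).fun_mul
        (DifferentiableAt.fun_sum fun m _ => differentiableAt_normQ hx j m))

theorem pE_ne_zero (hx : Regular x) (hp : ∀ n, pB κ x i n ≠ 0) (n : ℤ) : pE κ x i n ≠ 0 :=
  div_ne_zero (hp _) (zpow_ne_zero _ (hx.1 i))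

theorem differentiableAt_normP (hx : Regular x) (hp : ∀ n, pB κ x i n ≠ 0) (j : Fin (N + 1))
    (n : ℕ) : DifferentiableAt ℂ (fun y => normP κ i y j n) x :=
  differentiableAt_div (differentiableAt_pE κ hx _ _) (differentiableAt_pE κ hx _ _)
    (pE_ne_zero hx hp _)

theorem differentiableAt_shiftP (hx : Regular x) (hp : ∀ n, pB κ x i n ≠ 0) (j : Fin (N + 1))
    (n : ℕ) : DifferentiableAt ℂ (fun y => shiftP κ i y j n) x :=
  differentiableAt_div (differentiableAt_pE κ hx _ _) (differentiableAt_pE κ hx _ _)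
    (pE_ne_zero hx hp _)

theorem differentiableAt_hatP (hx : Regular x) (hp : ∀ n, pB κ x i n ≠ 0) (j : Fin (N + 1))
    (n : ℕ) : DifferentiableAt ℂ (fun y => hatP κ i y j n) x := by
  have h : ∀ l, DifferentiableAt ℂ (fun y => shiftP κ i y l n - shiftP κ i y l (n + 1)) x :=
    fun l => (differentiableAt_shiftP hx hp l n).fun_sub (differentiableAt_shiftP hx hp l (n + 1))
  by_cases hj : j = i
  · simp only [hatP, if_pos hj]
    exact (differentiableAt_const _).fun_sub (DifferentiableAt.fun_sum fun l _ =>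
      (differentiableAt_hatQ hx l n).fun_mul (h l))
  · simp only [hatP, if_neg hj]
    exact h j

theorem eta_eventually_dom (hx : (eta κ i).Dom ℂ x) : ∀ᶠ y in 𝓝 x, (eta κ i).Dom ℂ y := by
  have h : ∀ᶠ y in 𝓝 x, ∀ j, j ≠ i → ∀ n : Fin L, etaB κ i y (n : ℕ) j ≠ 0 := by
    refine eventually_all.2 fun j => eventually_imp_distrib_left.2 fun hj => eventually_all.2
      fun n => ContinuousAt.eventually_ne (DifferentiableAt.continuousAt (𝕜 := ℂ) ?_)
        (hx.2.2 j hj n)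
    exact DifferentiableAt.fun_sum fun m _ =>
      (differentiableAt_pE κ hx.1 _ _).fun_mul (differentiableAt_qE hx.1 _ _)
  filter_upwards [eventually_regular hx.1, eventually_all.2 fun n =>
    (differentiableAt_pB κ i n).continuousAt.eventually_ne (hx.2.1 n), h] with y g1 g2 g3
  exact ⟨g1, g2, g3⟩

theorem differentiableAt_etaQ (hx : (eta κ i).Dom ℂ x) (n : Fin L) (j : Fin (N + 1)) :
    DifferentiableAt ℂ (fun y => etaQ κ i y n j) x := by
  have h : (fun y => etaQ κ i y n j) =ᶠ[𝓝 x] fun y => hatQ κ i y 0 0 / hatQ κ i y j 0 *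
      (1 / hatQ κ i y 0 n) * hatQ κ i y j n :=
    (eventually_regular hx.1).mono fun y hy => etaQ_eq hy n j
  refine DifferentiableAt.congr_of_eventuallyEq ?_ h
  have hd := fun j n => differentiableAt_hatQ (κ := κ) (i := i) hx.1 j n
  exact ((differentiableAt_div (hd _ _) (hd _ _) (hatQ_ne_zero hx _ (Nat.pos_of_neZero L))).fun_mul
    (differentiableAt_div (differentiableAt_const _) (hd _ _) (hatQ_ne_zero hx _ n.2))).fun_mul
    (hd _ _)

theorem differentiableAt_etaP (hx : (eta κ i).Dom ℂ x) (n : Fin L) (j : Fin (N + 1)) :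
    DifferentiableAt ℂ (fun y => etaP κ i y n j) x := by
  have h : (fun y => etaP κ i y n j) =ᶠ[𝓝 x]
      fun y => hatQ κ i y j n * hatP κ i y j n / etaQ κ i y n j :=
    (eta_eventually_dom hx).mono fun y hy => by
      have := etaQ_ne_zero hy n j
      simp only
      rw [← etaQ_mul_etaP hy, mul_div_cancel_left₀ _ this]
  refine DifferentiableAt.congr_of_eventuallyEq ?_ h
  exact differentiableAt_div ((differentiableAt_hatQ hx.1 _ _).fun_mul
    (differentiableAt_hatP hx.1 hx.2.1 _ _)) (differentiableAt_etaQ hx n j) (etaQ_ne_zero hx n j)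

theorem eta_differentiableAt (hx : (eta κ i).Dom ℂ x) :
    DifferentiableAt ℂ ((eta κ i).toFun ℂ) x :=
  differentiableAt_phase (fun a => differentiableAt_sB a.succ)
    (fun a n => differentiableAt_etaQ hx n a.succ) (fun a n => differentiableAt_etaP hx n a.succ)

/-- `η_i` is a composition of three maps preserving `form`: scaling to `p^{(i)} = s_i = 1`, the
difference transformation, and scaling back to `s_0 = q^{(0)} = q_0 = 1`. -/
theorem eta_canonical (hκ : κ.Admissible) (hx : (eta κ i).Dom ℂ x) (v w : Phase L N ℂ) :
    fundamentalForm (etaParams i κ) ((eta κ i).toFun ℂ x)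
      (fderiv ℂ ((eta κ i).toFun ℂ) x v) (fderiv ℂ ((eta κ i).toFun ℂ) x w)
      = fundamentalForm κ x v w := by
  have hTx : Regular ((eta κ i).toFun ℂ x) := hx.1
  have hT := eta_differentiableAt hx
  have hreg := eventually_regular hx.1
  have hdom := eta_eventually_dom hx
  have hpE := pE_ne_zero hx.1 hx.2.1
  have hinj : ∀ᶠ y in 𝓝 x, Function.Injective fun j => normS i y j :=
    hreg.mono fun y hy => normS_injective hy
  have hS0 : ∀ j, normS i x j ≠ 0 := fun j => div_ne_zero (hx.1.1 _) (hx.1.1 _)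
  rw [fundamentalForm_pullback hT hTx, fundamentalForm_eq_form]
  have h1 : form L (fun n => eExt κ n) (fun j y => normS i y j) (fun j n y => normQ κ i y j n)
      (fun j n y => normP κ i y j n) x v w = form L (fun n => eExt κ n) (fun j y => sB y j)
      (fun j n y => qE y j n) (fun j n y => pE κ y j n) x v w := by
    refine form_gauge (k := fun n => kExt κ n) (θ := fun j => κ.θ j)
      (c := fun y => 1 / sB y i) (a := fun _ _ => 1) (b := fun n y => pE κ y i n)
      (fun j => differentiableAt_sB _) (fun j n _ => differentiableAt_qE hx.1 _ _)
      (fun j n _ => differentiableAt_pE κ hx.1 _ _)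
      (fun j n _ => differentiableAt_normP hx.1 hx.2.1 _ _)
      (differentiableAt_div (differentiableAt_const _) (differentiableAt_sB _) (hx.1.1 _))
      (fun j => differentiableAt_const _) (fun n _ => differentiableAt_pE κ hx.1 _ _)
      (one_div_ne_zero (hx.1.1 _)) (fun _ => one_ne_zero) (fun n _ => hpE _) hx.1.1
      (hreg.mono fun y hy => hy.2)
      (Eventually.of_forall fun y n hn => sum_col_range hκ y n hn)
      (Eventually.of_forall fun y j => sum_row_range κ y j) ?_ ?_ ?_
    · exact Eventually.of_forall fun y j => by rw [normS]; ring
    · exact Eventually.of_forall fun y j n _ => by rw [normQ, one_mul]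
    · filter_upwards [hdom] with y hy j n _
      rw [normP, one_mul, mul_div_cancel₀ _ (pE_ne_zero hy.1 hy.2.1 _)]
  have h2 : form L (fun n => eExt (etaParams i κ) n) (fun j y => normS i y j)
      (fun j n y => hatQ κ i y j n) (fun j n y => hatP κ i y j n) x v w
      = form L (fun n => eExt κ n) (fun j y => normS i y j) (fun j n y => normQ κ i y j n)
      (fun j n y => normP κ i y j n) x v w := by
    refine form_diffPair (i := i) (R := fun j n y => shiftP κ i y j n)
      (E' := fun n => eExt κ ((n : ℤ) - 1)) (k := fun n => kExt κ n)
      (k' := fun n => kExt (etaParams i κ) n) (c := 1 / (L : ℂ)) (θ := fun j => κ.θ j)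
      (hdom.mono fun y hy => diffPair hy.1 hy.2.1) (differentiableAt_normS hx.1)
      (fun j n _ => differentiableAt_normQ hx.1 _ _)
      (fun j n _ => differentiableAt_normP hx.1 hx.2.1 _ _)
      (fun j n _ => differentiableAt_hatQ hx.1 _ _)
      (fun j n _ => differentiableAt_shiftP hx.1 hx.2.1 _ _) hS0 hinj ?_ ?_
      (hdom.mono fun y hy j => norm_row hy.2.1 j) ?_ (fun n hn => eExt_etaParams i κ hn) ?_ ?_
    · filter_upwards [hdom] with y hy n hn
      have h := norm_col hκ hy.2.1 hn
      rw [← add_sum_erase univ _ (mem_univ i), (diffPair hy.1 hy.2.1).P_i n hn, mul_one] at h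
      exact eq_sub_of_add_eq h
    · refine Eventually.of_forall fun y n hn => ?_
      have h : ∑ j, hatQ κ i y j n * hatP κ i y j n = _ := hat_col n
      rw [← kExt_etaParams i κ hn, ← add_sum_erase univ _ (mem_univ i),
        show hatQ κ i y i n = 1 from if_pos rfl, one_mul] at h
      exact eq_sub_of_add_eq h
    · intro n _
      rw [Nat.cast_add, Nat.cast_one, add_sub_cancel_right]
    · have := eExt_add κ (-1)
      rw [show (-1 + (L : ℤ)) = (L : ℤ) - 1 by ring] at this
      rw [this, Nat.cast_zero, zero_sub]
    · intro n hn
      rw [kExt_etaParams i κ hn, Nat.cast_add, Nat.cast_one, add_sub_cancel_right]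
  rw [← h1, ← h2]
  have hQ0 := fun j (n : ℕ) (hn : n < L) => hatQ_ne_zero hx j hn
  have hL := Nat.pos_of_neZero L
  refine form_gauge (e := fun n => eExt (etaParams i κ) n) (k := fun n => kExt (etaParams i κ) n)
    (θ := fun j => (etaParams i κ).θ j)
    (c := fun y => sB y i) (a := fun j y => hatQ κ i y 0 0 / hatQ κ i y j 0)
    (b := fun n y => 1 / hatQ κ i y 0 n)
    (differentiableAt_normS hx.1) (fun j n _ => differentiableAt_hatQ hx.1 _ _)
    (fun j n _ => differentiableAt_hatP hx.1 hx.2.1 _ _) (fun j n _ => ?_)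
    (differentiableAt_sB i)
    (fun j => differentiableAt_div (differentiableAt_hatQ hx.1 _ _)
      (differentiableAt_hatQ hx.1 _ _) (hQ0 _ _ hL))
    (fun n hn => differentiableAt_div (differentiableAt_const _) (differentiableAt_hatQ hx.1 _ _)
      (hQ0 _ _ hn)) (hx.1.1 i) (fun j => div_ne_zero (hQ0 _ _ hL) (hQ0 _ _ hL))
    (fun n hn => one_div_ne_zero (hQ0 _ _ hn)) hS0 hinj ?_
    (hdom.mono fun y hy j => hat_row hκ hy j) ?_ ?_ ?_
  · exact (differentiableAt_pE _ hTx j n).fun_comp' x hT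
  · refine Eventually.of_forall fun y n hn => ?_
    rw [hat_col, ← kExt_etaParams i κ hn]
    rfl
  · filter_upwards [hreg] with y hy j
    rw [normS, mul_div_cancel₀ _ (hy.1 i)]
    rfl
  · filter_upwards [hdom] with y hy j n hn
    rw [qE_natCast _ j ⟨n, hn⟩, (eta_extended hκ hy).1, etaQ_eq hy.1]
  · filter_upwards [hdom] with y hy j n hn
    have h := etaQ_mul_etaP hy ⟨n, hn⟩ j
    rw [etaQ_eq hy.1] at h
    rw [pE_natCast _ _ j ⟨n, hn⟩, (eta_extended hκ hy).2]
    refine mul_left_cancel₀ (hatQ_ne_zero hy j hn) ?_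
    rw [← h]
    ring

end Eta

end HLN

namespace HLN

set_option linter.unusedSectionVars false

open Finset Filter Topology

/-! ### Canonical transformations map solutions to solutions. -/

section Solutions

variable {L N : ℕ} [NeZero L]

theorem fundamentalForm_vertical (κ : Params L N) (x : Phase L N ℂ) (v : Phase L N ℂ)
    (wq wp : Fin N → Idx L → ℂ) :
    fundamentalForm κ x v (0, wq, wp)
      = ∑ i, ∑ n, (v.2.2 i n * wq i n - wp i n * v.2.1 i n)
        + ∑ j, fderiv ℂ (hamiltonian κ j) x (0, wq, wp) * v.1 j := by
  simp only [fundamentalForm, Pi.zero_apply, mul_zero, zero_sub, sum_neg_distrib, sub_neg_eq_add]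

theorem sum_mul_single (f : Fin N → Idx L → ℂ) (i : Fin N) (n : Idx L) :
    ∑ a, ∑ m, f a m * (Pi.single i (Pi.single n 1) : Fin N → Idx L → ℂ) a m = f i n := by
  rw [Fintype.sum_eq_single i, Fintype.sum_eq_single n]
  · simp
  · intro m hm; simp [hm]
  · intro a ha; simp [ha]

theorem eq_sum_single (f : Fin N → Idx L → ℂ) :
    f = ∑ a, ∑ m, f a m • (Pi.single a (Pi.single m 1) : Fin N → Idx L → ℂ) := by
  funext i n
  simp only [Finset.sum_apply, Pi.smul_apply, smul_eq_mul]
  rw [Fintype.sum_eq_single i, Fintype.sum_eq_single n]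
  · simp
  · intro m hm; simp [hm.symm]
  · intro a ha; simp [ha.symm]

/-- Hamilton's equations say that the tangent vectors of a solution are orthogonal to the vertical
vectors. -/
theorem hamilton_iff (κ : Params L N) (x : Phase L N ℂ)
    (A B : (Fin N → ℂ) →L[ℂ] (Fin N → Idx L → ℂ)) :
    ((∀ (i j : Fin N) (n : Idx L), A (Pi.single j 1) i n =
        fderiv ℂ (hamiltonian κ j) x (0, 0, Pi.single i (Pi.single n 1))) ∧
      ∀ (i j : Fin N) (n : Idx L), B (Pi.single j 1) i n =
        - fderiv ℂ (hamiltonian κ j) x (0, Pi.single i (Pi.single n 1), 0)) ↔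
    ∀ a wq wp, fundamentalForm κ x (a, A a, B a) (0, wq, wp) = 0 := by
  constructor
  · rintro ⟨hA, hB⟩ a wq wp
    rw [fundamentalForm_vertical]
    have hlin : ∀ (C : (Fin N → ℂ) →L[ℂ] (Fin N → Idx L → ℂ)) i n,
        C a i n = ∑ j, a j * C (Pi.single j 1) i n := fun C i n => by
      have ha : a = ∑ j, a j • (Pi.single j 1 : Fin N → ℂ) := by
        funext l
        simp [Finset.sum_apply, Pi.single_apply]
      have h' : C a = ∑ j, a j • C (Pi.single j 1) := by
        conv_lhs => rw [ha]
        simp only [map_sum, map_smul]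
      rw [h']
      simp only [Finset.sum_apply, Pi.smul_apply, smul_eq_mul]
    have hH : ∀ j, fderiv ℂ (hamiltonian κ j) x (0, wq, wp)
        = ∑ i, ∑ n, (wp i n * A (Pi.single j 1) i n - wq i n * B (Pi.single j 1) i n) := by
      intro j
      have h1 : ((0, wq, wp) : Phase L N ℂ) = ∑ i, ∑ n,
          (wq i n • ((0, Pi.single i (Pi.single n 1), 0) : Phase L N ℂ)
            + wp i n • ((0, 0, Pi.single i (Pi.single n 1)) : Phase L N ℂ)) := by
        refine Prod.ext ?_ (Prod.ext ?_ ?_)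
        · simp [Prod.fst_sum]
        · simpa [Prod.fst_sum, Prod.snd_sum] using eq_sum_single wq
        · simpa [Prod.fst_sum, Prod.snd_sum] using eq_sum_single wp
      rw [h1]
      simp only [map_sum, map_add, map_smul, smul_eq_mul]
      refine sum_congr rfl fun i _ => sum_congr rfl fun n _ => ?_
      rw [hA, hB]; ring
    have h2 : ∑ j, fderiv ℂ (hamiltonian κ j) x (0, wq, wp) * a j
        = ∑ i, ∑ n, (wp i n * A a i n - wq i n * B a i n) := by
      simp only [hH, sum_mul]
      rw [sum_comm]
      refine sum_congr rfl fun i _ => ?_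
      rw [sum_comm]
      refine sum_congr rfl fun n _ => ?_
      rw [hlin A, hlin B, mul_sum, mul_sum, ← sum_sub_distrib]
      exact sum_congr rfl fun j _ => by ring
    rw [h2, ← sum_add_distrib]
    refine sum_eq_zero fun i _ => ?_
    rw [← sum_add_distrib]
    exact sum_eq_zero fun n _ => by ring
  · intro h
    have hs : ∀ (j : Fin N) (F : Fin N → ℂ), ∑ l, F l * (Pi.single j 1 : Fin N → ℂ) l = F j :=
      fun j F => by
        rw [Fintype.sum_eq_single j]
        · simp
        · intro l hl; simp [hl]
    constructor
    · intro i j n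
      have h1 := h (Pi.single j 1) 0 (Pi.single i (Pi.single n 1))
      rw [fundamentalForm_vertical] at h1
      simp only [Pi.zero_apply, mul_zero, zero_sub, sum_neg_distrib] at h1
      rw [hs j fun l => fderiv ℂ (hamiltonian κ l) x _] at h1
      have h2 := sum_mul_single (A (Pi.single j 1)) i n
      simp only [mul_comm] at h1 h2
      rw [h2] at h1
      linear_combination (-1 : ℂ) * h1
    · intro i j n
      have h1 := h (Pi.single j 1) (Pi.single i (Pi.single n 1)) 0
      rw [fundamentalForm_vertical] at h1
      simp only [Pi.zero_apply, zero_mul, sub_zero] at h1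
      rw [hs j fun l => fderiv ℂ (hamiltonian κ l) x _, sum_mul_single] at h1
      linear_combination h1

/-- Along a vertical line the times of the image stay constant. -/
theorem fderiv_vertical {T : Phase L N ℂ → Phase L N ℂ} {f : (Fin N → ℂ) → Fin N → ℂ}
    (hfst : ∀ x, (T x).1 = f x.1) {x : Phase L N ℂ} (hT : DifferentiableAt ℂ T x)
    (w : (Fin N → Idx L → ℂ) × (Fin N → Idx L → ℂ)) : (fderiv ℂ T x (0, w)).1 = 0 := by
  have hline : HasDerivAt (fun t : ℂ => x + t • ((0, w) : Phase L N ℂ)) (0, w) 0 := by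
    simpa using ((hasDerivAt_id (0 : ℂ)).smul_const ((0, w) : Phase L N ℂ)).const_add x
  have h1 : HasFDerivAt T (fderiv ℂ T x) (x + (0 : ℂ) • ((0, w) : Phase L N ℂ)) := by
    simpa using hT.hasFDerivAt
  have h2 := (ContinuousLinearMap.fst ℂ (Fin N → ℂ)
    ((Fin N → Idx L → ℂ) × (Fin N → Idx L → ℂ))).hasFDerivAt.comp_hasDerivAt (0 : ℂ)
    (h1.comp_hasDerivAt (0 : ℂ) hline)
  have h3 : (ContinuousLinearMap.fst ℂ (Fin N → ℂ)
      ((Fin N → Idx L → ℂ) × (Fin N → Idx L → ℂ))) ∘ (T ∘ fun t : ℂ =>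
        x + t • ((0, w) : Phase L N ℂ)) = fun _ => f x.1 := by
    funext t
    simp [hfst]
  rw [h3] at h2
  exact h2.unique (hasDerivAt_const _ _)

/-- A canonical transformation whose action on the times depends only on the times maps solutions
to solutions. -/
theorem maps_solutions_of_canonical {T : Transf L N} {κ κ' : Params L N}
    {f g : (Fin N → ℂ) → Fin N → ℂ} {O : Set (Fin N → ℂ)}
    (hfst : ∀ x, (T.toFun ℂ x).1 = f x.1) (hO : IsOpen O) (hg : DifferentiableOn ℂ g O)
    (hfO : ∀ x, T.Dom ℂ x → f x.1 ∈ O) (hgf : ∀ x, T.Dom ℂ x → g (f x.1) = x.1)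
    (hfg : ∀ s ∈ O, f (g s) = s)
    (hdiff : ∀ x : Phase L N ℂ, T.Dom ℂ x → DifferentiableAt ℂ (T.toFun ℂ) x)
    (hreg : ∀ x : Phase L N ℂ, T.Dom ℂ x → Regular (T.toFun ℂ x))
    (hcan : ∀ x : Phase L N ℂ, T.Dom ℂ x → ∀ v w : Phase L N ℂ,
      fundamentalForm κ' (T.toFun ℂ x) (fderiv ℂ (T.toFun ℂ) x v) (fderiv ℂ (T.toFun ℂ) x w)
        = fundamentalForm κ x v w)
    (U : Set (Fin N → ℂ)) (q p : (Fin N → ℂ) → Fin N → Idx L → ℂ)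
    (hsol : IsSolution κ U q p) (hdom : ∀ s ∈ U, T.Dom ℂ (s, q s, p s))
    (q' p' : (Fin N → ℂ) → Fin N → Idx L → ℂ)
    (hqp : ∀ s ∈ U, q' (T.toFun ℂ (s, q s, p s)).1 = (T.toFun ℂ (s, q s, p s)).2.1 ∧
        p' (T.toFun ℂ (s, q s, p s)).1 = (T.toFun ℂ (s, q s, p s)).2.2) :
    IsSolution κ' ((fun s => (T.toFun ℂ (s, q s, p s)).1) '' U) q' p' := by
  set V := (fun s => (T.toFun ℂ (s, q s, p s)).1) '' U with hV
  -- Describing the image through the inverse `g` of the time map shows that it is open.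
  have hVeq : V = O ∩ g ⁻¹' U := by
    ext s
    constructor
    · rintro ⟨t, ht, rfl⟩
      have h1 := hfO _ (hdom t ht)
      have h2 := hgf _ (hdom t ht)
      simp only [hfst]
      exact ⟨h1, by rw [Set.mem_preimage, h2]; exact ht⟩
    · rintro ⟨hs, hsU⟩
      exact ⟨g s, hsU, by simp only [hfst]; exact hfg s hs⟩
  have hVopen : IsOpen V := by
    rw [hVeq]
    exact hg.continuousOn.isOpen_inter_preimage hO hsol.isOpen
  have hpoint : ∀ s ∈ V, ((s, q' s, p' s) : Phase L N ℂ)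
      = T.toFun ℂ (g s, q (g s), p (g s)) := by
    intro s hs
    rw [hVeq] at hs
    have h1 : (T.toFun ℂ (g s, q (g s), p (g s))).1 = s := by rw [hfst]; exact hfg s hs.1
    obtain ⟨h2, h3⟩ := hqp (g s) hs.2
    rw [h1] at h2 h3
    rw [h2, h3]
    exact Prod.ext h1.symm rfl
  have hgU : ∀ s ∈ V, g s ∈ U := fun s hs => by rw [hVeq] at hs; exact hs.2
  have hqd : ∀ s ∈ V, DifferentiableAt ℂ q (g s) := fun s hs =>
    hsol.diff_q.differentiableAt (hsol.isOpen.mem_nhds (hgU s hs))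
  have hpd : ∀ s ∈ V, DifferentiableAt ℂ p (g s) := fun s hs =>
    hsol.diff_p.differentiableAt (hsol.isOpen.mem_nhds (hgU s hs))
  have hgd : ∀ s ∈ V, DifferentiableAt ℂ g s := fun s hs => by
    rw [hVeq] at hs
    exact hg.differentiableAt (hO.mem_nhds hs.1)
  have hTd : ∀ s ∈ V, DifferentiableAt ℂ (T.toFun ℂ) (g s, q (g s), p (g s)) := fun s hs =>
    hdiff _ (hdom _ (hgU s hs))
  -- the derivative of the transformed solution
  have hder : ∀ s ∈ V, HasFDerivAt (fun t => ((t, q' t, p' t) : Phase L N ℂ))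
      ((fderiv ℂ (T.toFun ℂ) (g s, q (g s), p (g s))).comp
        (((ContinuousLinearMap.id ℂ _).prod ((fderiv ℂ q (g s)).prod (fderiv ℂ p (g s)))).comp
          (fderiv ℂ g s))) s := by
    intro s hs
    have h1 : HasFDerivAt (fun t => ((t, q t, p t) : Phase L N ℂ))
        ((ContinuousLinearMap.id ℂ _).prod ((fderiv ℂ q (g s)).prod (fderiv ℂ p (g s)))) (g s) :=
      (hasFDerivAt_id (g s)).prodMk ((hqd s hs).hasFDerivAt.prodMk (hpd s hs).hasFDerivAt)
    have h2 := h1.comp s (hgd s hs).hasFDerivAt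
    have h3 : HasFDerivAt (T.toFun ℂ ∘ ((fun t => ((t, q t, p t) : Phase L N ℂ)) ∘ g)) _ s :=
      HasFDerivAt.comp s (hTd s hs).hasFDerivAt h2
    refine h3.congr_of_eventuallyEq ?_
    filter_upwards [hVopen.mem_nhds hs] with t ht
    exact hpoint t ht
  have hq' : ∀ s ∈ V, DifferentiableAt ℂ q' s := fun s hs =>
    (hder s hs).differentiableAt.snd.fst
  have hp' : ∀ s ∈ V, DifferentiableAt ℂ p' s := fun s hs =>
    (hder s hs).differentiableAt.snd.snd
  have hham : ∀ s ∈ V, ∀ a wq wp, fundamentalForm κ' ((s, q' s, p' s) : Phase L N ℂ)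
      (a, fderiv ℂ q' s a, fderiv ℂ p' s a) (0, wq, wp) = 0 := by
    intro s hs a wq wp
    set x : Phase L N ℂ := (g s, q (g s), p (g s)) with hx
    have hxd : T.Dom ℂ x := hdom _ (hgU s hs)
    have hxs : ∀ a wq wp, fundamentalForm κ x (a, fderiv ℂ q (g s) a, fderiv ℂ p (g s) a)
        (0, wq, wp) = 0 :=
      (hamilton_iff κ x (fderiv ℂ q (g s)) (fderiv ℂ p (g s))).1
        ⟨hsol.eq_q _ (hgU s hs), hsol.eq_p _ (hgU s hs)⟩
    have hda : ((a, fderiv ℂ q' s a, fderiv ℂ p' s a) : Phase L N ℂ)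
        = fderiv ℂ (T.toFun ℂ) x (fderiv ℂ g s a, fderiv ℂ q (g s) (fderiv ℂ g s a),
          fderiv ℂ p (g s) (fderiv ℂ g s a)) := by
      have h1 : HasFDerivAt (fun t => ((t, q' t, p' t) : Phase L N ℂ))
        ((ContinuousLinearMap.id ℂ _).prod ((fderiv ℂ q' s).prod (fderiv ℂ p' s))) s :=
        (hasFDerivAt_id s).prodMk ((hq' s hs).hasFDerivAt.prodMk (hp' s hs).hasFDerivAt)
      exact congrArg (fun A => A a) (h1.unique (hder s hs))
    have hvert := fun w => fderiv_vertical hfst (hTd s hs) w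
    -- the derivative is bijective on vertical vectors
    let ℓ : ((Fin N → Idx L → ℂ) × (Fin N → Idx L → ℂ)) →ₗ[ℂ]
        ((Fin N → Idx L → ℂ) × (Fin N → Idx L → ℂ)) :=
      (LinearMap.snd ℂ _ _).comp ((fderiv ℂ (T.toFun ℂ) x).toLinearMap.comp (LinearMap.inr ℂ _ _))
    have hℓ : ∀ w, fderiv ℂ (T.toFun ℂ) x (0, w) = (0, ℓ w) := fun w => Prod.ext (hvert w) rfl
    -- By canonicity a vertical vector in the kernel is `Γ_κ`-orthogonal to all vertical vectors, on
    -- which `Γ_κ` is the standard symplectic form. In finite dimension injectivity gives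
    -- surjectivity.
    have hinj : Function.Injective ℓ := by
      rw [← LinearMap.ker_eq_bot, LinearMap.ker_eq_bot']
      rintro ⟨uq, up⟩ hu
      have h0 : ∀ wq wp, fundamentalForm κ x (0, uq, up) (0, wq, wp) = 0 := fun wq wp => by
        rw [← hcan x hxd, hℓ, hu]
        have : ((0, 0) : Phase L N ℂ) = 0 := rfl
        rw [this]
        simp [fundamentalForm]
      refine Prod.ext ?_ ?_
      · funext i n
        have h1 := h0 0 (Pi.single i (Pi.single n 1))
        rw [fundamentalForm_vertical] at h1
        simp only [Pi.zero_apply, mul_zero, zero_sub, sum_neg_distrib, sum_const_zero,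
          add_zero] at h1
        have h2 := sum_mul_single uq i n
        simp only [mul_comm] at h1 h2
        rw [h2] at h1
        simpa using h1
      · funext i n
        have h1 := h0 (Pi.single i (Pi.single n 1)) 0
        rw [fundamentalForm_vertical] at h1
        simp only [Pi.zero_apply, mul_zero, zero_mul, sub_zero, sum_const_zero, add_zero] at h1
        rw [sum_mul_single] at h1
        exact h1
    obtain ⟨⟨uq, up⟩, hu⟩ := LinearMap.injective_iff_surjective.1 hinj (wq, wp)
    -- Both arguments are images under the derivative, so canonicity reduces the equations for `κ'`
    -- to those for `κ`.
    rw [hpoint s hs, hda, ← hu, ← hℓ, hcan x hxd]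
    exact hxs _ _ _
  have hboth := fun s (hs : s ∈ V) => (hamilton_iff κ' (s, q' s, p' s) (fderiv ℂ q' s)
    (fderiv ℂ p' s)).2 (hham s hs)
  exact
    { isOpen := hVopen
      regular := fun s hs => by rw [hpoint s hs]; exact hreg _ (hdom _ (hgU s hs))
      diff_q := fun s hs => (hq' s hs).differentiableWithinAt
      diff_p := fun s hs => (hp' s hs).differentiableWithinAt
      eq_q := fun s hs => (hboth s hs).1
      eq_p := fun s hs => (hboth s hs).2 }

end Solutions

end HLN

namespace HLN

set_option linter.unusedSectionVars false

open Finset MvPolynomial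

/-! ### Automorphisms of the rational function field. -/

section Automorphism

variable {L N : ℕ} [NeZero L]

theorem aeval_coordFn (f : MvPolynomial (Coord L N) ℂ) :
    aeval (coordFn : Coord L N → RatField L N) f = algebraMap _ (RatField L N) f := by
  have : (aeval (coordFn : Coord L N → RatField L N))
      = IsScalarTower.toAlgHom ℂ (MvPolynomial (Coord L N) ℂ) (RatField L N) := by
    ext c
    simp [coordFn]
  rw [this]; rfl

theorem algebraicIndependent_coordFn :
    AlgebraicIndependent ℂ (coordFn : Coord L N → RatField L N) := by
  rw [algebraicIndependent_iff_injective_aeval]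
  intro f g h
  rw [aeval_coordFn, aeval_coordFn] at h
  exact IsFractionRing.injective _ _ h

theorem eq_top_of_coordFn_mem (S : IntermediateField ℂ (RatField L N))
    (h : ∀ c, coordFn c ∈ S) : S = ⊤ := by
  have hpoly : ∀ f : MvPolynomial (Coord L N) ℂ, algebraMap _ (RatField L N) f ∈ S := by
    intro f
    rw [← aeval_coordFn]
    have h1 : Algebra.adjoin ℂ (Set.range (coordFn : Coord L N → RatField L N)) ≤ S.toSubalgebra :=
      Algebra.adjoin_le (by rintro _ ⟨c, rfl⟩; exact h c)
    apply h1
    rw [Algebra.adjoin_range_eq_range_aeval]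
    exact ⟨f, rfl⟩
  rw [eq_top_iff]
  rintro f -
  obtain ⟨a, b, -, rfl⟩ := IsFractionRing.div_surjective (A := MvPolynomial (Coord L N) ℂ) f
  exact S.div_mem (hpoly a) (hpoly b)

/-- Elements that generate the field `ℂ(s, q, p)`, as many as there are coordinates, are the images
of the coordinates under an automorphism. -/
theorem exists_algEquiv_of_generate (y : Coord L N → RatField L N)
    (h : ∀ S : IntermediateField ℂ (RatField L N), (∀ c, y c ∈ S) → ∀ c, coordFn c ∈ S) :
    ∃ σ : RatField L N ≃ₐ[ℂ] RatField L N, ∀ c, σ (coordFn c) = y c := by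
  have htop : IntermediateField.adjoin ℂ (Set.range y) = ⊤ :=
    eq_top_of_coordFn_mem _ (h _ fun c => IntermediateField.subset_adjoin _ _ ⟨c, rfl⟩)
  have halg : Algebra.IsAlgebraic (Algebra.adjoin ℂ (Set.range y)) (RatField L N) := by
    refine ⟨fun f => ?_⟩
    have hf : f ∈ IntermediateField.adjoin ℂ (Set.range y) := by rw [htop]; trivial
    rw [IntermediateField.mem_adjoin_iff_div] at hf
    obtain ⟨r, hr, s, hs, rfl⟩ := hf
    rw [div_eq_mul_inv]
    exact (isAlgebraic_algebraMap (⟨r, hr⟩ : Algebra.adjoin ℂ (Set.range y))).mul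
      (isAlgebraic_algebraMap (⟨s, hs⟩ : Algebra.adjoin ℂ (Set.range y))).inv
  -- A family over which the field is algebraic, and which is no larger than the transcendence
  -- degree, is a transcendence basis.
  have hindep : AlgebraicIndependent ℂ y :=
    (Algebra.IsAlgebraic.isTranscendenceBasis_of_le_trdeg_of_finite ℂ y
      algebraicIndependent_coordFn.cardinalMk_le_trdeg).1
  have hinj : Function.Injective (aeval y : MvPolynomial (Coord L N) ℂ →ₐ[ℂ] RatField L N) :=
    hindep
  let σ : RatField L N →ₐ[ℂ] RatField L N := IsFractionRing.liftAlgHom hinj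
  have hσ : ∀ c, σ (coordFn c) = y c := fun c => by
    simp only [σ, coordFn, IsFractionRing.liftAlgHom_apply]
    rw [IsFractionRing.lift_algebraMap]
    simp
  refine ⟨AlgEquiv.ofBijective σ ⟨σ.toRingHom.injective, ?_⟩, hσ⟩
  have : σ.fieldRange = ⊤ := eq_top_of_coordFn_mem _ (h _ fun c => ⟨coordFn c, hσ c⟩)
  rwa [AlgHom.fieldRange_eq_top] at this

theorem algEquiv_ext {σ τ : RatField L N ≃ₐ[ℂ] RatField L N}
    (h : ∀ c, σ (coordFn c) = τ (coordFn c)) : σ = τ := by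
  have : AlgHom.equalizer (σ : RatField L N →ₐ[ℂ] RatField L N) τ = ⊤ := by
    rw [eq_top_iff]
    rintro f -
    obtain ⟨a, b, -, rfl⟩ := IsFractionRing.div_surjective (A := MvPolynomial (Coord L N) ℂ) f
    have hpoly : ∀ f : MvPolynomial (Coord L N) ℂ,
        σ (algebraMap _ (RatField L N) f) = τ (algebraMap _ (RatField L N) f) := by
      intro f
      rw [← aeval_coordFn]
      have h1 : (σ : RatField L N →ₐ[ℂ] RatField L N).comp (aeval coordFn)
          = (τ : RatField L N →ₐ[ℂ] RatField L N).comp (aeval coordFn) := by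
        ext c
        simpa using h c
      exact DFunLike.congr_fun h1 f
    change σ _ = τ _
    rw [map_div₀, map_div₀, hpoly, hpoly]
  ext f
  have hf : f ∈ AlgHom.equalizer (σ : RatField L N →ₐ[ℂ] RatField L N) τ := by rw [this]; trivial
  exact hf

/-- The coordinates of `y` lie in `S`. -/
def InField (S : IntermediateField ℂ (RatField L N)) (y : Phase L N (RatField L N)) : Prop :=
  (∀ a, y.1 a ∈ S) ∧ (∀ a n, y.2.1 a n ∈ S) ∧ ∀ a n, y.2.2 a n ∈ S

/-- Reduces birationality to recovering the old coordinates rationally from the new ones, without an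
explicit inverse or a check of two compositions. -/
theorem exists_realizes {T : Transf L N} (h : ∀ S, InField S (T.toFun (RatField L N) (generic L N)) →
    InField S (generic L N)) : ∃ σ, T.Realizes σ := by
  set y := T.toFun (RatField L N) (generic L N) with hy
  obtain ⟨σ, hσ⟩ := exists_algEquiv_of_generate (L := L) (N := N)
    (Sum.elim y.1 (Sum.elim (fun z => y.2.1 z.1 z.2) fun z => y.2.2 z.1 z.2))
    fun S hS => by
      have h1 := h S ⟨fun a => hS (.inl a), fun a n => hS (.inr (.inl (a, n))),
        fun a n => hS (.inr (.inr (a, n)))⟩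
      rintro (a | ⟨a, n⟩ | ⟨a, n⟩)
      · exact h1.1 a
      · exact h1.2.1 a n
      · exact h1.2.2 a n
  refine ⟨σ, Prod.ext ?_ (Prod.ext ?_ ?_)⟩
  · funext a; exact hσ (.inl a)
  · funext a n; exact hσ (.inr (.inl (a, n)))
  · funext a n; exact hσ (.inr (.inr (a, n)))

section InField

variable {S : IntermediateField ℂ (RatField L N)} {y : Phase L N (RatField L N)}

theorem InField.sB_mem (h : InField S y) (j : Fin (N + 1)) : sB y j ∈ S := by
  refine Fin.cases ?_ (fun a => ?_) j
  · exact S.one_mem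
  · exact h.1 a

theorem InField.qB_mem (h : InField S y) (j : Fin (N + 1)) (n : Fin L) : qB y j n ∈ S := by
  by_cases hn : n = 0
  · rw [hn, qB_zero_right]; exact S.one_mem
  refine Fin.cases ?_ (fun a => ?_) j
  · rw [qB_zero_left]; exact S.one_mem
  · have := h.2.1 a ⟨n, hn⟩
    rwa [← qB_succ] at this

theorem InField.pPos_mem (h : InField S y) (κ : Params L N) (j : Fin (N + 1)) (n : Idx L) :
    pPos κ y j n ∈ S := by
  refine Fin.cases ?_ (fun a => ?_) j
  · exact S.sub_mem (S.algebraMap_mem _) (S.sum_mem fun a _ => S.mul_mem (h.2.1 a n) (h.2.2 a n))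
  · exact h.2.2 a n

theorem InField.pB_mem (h : InField S y) (κ : Params L N) (j : Fin (N + 1)) (n : Fin L) :
    pB κ y j n ∈ S := by
  rw [pB]
  split_ifs
  · exact S.sub_mem (S.algebraMap_mem _)
      (S.sum_mem fun m _ => S.mul_mem (h.qB_mem j m) (h.pPos_mem κ j m))
  · exact h.pPos_mem κ j _

theorem inField_of_mem (hs : ∀ j, sB y j ∈ S) (hq : ∀ j n, qB y j n ∈ S) {κ : Params L N}
    (hqp : ∀ j n, qB y j n * pB κ y j n ∈ S) (hq0 : ∀ j n, qB y j n ≠ 0) : InField S y := by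
  refine ⟨fun a => hs a.succ, fun a n => ?_, fun a n => ?_⟩
  · rw [← qB_succ]; exact hq _ _
  · rw [← pB_succ κ]
    have := S.div_mem (hqp a.succ n) (hq a.succ n)
    rwa [mul_div_cancel_left₀ _ (hq0 _ _)] at this

end InField

end Automorphism

/-! ### Values of rational functions at complex points. -/

section Specialization

variable {L N : ℕ} [NeZero L]

/-- The values of the coordinates at the point `x`. -/
def coordVal (x : Phase L N ℂ) : Coord L N → ℂ :=
  Sum.elim x.1 (Sum.elim (fun z => x.2.1 z.1 z.2) fun z => x.2.2 z.1 z.2)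

/-- The rational function `f` is defined at the point `x` and has the value `c` there. -/
def Specializes (x : Phase L N ℂ) (f : RatField L N) (c : ℂ) : Prop :=
  ∃ a b : MvPolynomial (Coord L N) ℂ, eval (coordVal x) b ≠ 0 ∧
    f * algebraMap _ (RatField L N) b = algebraMap _ (RatField L N) a ∧
    eval (coordVal x) a = c * eval (coordVal x) b

variable {x : Phase L N ℂ} {f g : RatField L N} {c d : ℂ}

/-- The purpose of specialization: one complex point with a non-zero value shows that a denominator
does not vanish identically. -/
theorem Specializes.ne_zero (h : Specializes x f c) (hc : c ≠ 0) : f ≠ 0 := by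
  rintro rfl
  obtain ⟨a, b, hb, h1, h2⟩ := h
  rw [zero_mul] at h1
  have : a = 0 := IsFractionRing.injective (MvPolynomial (Coord L N) ℂ) (RatField L N)
    (by rw [← h1, map_zero])
  rw [this, map_zero] at h2
  exact mul_ne_zero hc hb h2.symm

theorem specializes_algebraMap (x : Phase L N ℂ) (c : ℂ) :
    Specializes x (algebraMap ℂ (RatField L N) c) c := by
  refine ⟨C c, 1, by simp, ?_, by simp⟩
  rw [map_one, mul_one, ← MvPolynomial.algebraMap_eq, ← IsScalarTower.algebraMap_apply]

theorem specializes_one (x : Phase L N ℂ) : Specializes x 1 1 := by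
  simpa using specializes_algebraMap x 1

theorem specializes_coordFn (x : Phase L N ℂ) (i : Coord L N) :
    Specializes x (coordFn i) (coordVal x i) :=
  ⟨X i, 1, by simp, by simp [coordFn], by simp⟩

theorem Specializes.add (hf : Specializes x f c) (hg : Specializes x g d) :
    Specializes x (f + g) (c + d) := by
  obtain ⟨a, b, hb, h1, h2⟩ := hf
  obtain ⟨a', b', hb', h1', h2'⟩ := hg
  refine ⟨a * b' + a' * b, b * b', by simp [hb, hb'], ?_, ?_⟩
  · rw [map_add, map_mul, map_mul, map_mul, ← h1, ← h1']; ring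
  · rw [map_add, map_mul, map_mul, map_mul, h2, h2']; ring

theorem Specializes.mul (hf : Specializes x f c) (hg : Specializes x g d) :
    Specializes x (f * g) (c * d) := by
  obtain ⟨a, b, hb, h1, h2⟩ := hf
  obtain ⟨a', b', hb', h1', h2'⟩ := hg
  refine ⟨a * a', b * b', by simp [hb, hb'], ?_, ?_⟩
  · rw [map_mul, map_mul, ← h1, ← h1']; ring
  · rw [map_mul, map_mul, h2, h2']; ring

theorem Specializes.inv (hf : Specializes x f c) (hc : c ≠ 0) : Specializes x f⁻¹ c⁻¹ := by
  have hf0 := hf.ne_zero hc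
  obtain ⟨a, b, hb, h1, h2⟩ := hf
  refine ⟨b, a, by rw [h2]; exact mul_ne_zero hc hb, ?_, ?_⟩
  · rw [← h1, ← mul_assoc, inv_mul_cancel₀ hf0, one_mul]
  · rw [h2, ← mul_assoc, inv_mul_cancel₀ hc, one_mul]

theorem Specializes.sub (hf : Specializes x f c) (hg : Specializes x g d) :
    Specializes x (f - g) (c - d) := by
  have h := hf.add ((specializes_algebraMap x (-1)).mul hg)
  rw [map_neg, map_one, neg_one_mul, neg_one_mul, ← sub_eq_add_neg, ← sub_eq_add_neg] at h
  exact h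

theorem Specializes.div (hf : Specializes x f c) (hg : Specializes x g d) (hd : d ≠ 0) :
    Specializes x (f / g) (c / d) := by
  rw [div_eq_mul_inv, div_eq_mul_inv]; exact hf.mul (hg.inv hd)

theorem specializes_sum {α : Type*} (s : Finset α) {f : α → RatField L N} {c : α → ℂ}
    (h : ∀ i ∈ s, Specializes x (f i) (c i)) :
    Specializes x (∑ i ∈ s, f i) (∑ i ∈ s, c i) := by
  classical
  induction s using Finset.induction_on with
  | empty => simpa using specializes_algebraMap x 0
  | insert a s ha ih =>
    rw [sum_insert ha, sum_insert ha]
    exact (h a (mem_insert_self _ _)).add (ih fun i hi => h i (mem_insert_of_mem hi))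

theorem Specializes.pow (hf : Specializes x f c) (n : ℕ) : Specializes x (f ^ n) (c ^ n) := by
  induction n with
  | zero => simpa using specializes_one x
  | succ n ih => rw [pow_succ, pow_succ]; exact ih.mul hf

theorem Specializes.zpow (hf : Specializes x f c) (hc : c ≠ 0) (n : ℤ) :
    Specializes x (f ^ n) (c ^ n) := by
  cases n with
  | ofNat n => simpa using hf.pow n
  | negSucc n => rw [zpow_negSucc, zpow_negSucc]; exact (hf.pow _).inv (pow_ne_zero _ hc)

theorem specializes_sB (x : Phase L N ℂ) (j : Fin (N + 1)) :
    Specializes x (sB (generic L N) j) (sB x j) := by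
  refine Fin.cases ?_ (fun a => ?_) j
  · exact specializes_one x
  · exact specializes_coordFn x (.inl a)

theorem specializes_qB (x : Phase L N ℂ) (j : Fin (N + 1)) (n : Fin L) :
    Specializes x (qB (generic L N) j n) (qB x j n) := by
  by_cases hn : n = 0
  · rw [hn, qB_zero_right, qB_zero_right]; exact specializes_one x
  refine Fin.cases ?_ (fun a => ?_) j
  · rw [qB_zero_left, qB_zero_left]; exact specializes_one x
  · have := specializes_coordFn x (.inr (.inl (a, ⟨n, hn⟩)))
    rw [qB_succ _ a ⟨n, hn⟩, qB_succ _ a ⟨n, hn⟩]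
    exact this

theorem specializes_pPos (κ : Params L N) (x : Phase L N ℂ) (j : Fin (N + 1)) (n : Idx L) :
    Specializes x (pPos κ (generic L N) j n) (pPos κ x j n) := by
  refine Fin.cases ?_ (fun a => ?_) j
  · exact (specializes_algebraMap x _).sub (specializes_sum _ fun a _ =>
      (specializes_coordFn x (.inr (.inl (a, n)))).mul (specializes_coordFn x (.inr (.inr (a, n)))))
  · exact specializes_coordFn x (.inr (.inr (a, n)))

theorem specializes_pB (κ : Params L N) (x : Phase L N ℂ) (j : Fin (N + 1)) (n : Fin L) :
    Specializes x (pB κ (generic L N) j n) (pB κ x j n) := by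
  rw [pB, pB]
  split_ifs
  · exact (specializes_algebraMap x _).sub
      (specializes_sum _ fun m _ => (specializes_qB x j m).mul (specializes_pPos κ x j m))
  · exact specializes_pPos κ x j _

theorem specializes_etaB {κ : Params L N} {x : Phase L N ℂ} (hx : Regular x) (i : Fin (N + 1))
    (n : ℤ) (j : Fin (N + 1)) : Specializes x (etaB κ i (generic L N) n j) (etaB κ i x n j) :=
  specializes_sum _ fun _ _ => ((specializes_pB κ x i _).div ((specializes_sB x i).zpow (hx.1 i) _)
    (zpow_ne_zero _ (hx.1 i))).mul (((specializes_sB x j).zpow (hx.1 j) _).mul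
      (specializes_qB x j _))

/-- The point with given `q`, `p` and `s_i = i + 1`. -/
def stdPoint (q p : Fin N → Idx L → ℂ) : Phase L N ℂ := (fun a => ((a : ℕ) : ℂ) + 2, q, p)

theorem sB_stdPoint (q p : Fin N → Idx L → ℂ) (j : Fin (N + 1)) :
    sB (stdPoint q p) j = ((j : ℕ) : ℂ) + 1 := by
  refine Fin.cases ?_ (fun a => ?_) j
  · simp
  · simp only [sB_succ, stdPoint, Fin.val_succ]; push_cast; ring

theorem regular_stdPoint (q p : Fin N → Idx L → ℂ) : Regular (stdPoint q p) := by
  refine ⟨fun i => ?_, fun i j h => ?_⟩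
  · rw [sB_stdPoint]; exact Nat.cast_add_one_ne_zero _
  · rw [sB_stdPoint, sB_stdPoint] at h
    exact Fin.ext (by exact_mod_cast add_right_cancel h)

theorem regular_generic : Regular (generic L N) := by
  have h := regular_stdPoint (L := L) (N := N) 0 0
  refine ⟨fun i => (specializes_sB _ i).ne_zero (h.1 i), fun i j hij => h.2 ?_⟩
  by_contra hne
  exact ((specializes_sB _ i).sub (specializes_sB _ j)).ne_zero (sub_ne_zero.2 hne)
    (sub_eq_zero.2 hij)

theorem qB_generic_ne_zero (j : Fin (N + 1)) (n : Fin L) : qB (generic L N) j n ≠ 0 := by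
  refine (specializes_qB (stdPoint 1 0) j n).ne_zero ?_
  by_cases hn : n = 0
  · rw [hn, qB_zero_right]; exact one_ne_zero
  refine Fin.cases ?_ (fun a => ?_) j
  · rw [qB_zero_left]; exact one_ne_zero
  · rw [qB_succ _ a ⟨n, hn⟩]; exact one_ne_zero

end Specialization

end HLN

namespace HLN

set_option linter.unusedSectionVars false

open Finset

/-! ### Generic non-vanishing of denominators, and birationality. -/

section Generic

variable {L N : ℕ} [NeZero L]

theorem sum_single_single {F : Type} [AddCommMonoid F] (a : Fin N) (m : Idx L) (t : F) :
    ∑ n, (Pi.single a (Pi.single m t) : Fin N → Idx L → F) a n = t := by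
  simp

/-- Where all `q` are 1 and all momenta but one vanish, each extended `p` is affine in the remaining
momentum `t`; for a suitable choice of that momentum the slope is ±1, and some `t` gives the value
1. -/
theorem pB_generic_ne_zero (hL : 2 ≤ L) (hN : 1 ≤ N) (κ : Params L N) (i : Fin (N + 1))
    (n : Fin L) : pB κ (generic L N) i n ≠ 0 := by
  have key : ∀ (a : Fin N) (m : Idx L), (∃ c ε : ℂ, ε ≠ 0 ∧
      ∀ t, pB κ (stdPoint 1 (Pi.single a (Pi.single m t))) i n = c + ε * t) →
      pB κ (generic L N) i n ≠ 0 := by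
    rintro a m ⟨c, ε, hε, h⟩
    refine (specializes_pB κ (stdPoint 1 (Pi.single a (Pi.single m ((1 - c) / ε)))) i n).ne_zero ?_
    rw [h, mul_div_cancel₀ _ hε, add_sub_cancel]
    exact one_ne_zero
  have hone : ∀ p i n, qB (stdPoint (L := L) (N := N) 1 p) i n = 1 := by
    intro p i n
    by_cases hn : n = 0
    · rw [hn, qB_zero_right]
    refine Fin.cases (qB_zero_left _ _) (fun a => ?_) i
    exact qB_succ _ a ⟨n, hn⟩
  have m₀ : Idx L := ⟨⟨1, hL⟩, fun h => by simp [Fin.ext_iff] at h⟩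
  have hcol : ∀ (a : Fin N) (m n : Idx L) (t : ℂ),
      pPos κ (stdPoint 1 (Pi.single a (Pi.single m t))) 0 n
        = κ.k n - (Pi.single m t : Idx L → ℂ) n := by
    intro a m n t
    have : ∑ b : Fin N, (Pi.single a (Pi.single m t) : Fin N → Idx L → ℂ) b n
        = (Pi.single m t : Idx L → ℂ) n := by
      rw [Fintype.sum_eq_single a fun b hb => by simp [hb]]
      simp
    simp only [pPos, stdPoint, Fin.cases_zero, Pi.one_apply, one_mul, this]
    rfl
  by_cases hn : n = 0
  · refine Fin.cases (fun key => ?_) (fun a key => ?_) i key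
    · refine key ⟨0, hN⟩ m₀ ⟨κ.θ 0 - ∑ m : Idx L, κ.k m, 1, one_ne_zero, fun t => ?_⟩
      rw [pB, dif_pos hn]
      simp only [hone, one_mul, hcol, sum_sub_distrib, sum_pi_single', mem_univ, if_true]
      change κ.θ 0 - _ = _
      ring
    · refine key a m₀ ⟨κ.θ a.succ, -1, by simp, fun t => ?_⟩
      rw [pB, dif_pos hn]
      have hsucc : ∀ m, pPos κ (stdPoint 1 (Pi.single a (Pi.single m₀ t))) a.succ m
          = (Pi.single a (Pi.single m₀ t) : Fin N → Idx L → ℂ) a m := fun _ => rfl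
      simp only [hone, one_mul, hsucc, sum_single_single]
      change κ.θ a.succ - _ = _
      ring
  · refine Fin.cases (fun key => ?_) (fun a key => ?_) i key
    · refine key ⟨0, hN⟩ ⟨n, hn⟩ ⟨κ.k n, -1, by simp, fun t => ?_⟩
      rw [pB, dif_neg hn, hcol, Pi.single_eq_same]
      ring
    · refine key a ⟨n, hn⟩ ⟨0, 1, one_ne_zero, fun t => ?_⟩
      rw [pB, dif_neg hn]
      simp [pPos, stdPoint]

/-- Folds the window back to `0, …, L - 1`: an index `k ≥ n` occurs in it as `k - L` and picks up
the factor `s_i / s_j`. -/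
theorem etaB_eq_sum {F : Type} [Field F] [Algebra ℂ F] {κ : Params L N} {i j : Fin (N + 1)}
    {x : Phase L N F} (hx : Regular x) (hj : j ≠ i) {n : ℕ} (hn : n ≤ L) :
    etaB κ i x n j = ∑ k : Fin L, (if (k : ℕ) < n then 1 else sB x i / sB x j)
      * (pB κ x i k * qB x j k) := by
  have hi := hx.1 i
  have hj' := hx.1 j
  have hd := normS_sub_one (i := i) hx hj
  have hij : sB x j - sB x i ≠ 0 := sub_ne_zero.2 fun h => hj (hx.2 h)
  have h1 : ∑ k : Fin L, (if (k : ℕ) < n then 1 else sB x i / sB x j) * (pB κ x i k * qB x j k)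
      = ∑ k ∈ range L, (if k < n then 1 else sB x i / sB x j) * normQ κ i x j k := by
    rw [← Fin.sum_univ_eq_sum_range
      (fun k => (if k < n then 1 else sB x i / sB x j) * normQ κ i x j k)]
    exact sum_congr rfl fun k _ => by rw [normQ, pE_natCast, qE_natCast]
  have h2 : ∀ k ∈ range L, (if k < n then 1 else sB x i / sB x j) * normQ κ i x j k
      = sB x i / sB x j * normQ κ i x j k
        + if k < n then (1 - sB x i / sB x j) * normQ κ i x j k else 0 := fun k _ => by
    split_ifs <;> ring
  have h3 : (range L).filter (· < n) = range n := by
    ext k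
    simp only [mem_filter, mem_range]
    omega
  rw [h1, sum_congr rfl h2, sum_add_distrib, ← sum_filter, h3, ← mul_sum, ← mul_sum,
    etaB_eq hx hj, hatQ, if_neg hj, normS, div_sub_one hi]
  field_simp
  ring

theorem etaB_generic_ne_zero (hL : 2 ≤ L) (κ : Params L N) {i j : Fin (N + 1)} (hj : j ≠ i)
    (n : Fin L) : etaB κ i (generic L N) (n : ℕ) j ≠ 0 := by
  have m₀ : Idx L := ⟨⟨1, hL⟩, fun h => by simp [Fin.ext_iff] at h⟩
  have key : ∀ x : Phase L N ℂ, Regular x → etaB κ i x (n : ℕ) j ≠ 0 →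
      etaB κ i (generic L N) (n : ℕ) j ≠ 0 := fun x hx h => (specializes_etaB hx i n j).ne_zero h
  have hc : ∀ (q p : Fin N → Idx L → ℂ) (k : Fin L), (if (k : ℕ) < n then 1 else
      sB (stdPoint q p) i / sB (stdPoint q p) j) ≠ 0 := fun q p k => by
    split_ifs
    · exact one_ne_zero
    · exact div_ne_zero ((regular_stdPoint q p).1 i) ((regular_stdPoint q p).1 j)
  have hsum : ∀ (q p : Fin N → Idx L → ℂ), etaB κ i (stdPoint q p) (n : ℕ) j
      = (if ((0 : Fin L) : ℕ) < n then 1 else sB (stdPoint q p) i / sB (stdPoint q p) j)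
          * pB κ (stdPoint q p) i 0
        + ∑ k : Idx L, (if ((k : Fin L) : ℕ) < n then 1 else
          sB (stdPoint q p) i / sB (stdPoint q p) j)
          * (pB κ (stdPoint q p) i k * qB (stdPoint q p) j k) := fun q p => by
    rw [etaB_eq_sum (regular_stdPoint q p) hj n.2.le, sum_fin_eq_add_sum_idx, qB_zero_right,
      mul_one]
  by_cases hi : i = 0
  · subst hi
    obtain ⟨b, rfl⟩ := Fin.exists_succ_eq.2 hj
    set c₀ : ℂ := if ((0 : Fin L) : ℕ) < n then 1 else
      sB (stdPoint (L := L) (N := N) 0 0) 0 / sB (stdPoint (L := L) (N := N) 0 0) b.succ with hc₀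
    set c₁ : ℂ := if ((m₀ : Fin L) : ℕ) < n then 1 else
      sB (stdPoint (L := L) (N := N) 0 0) 0 / sB (stdPoint (L := L) (N := N) 0 0) b.succ with hc₁
    have hc₁' : c₁ ≠ 0 := hc 0 0 m₀
    -- At the point below, `q = r` and `p^{(0)}` is 1 at `m₀`, `θ_0 - 1` at 0 and zero elsewhere, so
    -- this is the value of the sum. As `c₁ ≠ 0`, it cannot vanish for both `r = 1` and `r = 2`.
    obtain ⟨r, hr, hr'⟩ : ∃ r : ℂ, r ≠ 0 ∧ c₀ * (κ.θ 0 - 1) + c₁ * r ≠ 0 := by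
      by_contra h
      push Not at h
      have h1 := h 1 one_ne_zero
      have h2 := h 2 two_ne_zero
      exact hc₁' (by linear_combination h2 - h1)
    set q : Fin N → Idx L → ℂ := fun _ _ => r
    set p : Fin N → Idx L → ℂ := Pi.single b fun m => (κ.k m - if m = m₀ then 1 else 0) / r
      with hp
    have h1 : ∀ m : Idx L, pPos κ (stdPoint q p) 0 m = if m = m₀ then 1 else 0 := by
      intro m
      have : ∑ a : Fin N, q a m * p a m = κ.k m - if m = m₀ then 1 else 0 := by
        rw [Fintype.sum_eq_single b fun a ha => by simp [hp, ha]]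
        simp only [hp, q, Pi.single_eq_same]
        rw [mul_div_cancel₀ _ hr]
      simp only [pPos, stdPoint, Fin.cases_zero]
      rw [this]
      change κ.k m - _ = _
      ring
    refine key (stdPoint q p) (regular_stdPoint q p) ?_
    rw [hsum, Fintype.sum_eq_single m₀]
    · rw [pB_idx, h1, if_pos rfl, one_mul, qB_succ, pB, dif_pos rfl]
      simp only [h1, qB_zero_left, one_mul, sum_ite_eq', mem_univ, if_true]
      exact hr'
    · intro m hm
      rw [pB_idx, h1, if_neg hm]
      ring
  · obtain ⟨a, rfl⟩ := Fin.exists_succ_eq.2 hi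
    -- With `q^{(i)} = θ_i` and a single momentum 1 in row `i`, `p_0^{(i)}` becomes 0 and only the
    -- term `m₀` survives.
    set q : Fin N → Idx L → ℂ := Function.update 1 a fun _ => κ.θ a.succ with hq
    set p : Fin N → Idx L → ℂ := Pi.single a (Pi.single m₀ 1) with hp
    have hqj : ∀ m : Idx L, qB (stdPoint q p) j m = 1 := by
      intro m
      by_cases hj0 : j = 0
      · rw [hj0, qB_zero_left]
      · obtain ⟨b, rfl⟩ := Fin.exists_succ_eq.2 hj0
        rw [qB_succ]
        have hba : b ≠ a := fun h => hj (h ▸ rfl)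
        simp [stdPoint, hq, hba]
    have hpa : ∀ m : Idx L, pPos κ (stdPoint q p) a.succ m = (Pi.single m₀ 1 : Idx L → ℂ) m := by
      intro m
      simp [pPos, stdPoint, hp]
    have hp0 : pB κ (stdPoint q p) a.succ 0 = 0 := by
      rw [pB, dif_pos rfl, Fintype.sum_eq_single m₀ fun m hm => by rw [hpa]; simp [hm]]
      rw [hpa, qB_succ]
      simp [stdPoint, hq]
    refine key (stdPoint q p) (regular_stdPoint q p) ?_
    rw [hsum, Fintype.sum_eq_single m₀, hp0, mul_zero, zero_add, pB_idx, hpa, hqj]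
    · simpa using hc q p m₀
    · intro m hm
      rw [pB_idx, hpa]
      simp [hm]

theorem perm_dom_generic (κ : Params L N) (π : Equiv.Perm (Fin (N + 1))) :
    (permTransf κ π).Dom (RatField L N) (generic L N) :=
  ⟨regular_generic, fun n => qB_generic_ne_zero _ n⟩

theorem iota_dom_generic (hL : 2 ≤ L) (hN : 1 ≤ N) (κ : Params L N) :
    (iota κ).Dom (RatField L N) (generic L N) :=
  ⟨regular_generic, fun n => pB_generic_ne_zero hL hN κ _ n,
    fun i => pB_generic_ne_zero hL hN κ i _⟩

theorem eta_dom_generic (hL : 2 ≤ L) (hN : 1 ≤ N) (κ : Params L N) (i : Fin (N + 1)) :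
    (eta κ i).Dom (RatField L N) (generic L N) :=
  ⟨regular_generic, fun n => pB_generic_ne_zero hL hN κ _ n,
    fun _ hj n => etaB_generic_ne_zero hL κ hj n⟩

/-- The images of `s` and `q` with upper index `π⁻¹ 0` are the inverses of the divisors; once these
are known, everything else follows. -/
theorem perm_exists_realizes {κ : Params L N} (hκ : κ.Admissible) (π : Equiv.Perm (Fin (N + 1))) :
    ∃ σ, (permTransf κ π).Realizes σ := by
  refine exists_realizes fun S hS => ?_
  obtain ⟨hq, hp⟩ := perm_extended (x := generic L N) hκ (π := π) fun n => qB_generic_ne_zero _ n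
  have hs0 := (regular_generic (L := L) (N := N)).1 (π 0)
  have hsS := fun j => perm_sB (κ := κ) hs0 j ▸ hS.sB_mem j
  have hqS := fun j n => hq j n ▸ hS.qB_mem j n
  have hpS := fun j n => hp j n ▸ hS.pB_mem (permParams π κ) j n
  have hs0S : sB (generic L N) (π 0) ∈ S := by
    have := S.inv_mem (hsS (π.symm 0))
    rwa [Equiv.apply_symm_apply, sB_zero, one_div, inv_inv] at this
  have hq0S : ∀ n, qB (generic L N) (π 0) n ∈ S := fun n => by
    have := S.inv_mem (hqS (π.symm 0) n)
    rwa [Equiv.apply_symm_apply, qB_zero_left, one_div, inv_inv] at this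
  have hq0 := fun n => qB_generic_ne_zero (L := L) (N := N) (π 0) n
  refine inField_of_mem (κ := κ) (fun j => ?_) (fun j n => ?_) (fun j n => ?_) qB_generic_ne_zero
  · have := S.mul_mem (hsS (π.symm j)) hs0S
    rwa [Equiv.apply_symm_apply, div_mul_cancel₀ _ hs0] at this
  · have := S.mul_mem (hqS (π.symm j) n) (hq0S n)
    rwa [Equiv.apply_symm_apply, div_mul_cancel₀ _ (hq0 n)] at this
  · have := S.mul_mem (hqS (π.symm j) n) (hpS (π.symm j) n)
    have h0 := hq0 n
    rw [Equiv.apply_symm_apply] at this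
    convert this using 1
    field_simp

/-- Dividing the image of `p_n^{(j)}` by that of `p_n^{(0)}` removes `p_{L-n}^{(0)}`. At `n = 0`
this yields `p_0^{(j)} / p_0^{(0)}`, at the other `n` the variables `q`; the products `q p` are
known up to sign. -/
theorem iota_exists_realizes (hL : 2 ≤ L) (hN : 1 ≤ N) {κ : Params L N} (hκ : κ.Admissible) :
    ∃ σ, (iota κ).Realizes σ := by
  refine exists_realizes fun S hS => ?_
  have hx := iota_dom_generic hL hN κ
  set x := generic L N with hxdef
  obtain ⟨hq, hp⟩ := iota_extended hκ hx
  have hqS := fun j n => hq j n ▸ hS.qB_mem j n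
  have hpS := fun j n => hp j n ▸ hS.pB_mem (iotaParams κ) j n
  have hsS : ∀ j, sB x j ∈ S := fun j => hS.sB_mem j
  have h2 : ∀ j, pE κ x j 0 ≠ 0 := fun j => by rw [pE_zero]; exact hx.2.2 j
  have h1 := hx.1.1
  have hratio : ∀ j (n : Fin L), qE x j ((L : ℤ) - (n : ℕ)) * (pE κ x j 0 / (sB x j * pE κ x 0 0))
      ∈ S := by
    intro j n
    have := S.div_mem (hpS j n) (hpS 0 n)
    have h3 := pE_zero_reflect_ne_zero hx n.2
    have h4 := h2 0
    have h5 := h1 j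
    convert this using 1
    have hq0 : ∀ n : ℤ, qE x 0 n = 1 := fun n => by
      rw [qE, sB_zero, one_zpow, qB_zero_left, one_mul]
    rw [iotaP, iotaP, sB_zero, hq0]
    field_simp
  have hrefl : ∀ n : Fin L, n ≠ 0 → ∃ m : Fin L, (L : ℤ) - (m : ℕ) = (n : ℕ) := fun n hn =>
    ⟨⟨L - n, by
      have : 0 < (n : ℕ) := Nat.pos_of_ne_zero fun h => hn (Fin.ext h)
      omega⟩, by have := n.2; simp only [Nat.cast_sub this.le]; ring⟩
  have h0S : ∀ j, pE κ x j 0 / pE κ x 0 0 ∈ S := fun j => by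
    have := hratio j 0
    rw [Fin.val_zero, Nat.cast_zero, sub_zero, qE_period hx.1, qE_zero, mul_one] at this
    have h5 := h1 j
    convert this using 1
    field_simp
  refine inField_of_mem (κ := κ) hsS (fun j n => ?_) (fun j n => ?_) qB_generic_ne_zero
  · by_cases hn : n = 0
    · rw [hn, qB_zero_right]; exact S.one_mem
    · obtain ⟨m, hm⟩ := hrefl n hn
      have := S.div_mem (S.mul_mem (hratio j m) (hsS j)) (h0S j)
      have h5 := h1 j
      have h6 := h2 j
      have h7 := h2 0
      rw [hm, qE_natCast] at this
      convert this using 1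
      field_simp
  · have hmem : ∀ m : Fin L, qE x j ((L : ℤ) - (m : ℕ)) * pE κ x j ((L : ℤ) - (m : ℕ)) ∈ S :=
      fun m => by
        have := S.neg_mem (S.mul_mem (hqS j m) (hpS j m))
        rwa [iotaQ_mul_iotaP hx j m.2, neg_neg] at this
    by_cases hn : n = 0
    · have := hmem 0
      rw [Fin.val_zero, Nat.cast_zero, sub_zero, qE_period hx.1, pE_period κ hx.1, qE_zero,
        pE_zero] at this
      have h5 := h1 j
      rw [hn, qB_zero_right]
      convert this using 1
      field_simp
    · obtain ⟨m, hm⟩ := hrefl n hn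
      have := hmem m
      rwa [hm, qE_natCast, pE_natCast] at this

/-- The unknown factors `hatQ j 0` are carried along. Dividing row `j` by row `i` isolates `hatQ j n
/ hatQ j 0`, whose differences give `normQ`; sums of `hatP` give `shiftP`. Products and cross-ratios
are then free of these factors. -/
theorem eta_exists_realizes (hL : 2 ≤ L) (hN : 1 ≤ N) {κ : Params L N} (hκ : κ.Admissible)
    (i : Fin (N + 1)) : ∃ σ, (eta κ i).Realizes σ := by
  refine exists_realizes fun S hS => ?_
  have hx := eta_dom_generic hL hN κ i
  set x := generic L N with hxdef
  obtain ⟨hq, hp⟩ := eta_extended hκ hx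
  have hqS := fun j n => hq j n ▸ hS.qB_mem j n
  have hpS := fun j n => hp j n ▸ hS.pB_mem (etaParams i κ) j n
  have hsS : ∀ j, sB x j ∈ S := fun j => hS.sB_mem j
  have hL0 := Nat.pos_of_neZero L
  have hpair := diffPair hx.1 hx.2.1
  have hQ0 : ∀ j, hatQ κ i x j 0 ≠ 0 := fun j => hatQ_ne_zero hx j hL0
  have hSS : ∀ j, normS i x j ∈ S := fun j => S.div_mem (hsS j) (hsS i)
  -- the new variables, scaled so that `q_n^{(i)} = 1`
  have hu : ∀ j, ∀ n ≤ L, j ≠ i → hatQ κ i x j n / hatQ κ i x j 0 ∈ S := by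
    intro j n hn hj
    rcases hn.eq_or_lt with rfl | hn
    · rw [hpair.Qh_period j hj, mul_div_cancel_right₀ _ (hQ0 j)]
      exact hSS j
    · have := S.div_mem (hqS j ⟨n, hn⟩) (hqS i ⟨n, hn⟩)
      rw [etaQ_eq hx.1, etaQ_eq hx.1] at this
      have h1 := hatQ_ne_zero hx 0 hn
      have h2 := hQ0 0
      have h3 := hQ0 j
      have e1 : hatQ κ i x i n = 1 := if_pos rfl
      have e0 : hatQ κ i x i 0 = 1 := if_pos rfl
      simp only [e1, e0] at this
      convert this using 1
      field_simp
  have hv : ∀ j, ∀ n < L, j ≠ i → hatP κ i x j n * hatQ κ i x j 0 ∈ S := by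
    intro j n hn hj
    have h1 := S.div_mem (S.mul_mem (hqS j ⟨n, hn⟩) (hpS j ⟨n, hn⟩)) (hu j n hn.le hj)
    rw [etaQ_mul_etaP hx] at h1
    have h2 := hatQ_ne_zero hx j hn
    have h3 := hQ0 j
    convert h1 using 1
    field_simp
  have hQS : ∀ j, ∀ n < L, j ≠ i → normQ κ i x j n / hatQ κ i x j 0 ∈ S := by
    intro j n hn hj
    have := S.sub_mem (hu j (n + 1) hn hj) (hu j n hn.le hj)
    rwa [hpair.Qh_succ j hj n hn, ← sub_div, add_sub_cancel_left] at this
  have hRS : ∀ j, j ≠ i → ∀ n ≤ L, shiftP κ i x j n * hatQ κ i x j 0 ∈ S := by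
    intro j hj
    have htel : ∀ n ≤ L, ∑ m ∈ range n, hatP κ i x j m * hatQ κ i x j 0
        = (shiftP κ i x j 0 - shiftP κ i x j n) * hatQ κ i x j 0 := fun n hn => by
      rw [← sum_mul, sum_congr rfl fun m hm => hpair.Ph_eq j hj m
        ((mem_range.1 hm).trans_le hn), sum_range_sub']
    have hsum : ∀ n ≤ L, ∑ m ∈ range n, hatP κ i x j m * hatQ κ i x j 0 ∈ S := fun n hn =>
      S.sum_mem fun m hm => hv j m ((mem_range.1 hm).trans_le hn) hj
    -- Over a full period the sum is `normS - 1` times `shiftP` at `L`, which fixes the constant of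
    -- summation.
    have h0 : shiftP κ i x j 0 * hatQ κ i x j 0 ∈ S := by
      have h1 := S.mul_mem (hSS j) (S.div_mem (hsum L le_rfl)
        (S.sub_mem (hSS j) S.one_mem))
      rw [htel L le_rfl, hpair.R_zero j hj] at h1
      have h2 := normS_sub_one (i := i) hx.1 hj
      rw [hpair.R_zero j hj]
      convert h1 using 1
      field_simp
    intro n hn
    have := S.sub_mem h0 (hsum n hn)
    rw [htel n hn] at this
    convert this using 1
    ring
  have hqp_ne : ∀ j, ∀ n < L, j ≠ i → normQ κ i x j n * normP κ i x j n ∈ S := by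
    intro j n hn hj
    have := S.mul_mem (hQS j n hn hj) (hRS j hj (n + 1) hn)
    rw [← hpair.P_eq j hj n hn] at this
    have h3 := hQ0 j
    convert this using 1
    field_simp
  have hqp : ∀ j, ∀ n < L, normQ κ i x j n * normP κ i x j n ∈ S := by
    intro j n hn
    by_cases hj : j = i
    · subst hj
      -- Row `i`, where `hatQ` is constantly 1, is recovered from the column relation.
      have h := norm_col hκ hx.2.1 hn
      rw [← add_sum_erase univ _ (mem_univ j)] at h
      rw [eq_sub_of_add_eq h]
      exact S.sub_mem (S.algebraMap_mem _)
        (S.sum_mem fun l hl => hqp_ne l n hn (ne_of_mem_erase hl))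
    · exact hqp_ne j n hn hj
  have hG : ∀ j, ∀ n < L, normQ κ i x j n / hatQ κ i x j 0 ∈ S := by
    intro j n hn
    by_cases hj : j = i
    · subst hj
      have := hqp j n hn
      rwa [hpair.P_i n hn, mul_one, ← div_one (normQ κ j x j n),
        ← hpair.Qh_i 0 hL0] at this
    · exact hQS j n hn hj
  have hqne : ∀ j (n : Fin L), qB x j n ≠ 0 := qB_generic_ne_zero
  refine inField_of_mem (κ := κ) hsS (fun j n => ?_) (fun j n => ?_) hqne
  -- In this cross-ratio the `p^{(i)}` and the factors `hatQ j 0`, `hatQ 0 0` cancel; `q^{(0)} = q_0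
  -- = 1` leaves `q_n^{(j)}`.
  · have := S.div_mem (S.div_mem (hG j n n.2) (hG j 0 hL0)) (S.div_mem (hG 0 n n.2) (hG 0 0 hL0))
    simp only [normQ, Nat.cast_zero, qE_zero, pE_zero, qE_natCast, pE_natCast, qB_zero_left] at this
    have h1 := hQ0 j
    have h2 := hQ0 0
    have h3 := hx.2.1 n
    have h4 := hx.2.1 0
    convert this using 1
    field_simp
  · have := hqp j n n.2
    have h3 := hx.2.1 n
    rw [normQ, normP, qE_natCast, pE_natCast, pE_natCast] at this
    convert this using 1
    field_simp

end Generic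

/-! ### Assembly of the symmetry statements. -/

section Symmetry

variable {L N : ℕ} [NeZero L] {κ : Params L N}

theorem eta_isSymmetry (hL : 2 ≤ L) (hN : 1 ≤ N) (hκ : κ.Admissible) (i : Fin (N + 1)) :
    (eta κ i).IsSymmetry κ (etaParams i κ) where
  dom_generic := eta_dom_generic hL hN κ i
  birational := eta_exists_realizes hL hN hκ i
  differentiable _ hx := eta_differentiableAt hx
  canonical _ hx := eta_canonical hκ hx
  maps_solutions := maps_solutions_of_canonical (f := id) (g := id) (O := Set.univ)
    (fun _ => rfl) isOpen_univ differentiableOn_id (fun _ _ => trivial) (fun _ _ => rfl)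
    (fun _ _ => rfl) (fun _ hx => eta_differentiableAt hx) (fun _ hx => hx.1)
    fun _ hx => eta_canonical hκ hx

theorem iota_isSymmetry (hL : 2 ≤ L) (hN : 1 ≤ N) (hκ : κ.Admissible) :
    (iota κ).IsSymmetry κ (iotaParams κ) where
  dom_generic := iota_dom_generic hL hN κ
  birational := iota_exists_realizes hL hN hκ
  differentiable _ hx := iota_differentiableAt hx
  canonical _ hx := iota_canonical hκ hx
  maps_solutions := maps_solutions_of_canonical (f := id) (g := id) (O := Set.univ)
    (fun _ => rfl) isOpen_univ differentiableOn_id (fun _ _ => trivial) (fun _ _ => rfl)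
    (fun _ _ => rfl) (fun _ hx => iota_differentiableAt hx) (fun _ hx => hx.1)
    fun _ hx => iota_canonical hκ hx

/-- `s_j` as a function of `s_1, …, s_N`. -/
noncomputable def sVal (s : Fin N → ℂ) (j : Fin (N + 1)) : ℂ := Fin.cases 1 s j

/-- Action of a permutation on the times. -/
noncomputable def permTimes (π : Equiv.Perm (Fin (N + 1))) (s : Fin N → ℂ) : Fin N → ℂ :=
  fun a => sVal s (π a.succ) / sVal s (π 0)

theorem sVal_permTimes {π : Equiv.Perm (Fin (N + 1))} {s : Fin N → ℂ} (h : sVal s (π 0) ≠ 0)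
    (j : Fin (N + 1)) : sVal (permTimes π s) j = sVal s (π j) / sVal s (π 0) := by
  refine Fin.cases ?_ (fun a => rfl) j
  exact (div_self h).symm

theorem permTimes_permTimes {π ρ : Equiv.Perm (Fin (N + 1))} (hπ : ∀ j, π (ρ j) = j)
    {s : Fin N → ℂ} (h : sVal s (π 0) ≠ 0) : permTimes ρ (permTimes π s) = s := by
  funext a
  rw [permTimes, sVal_permTimes h, sVal_permTimes h, hπ, hπ, div_div_div_cancel_right₀ h]
  exact div_one _

theorem differentiableAt_sVal (j : Fin (N + 1)) (s : Fin N → ℂ) :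
    DifferentiableAt ℂ (fun s : Fin N → ℂ => sVal s j) s := by
  refine Fin.cases ?_ (fun a => ?_) j
  · exact differentiableAt_const _
  · exact differentiableAt_apply a s

theorem perm_isSymmetry (hκ : κ.Admissible) (π : Equiv.Perm (Fin (N + 1))) :
    (permTransf κ π).IsSymmetry κ (permParams π κ) where
  dom_generic := perm_dom_generic κ π
  birational := perm_exists_realizes hκ π
  differentiable _ hx := perm_differentiableAt hx
  canonical _ hx := perm_canonical hκ hx
  maps_solutions := by
    have hinv : ∀ s : Fin N → ℂ, sVal s (π 0) ≠ 0 → sVal (permTimes π s) (π.symm 0) ≠ 0 :=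
      fun s h => by
        rw [sVal_permTimes h, Equiv.apply_symm_apply]
        exact div_ne_zero one_ne_zero h
    -- `O` is the set of times on which the divisor of the inverse time map is non-zero.
    refine maps_solutions_of_canonical (f := permTimes π) (g := permTimes π.symm)
      (O := {s | sVal s (π.symm 0) ≠ 0}) (fun _ => rfl) ?_ ?_ (fun x hx => hinv _ (hx.1.1 _))
      (fun x hx => permTimes_permTimes (fun j => π.apply_symm_apply j) (hx.1.1 _))
      (fun s hs => permTimes_permTimes (fun j => π.symm_apply_apply j) hs)
      (fun _ hx => perm_differentiableAt hx) (fun _ hx => perm_regular hx.1)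
      fun _ hx => perm_canonical hκ hx
    · have : Continuous fun s : Fin N → ℂ => sVal s (π.symm 0) :=
        continuous_iff_continuousAt.2 fun s => (differentiableAt_sVal _ s).continuousAt
      exact isOpen_ne.preimage this
    · intro s hs
      refine DifferentiableAt.differentiableWithinAt (differentiableAt_pi.2 fun a => ?_)
      exact differentiableAt_div (differentiableAt_sVal _ s) (differentiableAt_sVal _ s) hs

theorem zeta_isSymmetry (hκ : κ.Admissible) {i j : Fin (N + 1)} (hij : i ≠ j) :
    (zeta κ i j).IsSymmetry κ (zetaParams i j κ) := by
  rw [zeta_eq_permTransf κ hij]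
  exact perm_isSymmetry hκ _

end Symmetry

/-! ### The group generated by the `ζ_{ij}`. -/

section Group

variable {L N : ℕ} [NeZero L] {κ : Params L N}

theorem realizes_sB {T : Transf L N} {σ : RatField L N ≃ₐ[ℂ] RatField L N} (h : T.Realizes σ)
    (j : Fin (N + 1)) :
    σ (sB (generic L N) j) = sB (T.toFun (RatField L N) (generic L N)) j := by
  refine Fin.cases ?_ (fun a => ?_) j
  · exact map_one σ
  · exact congrFun (congrArg Prod.fst h) a

theorem realizes_qB {T : Transf L N} {σ : RatField L N ≃ₐ[ℂ] RatField L N} (h : T.Realizes σ)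
    (j : Fin (N + 1)) (n : Fin L) :
    σ (qB (generic L N) j n) = qB (T.toFun (RatField L N) (generic L N)) j n := by
  by_cases hn : n = 0
  · rw [hn, qB_zero_right, qB_zero_right, map_one]
  refine Fin.cases ?_ (fun a => ?_) j
  · rw [qB_zero_left, qB_zero_left, map_one]
  · rw [qB_succ _ a ⟨n, hn⟩, qB_succ _ a ⟨n, hn⟩]
    exact congrFun (congrFun (congrArg (fun y => y.2.1) h) a) ⟨n, hn⟩

theorem realizes_pPos {T : Transf L N} {σ : RatField L N ≃ₐ[ℂ] RatField L N} (h : T.Realizes σ)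
    (κ : Params L N) (j : Fin (N + 1)) (n : Idx L) :
    σ (pPos κ (generic L N) j n) = pPos κ (T.toFun (RatField L N) (generic L N)) j n := by
  have hp : ∀ a, σ ((generic L N).2.2 a n) = (T.toFun (RatField L N) (generic L N)).2.2 a n :=
    fun a => congrFun (congrFun (congrArg (fun y => y.2.2) h) a) n
  have hq : ∀ a, σ ((generic L N).2.1 a n) = (T.toFun (RatField L N) (generic L N)).2.1 a n :=
    fun a => congrFun (congrFun (congrArg (fun y => y.2.1) h) a) n
  refine Fin.cases ?_ (fun a => ?_) j
  · simp only [pPos, Fin.cases_zero, map_sub, map_sum, map_mul, hp, hq, AlgEquiv.commutes]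
  · exact hp a

theorem realizes_ext {T : Transf L N} {σ τ : RatField L N ≃ₐ[ℂ] RatField L N}
    (hσ : T.Realizes σ) (hτ : T.Realizes τ) : σ = τ := by
  have h := hσ.trans hτ.symm
  refine algEquiv_ext ?_
  rintro (a | ⟨a, n⟩ | ⟨a, n⟩)
  · exact congrFun (congrArg Prod.fst h) a
  · exact congrFun (congrFun (congrArg (fun y => y.2.1) h) a) n
  · exact congrFun (congrFun (congrArg (fun y => y.2.2) h) a) n

/-- Applying `σ` to the formulas of `ρ` relabels them by `π`, and the divisors with index `π 0`
cancel. -/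
theorem perm_realizes_mul (hκ : κ.Admissible) {π ρ : Equiv.Perm (Fin (N + 1))}
    {σ τ : RatField L N ≃ₐ[ℂ] RatField L N} (hσ : (permTransf κ π).Realizes σ)
    (hτ : (permTransf κ ρ).Realizes τ) : (permTransf κ (π * ρ)).Realizes (σ * τ) := by
  have hs0 := (regular_generic (L := L) (N := N)).1 (π 0)
  have hq0 := fun n => qB_generic_ne_zero (L := L) (N := N) (π 0) n
  obtain ⟨hq, hp⟩ := perm_extended (x := generic L N) hκ (π := π) hq0
  -- Only `n ≠ 0` is needed, where `p_n` involves `κ_n` but no `θ_j`, so the permuted parameters may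
  -- be replaced by `κ`.
  have hpp : ∀ j (n : Idx L), σ (pB κ (generic L N) j n)
      = pB κ (generic L N) (π j) n * qB (generic L N) (π 0) n := fun j n => by
    rw [← hp, pB_idx, realizes_pPos hσ, pB_idx]
    rfl
  refine Prod.ext ?_ (Prod.ext ?_ ?_)
  · funext a
    have h1 : τ ((generic L N).1 a) = _ := congrFun (congrArg Prod.fst hτ) a
    change σ (τ _) = sB _ (π (ρ _)) / sB _ (π (ρ 0))
    rw [h1]
    change σ (sB _ _ / sB _ _) = _
    rw [map_div₀, realizes_sB hσ, realizes_sB hσ, perm_sB hs0, perm_sB hs0,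
      div_div_div_cancel_right₀ hs0]
  · funext a n
    have h1 : τ ((generic L N).2.1 a n) = _ :=
      congrFun (congrFun (congrArg (fun y => y.2.1) hτ) a) n
    change σ (τ _) = qB _ (π (ρ _)) _ / qB _ (π (ρ 0)) _
    rw [h1]
    change σ (qB _ _ _ / qB _ _ _) = _
    rw [map_div₀, realizes_qB hσ, realizes_qB hσ, hq, hq, div_div_div_cancel_right₀ (hq0 _)]
  · funext a n
    have h1 : τ ((generic L N).2.2 a n) = _ :=
      congrFun (congrFun (congrArg (fun y => y.2.2) hτ) a) n
    change σ (τ _) = pB _ _ (π (ρ _)) _ * qB _ (π (ρ 0)) _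
    rw [h1]
    change σ (pB _ _ _ _ * qB _ _ _) = _
    rw [map_mul, realizes_qB hσ, hpp, hq, mul_assoc, mul_div_cancel₀ _ (hq0 _)]

/-- The permutations of `0, …, N`, as automorphisms of `ℂ(s, q, p)`. -/
noncomputable def permAut (hκ : κ.Admissible) :
    Equiv.Perm (Fin (N + 1)) →* (RatField L N ≃ₐ[ℂ] RatField L N) :=
  MonoidHom.mk' (fun π => (perm_exists_realizes hκ π).choose) fun π ρ =>
    realizes_ext (perm_exists_realizes hκ (π * ρ)).choose_spec
      (perm_realizes_mul hκ (perm_exists_realizes hκ π).choose_spec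
        (perm_exists_realizes hκ ρ).choose_spec)

theorem permAut_realizes (hκ : κ.Admissible) (π : Equiv.Perm (Fin (N + 1))) :
    (permTransf κ π).Realizes (permAut hκ π) := (perm_exists_realizes hκ π).choose_spec

theorem permAut_injective (hκ : κ.Admissible) : Function.Injective (permAut hκ) := by
  rw [injective_iff_map_eq_one]
  intro π hπ
  have hs0 := (regular_generic (L := L) (N := N)).1 (π 0)
  have h : ∀ j, sB (generic L N) j = sB (generic L N) (π j) / sB (generic L N) (π 0) := fun j => by
    have h1 := realizes_sB (permAut_realizes hκ π) j
    rwa [hπ, perm_sB hs0] at h1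
  have h0 : π 0 = 0 := by
    have h1 := h (π.symm 0)
    rw [Equiv.apply_symm_apply, sB_zero, eq_div_iff hs0] at h1
    -- At `s_j = j + 1` the relation `s_{π⁻¹ 0} s_{π 0} = 1` says that a product of positive
    -- integers is 1, so `π 0 = 0`.
    have hspec := ((specializes_sB (stdPoint (L := L) (N := N) 0 0) (π.symm 0)).mul
      (specializes_sB (stdPoint 0 0) (π 0))).sub (specializes_one _)
    rw [h1, sub_self, sB_stdPoint, sB_stdPoint] at hspec
    by_contra hne
    refine hspec.ne_zero ?_ rfl
    have hpos : 0 < ((π 0 : Fin (N + 1)) : ℕ) := Nat.pos_of_ne_zero fun h => hne (Fin.ext h)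
    rw [sub_ne_zero]
    intro h2
    have h3 : (((π.symm 0 : Fin (N + 1)) : ℕ) + 1) * (((π 0 : Fin (N + 1)) : ℕ) + 1) = 1 := by
      exact_mod_cast h2
    have := (mul_eq_one.1 h3).2
    omega
  ext j
  have h1 := h j
  rw [h0, sB_zero, div_one] at h1
  rw [← regular_generic.2 h1]
  rfl

/-- The `ζ_{ij}` are the images of the transpositions, which generate the symmetric group. -/
theorem zetaGroup_eq_range (hκ : κ.Admissible) : zetaGroup κ = (permAut hκ).range := by
  have hgen : {σ | ∃ i j, i ≠ j ∧ (zeta κ i j).Realizes σ}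
      = permAut hκ '' {π | π.IsSwap} := by
    ext σ
    constructor
    · rintro ⟨i, j, hij, h⟩
      rw [zeta_eq_permTransf κ hij] at h
      exact ⟨Equiv.swap i j, ⟨i, j, hij, rfl⟩, realizes_ext (permAut_realizes hκ _) h⟩
    · rintro ⟨_, ⟨i, j, hij, rfl⟩, rfl⟩
      refine ⟨i, j, hij, ?_⟩
      rw [zeta_eq_permTransf κ hij]
      exact permAut_realizes hκ _
  rw [zetaGroup, hgen, ← MonoidHom.map_closure, Equiv.Perm.closure_isSwap, MonoidHom.range_eq_map]

theorem exists_perm_mulEquiv_zetaGroup (hκ : κ.Admissible) :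
    ∃ φ : Equiv.Perm (Fin (N + 1)) ≃* zetaGroup κ, ∀ i j : Fin (N + 1), i ≠ j →
      (zeta κ i j).Realizes (φ (Equiv.swap i j) : RatField L N ≃ₐ[ℂ] RatField L N) := by
  refine ⟨(MonoidHom.ofInjective (permAut_injective hκ)).trans
    (MulEquiv.subgroupCongr (zetaGroup_eq_range hκ).symm), fun i j hij => ?_⟩
  rw [zeta_eq_permTransf κ hij]
  exact permAut_realizes hκ _

end Group

end HLN

theorem mainTheorem6 (L N : ℕ) [NeZero L] (hL : 2 ≤ L) (hN : 1 ≤ N)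
    (κ : HLN.Params L N) (hκ : κ.Admissible) :
    (∀ i : Fin (N + 1),
      (HLN.etaParams i κ).Admissible ∧
      (HLN.eta κ i).IsSymmetry κ (HLN.etaParams i κ) ∧
      (κ.θ i ≠ 0 → ∀ (F : Type) [Field F] [Algebra ℂ F] (x : HLN.Phase L N F),
        (HLN.eta κ i).Dom F x → HLN.EtaFormulas κ i x)) ∧
    (∀ i j : Fin (N + 1), i ≠ j →
      (HLN.zetaParams i j κ).Admissible ∧
      (HLN.zeta κ i j).IsSymmetry κ (HLN.zetaParams i j κ)) ∧
    (∃ φ : Equiv.Perm (Fin (N + 1)) ≃* HLN.zetaGroup κ,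
      ∀ i j : Fin (N + 1), i ≠ j →
        (HLN.zeta κ i j).Realizes (φ (Equiv.swap i j) : HLN.RatField L N ≃ₐ[ℂ] HLN.RatField L N)) ∧
    ((HLN.iotaParams κ).Admissible ∧
      (HLN.iota κ).IsSymmetry κ (HLN.iotaParams κ)) :=
  ⟨fun i => ⟨HLN.etaParams_admissible hκ i, HLN.eta_isSymmetry hL hN hκ i,
      fun hθ _ _ _ _ hx => HLN.etaFormulas_of_dom hκ hθ hx⟩,
    fun i j hij => ⟨HLN.zetaParams_admissible hκ i j, HLN.zeta_isSymmetry hκ hij⟩,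
    HLN.exists_perm_mulEquiv_zetaGroup hκ,
    HLN.iotaParams_admissible hκ, HLN.iota_isSymmetry hL hN hκ⟩
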